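/- Let $k$ be a field. All Hopf algebras, modules and tensor products are over $k$; we use Sweedler notation $\Delta(h)=h_{(1)}\otimes h_{(2)}$ in a Hopf algebra, $\delta(m)=m_{(-1)}\otimes m_{(0)}$ for left coactions, and $\Delta_R(r)=r^{(1)}\otimes r^{(2)}$ in a braided Hopf algebra $R$. **Conventions.** A (left-left) Yetter-Drinfel'd module over a Hopf algebra $H$ is a left $H$-module and left $H$-comodule $M$ with $\delta(hm)=h_{(1)}m_{(-1)}S(h_{(3)})\otimes h_{(2)}m_{(0)}$; these form a category ${}^H_H\mathcal{YD}$ with braiding $c(m\otimes n)=m_{(-1)}n\otimes m_{(0)}$. A Nichols algebra of $W\in{}^H_H\mathcal{YD}$ is a braided Hopf algebra $\mathcal B(W)=\bigoplus_{n\ge0}R(n)$ in ${}^H_H\mathcal{YD}$, graded as an algebra and as a coalgebra, with $c(R(i)\otimes R(j))\subseteq R(j)\otimes R(i)$, together with an isomorphism $W\cong R(1)$ of Yetter-Drinfel'd modules, such that $R(1)$ generates $\mathcal B(W)$ as an algebra and $R(1)$ is exactly the space of primitive elements of $\mathcal B(W)$. We regard $W$ as a subspace of $\mathcal B(W)$ through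 this isomorphism. For a braided Hopf algebra $R$ in ${}^H_H\mathcal{YD}$, the Radford biproduct $R\#H$ is the Hopf algebra with underlying space $R\otimes H$, product $(r\#h)(r'\#h')=r(h_{(1)}r')\#h_{(2)}h'$ and coproduct $\Delta(r\#h)=\bigl(r^{(1)}\#r^{(2)}{}_{(-1)}h_{(1)}\bigr)\otimes\bigl(r^{(2)}{}_{(0)}\#h_{(2)}\bigr)$. **Situation.** Let $H$ be a Hopf algebra with bijective antipode, $V\in{}^H_H\mathcal{YD}$, and $A:=\mathcal B(V)\#H$, graded by $A(n)=\mathcal B(V)(n)\#H$. Let $M$ be a graded Yetter-Drinfel'd module over $A$ of highest weight, that is: $M\in{}^A_A\mathcal{YD}$ has a vector space grading $M=\bigoplus_{n\ge1}M(n)$ for which action and coaction are graded maps; the space of highest weight vectors $M_H:=\{m\in M\mid\delta(m)\in H\otimes M\}$ equals $M(1)$; and $M$ is generated by $M_H$ as an $A$-module. By restriction of the structure maps, $M_H$ is a Yetter-Drinfel'd module over $H$, hence so is $M_H\oplus V$. Let $T_c(M)$ and $T_c(M_H\oplus V)$ be the tensor algebras of $M\in{}^A_A\mathcal{YD}$ and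 of $M_H\oplus V\in{}^H_H\mathcal{YD}$; $A$ acts on $T_c(M)$ and $H$ on $T_c(M_H\oplus V)$ diagonally, extending the given actions on $M$ and on $M_H\oplus V$ (so that these are module algebras). Let $\pi:T_c(M)\to\mathcal B(M)$ and $q:T_c(M_H\oplus V)\to\mathcal B(M_H\oplus V)$ be the algebra morphisms that restrict to the identity on $M$ and on $M_H\oplus V$, respectively. Let $T_c(M)\#\mathcal B(V)$ be the algebra with underlying space $T_c(M)\otimes\mathcal B(V)$, unit $1\#1$ and product $$(x\#r)(x'\#r')=x\bigl((r^{(1)}\#r^{(2)}{}_{(-1)})\cdot x'\bigr)\#r^{(2)}{}_{(0)}r',$$ and let $p:T_c(M_H\oplus V)\to T_c(M)\#\mathcal B(V)$ be the algebra morphism with $p(m)=m\#1$ for $m\in M_H$ and $p(v)=1\#v$ for $v\in V$. **Proposition.** Let $X\subseteq T_c(M_H\oplus V)$ be a subset such that $H\cdot X=\{hx\mid h\in H,\ x\in X\}$ generates $\ker q$ as a two-sided ideal. For $x\in X$ write $p(x)=\sum_i m_i^x\#v_i^x$ with $m_i^x\in T_c(M)$ and $v_i^x\in\mathcal B(V)$,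 and set $$\hat X:=\Bigl\{\sum_i m_i^x\bigl((v_i^x\#1)\cdot m\bigr)\ \Big|\ x\in X,\ m\in T_c(M)\Bigr\}\subseteq T_c(M)$$ (the sum depends only on $p(x)$ and $m$). Then $A\cdot\hat X=\{az\mid a\in A,\ z\in\hat X\}$ generates $\ker\pi$ as a two-sided ideal of $T_c(M)$. -/

import Mathlib

open scoped TensorProduct
open Coalgebra

noncomputable section

namespace YDNichols

/-! Shortcuts for instance search. -/

section HomClass

variable {k M N : Type*} [Semiring k] [AddCommMonoid M] [AddCommMonoid N] [Module k M] [Module k N]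

theorem zeroHomClass_linearEquiv : ZeroHomClass (M ≃ₗ[k] N) M N := inferInstance

theorem zeroHomClass_linearMap : ZeroHomClass (M →ₗ[k] N) M N := inferInstance

theorem addHomClass_linearEquiv : AddHomClass (M ≃ₗ[k] N) M N := inferInstance

theorem addHomClass_linearMap : AddHomClass (M →ₗ[k] N) M N := inferInstance

end HomClass

attribute [local instance 2000] zeroHomClass_linearEquiv zeroHomClass_linearMap
  addHomClass_linearEquiv addHomClass_linearMap

/-! ### Modules, comodules and Yetter-Drinfel'd modules -/

section Basic

variable (k H M N : Type*) [Field k]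

/-- The action of `H` on `M` as a bilinear map. -/
def act [Ring H] [Algebra k H] [AddCommGroup M] [Module k M] [Module H M] [IsScalarTower k H M] :
    H →ₗ[k] M →ₗ[k] M :=
  (Algebra.lsmul k k M).toLinearMap

@[simp] theorem act_apply [Ring H] [Algebra k H] [AddCommGroup M] [Module k M] [Module H M]
    [IsScalarTower k H M] (h : H) (m : M) : act k H M h m = h • m := rfl

/-- A left comodule over a coalgebra `H`, with coaction `m ↦ m₍₋₁₎ ⊗ m₍₀₎`. -/
class LeftComodule (k H M : Type*) [Field k] [AddCommGroup H] [Module k H] [Coalgebra k H]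
    [AddCommGroup M] [Module k M] where
  /-- the coaction -/
  coact (k H) : M →ₗ[k] H ⊗[k] M
  coact_coassoc : ∀ m : M,
    TensorProduct.assoc k H H M ((comul (R := k) (A := H)).rTensor M (coact m)) =
      coact.lTensor H (coact m)
  coact_counit : ∀ m : M,
    TensorProduct.lid k M ((counit (R := k) (A := H)).rTensor M (coact m)) = m

open LeftComodule

/-- The diagonal action `h (m ⊗ n) = h₍₁₎ m ⊗ h₍₂₎ n` on a tensor product. -/
def diagAct [Ring H] [Bialgebra k H]
    [AddCommGroup M] [Module k M] [Module H M] [IsScalarTower k H M]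
    [AddCommGroup N] [Module k N] [Module H N] [IsScalarTower k H N] :
    H →ₗ[k] (M ⊗[k] N) →ₗ[k] (M ⊗[k] N) :=
  TensorProduct.map₂ (act k H M) (act k H N) ∘ₗ comul

section Hopf

variable [Ring H] [HopfAlgebra k H]
  [AddCommGroup M] [Module k M] [Module H M] [IsScalarTower k H M]
  [AddCommGroup N] [Module k N] [Module H N] [IsScalarTower k H N]

/-- `a ⊗ (b ⊗ c)` and `g ⊗ m` are sent to `a g S(c) ⊗ b m`. -/
def ydMap : (H ⊗[k] (H ⊗[k] H)) →ₗ[k] (H ⊗[k] M) →ₗ[k] (H ⊗[k] M) :=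
  TensorProduct.lift <|
    (LinearMap.mul k (Module.End k (H ⊗[k] M))).compl₁₂
      (LinearMap.rTensorHom M ∘ₗ LinearMap.mul k H)
      (TensorProduct.map₂ (LinearMap.mul k H).flip (act k H M) ∘ₗ
        (TensorProduct.comm k H H).toLinearMap ∘ₗ
          (HopfAlgebra.antipode k (A := H)).lTensor H)

@[simp] theorem ydMap_tmul (a b c g : H) (m : M) :
    ydMap k H M (a ⊗ₜ (b ⊗ₜ c)) (g ⊗ₜ m) =
      (a * (g * HopfAlgebra.antipode k c)) ⊗ₜ (b • m) := by
  simp [ydMap]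

/-- A left-left Yetter-Drinfel'd module over the Hopf algebra `H`:
`δ(h m) = h₍₁₎ m₍₋₁₎ S(h₍₃₎) ⊗ h₍₂₎ m₍₀₎`. -/
class YetterDrinfeld (k H M : Type*) [Field k] [Ring H] [HopfAlgebra k H]
    [AddCommGroup M] [Module k M] [Module H M] [IsScalarTower k H M] extends LeftComodule k H M where
  coact_smul : ∀ (h : H) (m : M),
    coact (h • m) =
      ydMap k H M ((comul (R := k) (A := H)).lTensor H (comul (R := k) h)) (coact m)

/-- The codiagonal coaction `m ⊗ n ↦ m₍₋₁₎ n₍₋₁₎ ⊗ (m₍₀₎ ⊗ n₍₀₎)` on a tensor product. -/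
def codiagCoact [LeftComodule k H M] [LeftComodule k H N] :
    (M ⊗[k] N) →ₗ[k] H ⊗[k] (M ⊗[k] N) :=
  (LinearMap.mul' k H).rTensor (M ⊗[k] N) ∘ₗ
    (TensorProduct.tensorTensorTensorComm k H M H N).toLinearMap ∘ₗ
      TensorProduct.map (coact k H) (coact k H)

/-- The braiding `c(m ⊗ n) = m₍₋₁₎ n ⊗ m₍₀₎`. -/
def braiding [LeftComodule k H M] : (M ⊗[k] N) →ₗ[k] (N ⊗[k] M) :=
  (TensorProduct.lift (act k H N)).rTensor M ∘ₗ
    (TensorProduct.assoc k H N M).symm.toLinearMap ∘ₗ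
      (TensorProduct.comm k M N).toLinearMap.lTensor H ∘ₗ
        (TensorProduct.assoc k H M N).toLinearMap ∘ₗ
          (coact k H).rTensor N

end Hopf

/-- `R` is an `H`-module algebra: `h 1 = ε(h) 1` and `h (a b) = (h₍₁₎ a) (h₍₂₎ b)`. -/
class IsModuleAlgebra (R : Type*) [Ring H] [Bialgebra k H] [Ring R] [Algebra k R]
    [Module H R] [IsScalarTower k H R] : Prop where
  smul_one : ∀ h : H, h • (1 : R) = algebraMap k R (counit h)
  smul_mul : ∀ (h : H) (a b : R), h • (a * b) = LinearMap.mul' k R (diagAct k H R R h (a ⊗ₜ b))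

section BraidedHopf

variable (R : Type*) [Ring H] [HopfAlgebra k H]
  [Ring R] [Algebra k R] [Module H R] [IsScalarTower k H R]

/-- The multiplication `(a ⊗ b) (c ⊗ d) = a (b₍₋₁₎ c) ⊗ b₍₀₎ d` of the braided tensor product,
i.e. `(m ⊗ m) (id ⊗ c ⊗ id)`. -/
def braidedMul [LeftComodule k H R] : ((R ⊗[k] R) ⊗[k] (R ⊗[k] R)) →ₗ[k] (R ⊗[k] R) :=
  TensorProduct.map (LinearMap.mul' k R) (LinearMap.mul' k R) ∘ₗ
    (TensorProduct.assoc k R R (R ⊗[k] R)).symm.toLinearMap ∘ₗ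
      ((TensorProduct.assoc k R R R).toLinearMap ∘ₗ
        (braiding k H R R).rTensor R ∘ₗ
          (TensorProduct.assoc k R R R).symm.toLinearMap).lTensor R ∘ₗ
        (TensorProduct.assoc k R R (R ⊗[k] R)).toLinearMap

/-- A braided Hopf algebra `R` in the category of Yetter-Drinfel'd modules over `H`: an algebra and
coalgebra in that category (all structure maps are `H`-linear and `H`-colinear) such that
`Δ : R → R ⊗ R` (with the braided product on `R ⊗ R`) and `ε` are algebra maps, and such that the
identity has a convolution inverse. -/
class BraidedHopfAlgebra (k H R : Type*) [Field k] [Ring H] [HopfAlgebra k H]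
    [Ring R] [Algebra k R] [Module H R] [IsScalarTower k H R] [Coalgebra k R] extends YetterDrinfeld k H R, IsModuleAlgebra k H R where
  coact_one : coact (1 : R) = 1 ⊗ₜ 1
  coact_mul : ∀ a b : R,
    coact (a * b) = (LinearMap.mul' k R).lTensor H (codiagCoact k H R R (a ⊗ₜ b))
  comul_smul : ∀ (h : H) (a : R), comul (R := k) (h • a) = diagAct k H R R h (comul a)
  counit_smul : ∀ (h : H) (a : R), counit (R := k) (h • a) = counit (R := k) h * counit (R := k) a
  coact_comul : ∀ a : R,
    (comul (R := k) (A := R)).lTensor H (coact a) = codiagCoact k H R R (comul a)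
  coact_counit' : ∀ a : R, (counit (R := k) (A := R)).lTensor H (coact a) = 1 ⊗ₜ counit a
  comul_one : comul (R := k) (1 : R) = 1 ⊗ₜ 1
  comul_mul : ∀ a b : R,
    comul (R := k) (a * b) = braidedMul k H R (comul a ⊗ₜ comul b)
  counit_one : counit (R := k) (1 : R) = 1
  counit_mul : ∀ a b : R, counit (R := k) (a * b) = counit (R := k) a * counit (R := k) b
  /-- the antipode -/
  antipode (k H) : R →ₗ[k] R
  mul_antipode_left : ∀ a : R,
    LinearMap.mul' k R (antipode.rTensor R (comul a)) = algebraMap k R (counit a)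
  mul_antipode_right : ∀ a : R,
    LinearMap.mul' k R (antipode.lTensor R (comul a)) = algebraMap k R (counit a)

end BraidedHopf

end Basic

/-! ### Smash products -/

/-- The smash product `R # H`, with underlying space `R ⊗ H`. -/
def Smash (k R H : Type*) [Field k] [AddCommGroup R] [Module k R] [AddCommGroup H] [Module k H] :
    Type _ := R ⊗[k] H

namespace Smash

section

variable {k R H : Type*} [Field k] [AddCommGroup R] [Module k R] [AddCommGroup H] [Module k H]

instance (priority := 50) : AddCommGroup (Smash k R H) := inferInstanceAs (AddCommGroup (R ⊗[k] H))
instance (priority := 50) : Module k (Smash k R H) := inferInstanceAs (Module k (R ⊗[k] H))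

/-- The identification of `R ⊗ H` with `R # H`. -/
def ofTensor : (R ⊗[k] H) ≃ₗ[k] Smash k R H := LinearEquiv.refl k _

/-- The element `r # h`. -/
def mk (r : R) (h : H) : Smash k R H := ofTensor (r ⊗ₜ h)

@[elab_as_elim]
theorem induction_on {p : Smash k R H → Prop} (x : Smash k R H) (zero : p 0)
    (mk : ∀ r h, p (mk r h)) (add : ∀ x y, p x → p y → p (x + y)) : p x :=
  TensorProduct.induction_on (motive := p) x zero mk add

end

section Ring

variable {k R H : Type*} [Field k] [Ring H] [Bialgebra k H] [Ring R] [Algebra k R]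
  [Module H R] [IsScalarTower k H R]

variable (k R H) in
/-- `x # h` acts on `R # H` by `r' # h' ↦ r (h₍₁₎ r') # h₍₂₎ h'`. -/
def mulL : (R ⊗[k] H) →ₗ[k] Module.End k (R ⊗[k] H) :=
  TensorProduct.lift <| (LinearMap.mul k (Module.End k (R ⊗[k] H))).compl₁₂
    (LinearMap.rTensorHom H ∘ₗ LinearMap.mul k R) (diagAct k H R H)

theorem mulL_tmul (r : R) (h : H) (y : R ⊗[k] H) :
    mulL k R H (r ⊗ₜ h) y = (LinearMap.mulLeft k r).rTensor H (diagAct k H R H h y) := rfl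

instance : Mul (Smash k R H) := ⟨fun x y => ofTensor (mulL k R H (ofTensor.symm x) (ofTensor.symm y))⟩
instance : One (Smash k R H) := ⟨mk 1 1⟩

theorem diagAct_apply {M N : Type*} [AddCommGroup M] [Module k M] [Module H M] [IsScalarTower k H M]
    [AddCommGroup N] [Module k N] [Module H N] [IsScalarTower k H N] (h : H) (y : M ⊗[k] N) :
    diagAct k H M N h y = TensorProduct.map₂ (act k H M) (act k H N) (comul h) y := rfl

theorem diagAct_one {M N : Type*} [AddCommGroup M] [Module k M] [Module H M] [IsScalarTower k H M]
    [AddCommGroup N] [Module k N] [Module H N] [IsScalarTower k H N] :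
    diagAct k H M N 1 = 1 := by
  ext m n
  simp [diagAct, Algebra.TensorProduct.one_def]

theorem diagAct_mul {M N : Type*} [AddCommGroup M] [Module k M] [Module H M] [IsScalarTower k H M]
    [AddCommGroup N] [Module k N] [Module H N] [IsScalarTower k H N] (g h : H) :
    diagAct k H M N (g * h) = diagAct k H M N g * diagAct k H M N h := by
  have key : ∀ s t : H ⊗[k] H, TensorProduct.map₂ (act k H M) (act k H N) (s * t) =
      TensorProduct.map₂ (act k H M) (act k H N) s * TensorProduct.map₂ (act k H M) (act k H N) t := by
    intro s t
    induction s using TensorProduct.induction_on with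
    | zero => simp
    | add x y hx hy => simp [add_mul, hx, hy]
    | tmul a b =>
      induction t using TensorProduct.induction_on with
      | zero => simp
      | add x y hx hy => simp [mul_add, hx, hy]
      | tmul c d => ext m n; simp [mul_smul]
  simp [diagAct, key]

theorem mk_mul_mk (r r' : R) (h h' : H) :
    (mk r h : Smash k R H) * mk r' h' =
      ofTensor ((LinearMap.mulLeft k r).rTensor H (diagAct k H R H h (r' ⊗ₜ h'))) := rfl

variable [IsModuleAlgebra k H R]

theorem diagAct_mulLeft (h : H) (r : R) (y : R ⊗[k] H) :
    diagAct k H R H h ((LinearMap.mulLeft k r).rTensor H y) =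
      mulL k R H ((act k H R).flip r |>.rTensor H <| comul h) y := by
  induction y using TensorProduct.induction_on with
  | zero => simp
  | add x y hx hy => rw [map_add, map_add, map_add, hx, hy]
  | tmul r' h' =>
    let F : H ⊗[k] (H ⊗[k] H) →ₗ[k] R ⊗[k] H :=
      TensorProduct.map (LinearMap.mul' k R) LinearMap.id ∘ₗ
        (TensorProduct.assoc k R R H).symm.toLinearMap ∘ₗ
        TensorProduct.map ((act k H R).flip r) (TensorProduct.map ((act k H R).flip r') ((LinearMap.mul k H).flip h'))
    have h1 : ∀ t : H ⊗[k] H, TensorProduct.map₂ (act k H R) (act k H H) t ((r * r') ⊗ₜ h') =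
        F (TensorProduct.assoc k H H H (comul.rTensor H t)) := by
      intro t
      induction t using TensorProduct.induction_on with
      | zero => simp
      | add x y hx hy => simp only [map_add, LinearMap.add_apply, hx, hy]
      | tmul a b =>
        simp only [TensorProduct.map₂_apply_tmul, act_apply, TensorProduct.map_tmul, IsModuleAlgebra.smul_mul (k := k),
          LinearMap.rTensor_tmul, diagAct, LinearMap.comp_apply]
        generalize comul (R := k) a = s
        induction s using TensorProduct.induction_on with
        | zero => simp
        | add x y hx hy => simp only [map_add, LinearMap.add_apply, hx, hy, TensorProduct.add_tmul]
        | tmul c d => simp [F]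
    have h2 : ∀ t : H ⊗[k] H, mulL k R H (((act k H R).flip r).rTensor H t) (r' ⊗ₜ h') =
        F (comul.lTensor H t) := by
      intro t
      induction t using TensorProduct.induction_on with
      | zero => simp
      | add x y hx hy => simp only [map_add, LinearMap.add_apply, hx, hy]
      | tmul a b =>
        simp only [LinearMap.rTensor_tmul, LinearMap.lTensor_tmul, mulL_tmul, diagAct, LinearMap.comp_apply]
        generalize comul (R := k) b = s
        induction s using TensorProduct.induction_on with
        | zero => simp
        | add x y hx hy => simp only [map_add, LinearMap.add_apply, hx, hy, TensorProduct.tmul_add]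
        | tmul c d => simp [F]
    rw [h2, ← coassoc_apply, ← h1]
    simp [diagAct]

theorem mulL_mulL (x y : R ⊗[k] H) : mulL k R H (mulL k R H x y) = mulL k R H x * mulL k R H y := by
  induction x using TensorProduct.induction_on with
  | zero => simp
  | add x x' hx hx' => simp only [map_add, LinearMap.add_apply, hx, hx', add_mul]
  | tmul r h =>
    induction y using TensorProduct.induction_on with
    | zero => simp
    | add x y hx hy => simp only [map_add, hx, hy, mul_add]
    | tmul r' h' =>
      refine LinearMap.ext fun z => ?_
      rw [Module.End.mul_apply, mulL_tmul r' h' z, mulL_tmul r h, mulL_tmul r h, diagAct_mulLeft,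
        diagAct_apply h (r' ⊗ₜ h')]
      generalize comul (R := k) h = t
      induction t using TensorProduct.induction_on with
      | zero => simp
      | add x y hx hy => simp only [map_add, LinearMap.add_apply, hx, hy]
      | tmul a b =>
        simp only [TensorProduct.map₂_apply_tmul, act_apply, LinearMap.rTensor_tmul,
          TensorProduct.map_tmul, LinearMap.mulLeft_apply, mulL_tmul, smul_eq_mul, diagAct_mul, LinearMap.flip_apply,
          LinearMap.mulLeft_mul, LinearMap.rTensor_comp, LinearMap.comp_apply,
          Module.End.mul_apply]

theorem mulL_one (x : R ⊗[k] H) : mulL k R H x (1 ⊗ₜ 1) = x := by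
  induction x using TensorProduct.induction_on with
  | zero => simp
  | add x x' hx hx' => simp only [map_add, LinearMap.add_apply, hx, hx']
  | tmul r h =>
    have : ∀ t : H ⊗[k] H, TensorProduct.map₂ (act k H R) (act k H H) t (1 ⊗ₜ 1) =
        (Algebra.linearMap k R).rTensor H (counit.rTensor H t) := by
      intro t
      induction t using TensorProduct.induction_on with
      | zero => simp
      | add x y hx hy => simp only [map_add, LinearMap.add_apply, hx, hy]
      | tmul a b => simp [IsModuleAlgebra.smul_one (k := k)]
    rw [mulL_tmul, diagAct_apply, this]
    simp

instance : Ring (Smash k R H) where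
  mul_assoc x y z := congrArg ofTensor (LinearMap.congr_fun (mulL_mulL x y) z)
  one_mul x := by
    have h : ∀ y : R ⊗[k] H, mulL k R H ((1 : R) ⊗ₜ (1 : H)) y = y := fun y => by
      rw [mulL_tmul, diagAct_one]
      simp
    exact congrArg ofTensor (h (ofTensor.symm x))
  mul_one x := mulL_one x
  left_distrib x y z := map_add (mulL k R H x) y z
  right_distrib x y z := LinearMap.congr_fun (map_add (mulL k R H) x y) z
  zero_mul x := LinearMap.congr_fun (map_zero (mulL k R H)) x
  mul_zero x := map_zero (mulL k R H x)
  zsmul := fun n x => n • x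
  zsmul_zero' := SubNegMonoid.zsmul_zero'
  zsmul_succ' := SubNegMonoid.zsmul_succ'
  zsmul_neg' := SubNegMonoid.zsmul_neg'
  neg_add_cancel := neg_add_cancel

instance : Algebra k (Smash k R H) :=
  Algebra.ofModule
    (fun c x y => LinearMap.congr_fun (map_smul (mulL k R H) c x) y)
    (fun c x y => map_smul (mulL k R H x) c y)

/-- The algebra inclusion `r ↦ r # 1`. -/
def inl : R →ₐ[k] Smash k R H :=
  AlgHom.ofLinearMap (ofTensor.toLinearMap ∘ₗ (TensorProduct.mk k R H).flip 1) rfl (by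
    intro r r'
    change _ = ofTensor (mulL k R H (r ⊗ₜ 1) (r' ⊗ₜ 1))
    rw [mulL_tmul, diagAct_one]
    simp)

/-- The algebra inclusion `h ↦ 1 # h`. -/
def inr : H →ₐ[k] Smash k R H :=
  AlgHom.ofLinearMap (ofTensor.toLinearMap ∘ₗ TensorProduct.mk k R H 1) rfl (by
    intro h h'
    change _ = ofTensor (mulL k R H (1 ⊗ₜ h) (1 ⊗ₜ h'))
    have : ∀ t : H ⊗[k] H, TensorProduct.map₂ (act k H R) (act k H H) t (1 ⊗ₜ h') =
        TensorProduct.map (Algebra.linearMap k R) ((LinearMap.mul k H).flip h')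
          (counit.rTensor H t) := by
      intro t
      induction t using TensorProduct.induction_on with
      | zero => simp
      | add x y hx hy => simp only [map_add, LinearMap.add_apply, hx, hy]
      | tmul a b => simp [IsModuleAlgebra.smul_one (k := k)]
    rw [mulL_tmul, diagAct_apply, this]
    simp)

theorem inl_mul_inr (r : R) (h : H) : (inl r * inr h : Smash k R H) = mk r h := by
  change ofTensor (mulL k R H (r ⊗ₜ 1) (1 ⊗ₜ h)) = _
  rw [mulL_tmul, diagAct_one]
  simp [mk]

/-- `(1 # h) (r # 1) = h₍₁₎ r # h₍₂₎`. -/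
theorem inr_mul_inl (h : H) (r : R) :
    (inr h * inl r : Smash k R H) = ofTensor (((act k H R).flip r).rTensor H (comul h)) := by
  change ofTensor (mulL k R H (1 ⊗ₜ h) (r ⊗ₜ 1)) = _
  rw [mulL_tmul, diagAct_apply]
  generalize comul (R := k) h = t
  induction t using TensorProduct.induction_on with
  | zero => simp
  | add x y hx hy => simp only [map_add, LinearMap.add_apply, hx, hy]
  | tmul a b => simp

theorem ofTensor_tmul (r : R) (h : H) : (ofTensor (r ⊗ₜ h) : Smash k R H) = inl r * inr h :=
  (inl_mul_inr r h).symm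

section Lift

variable {B : Type*} [Semiring B] [Algebra k B]

/-- Algebra maps out of a smash product. -/
def lift (f : R →ₐ[k] B) (g : H →ₐ[k] B)
    (hfg : ∀ h r, g h * f r =
      LinearMap.mul' k B (TensorProduct.map (f.toLinearMap ∘ₗ (act k H R).flip r) g.toLinearMap
        (comul h))) : Smash k R H →ₐ[k] B :=
  AlgHom.ofLinearMap
    (LinearMap.mul' k B ∘ₗ TensorProduct.map f.toLinearMap g.toLinearMap ∘ₗ
      ofTensor.symm.toLinearMap)
    (by change LinearMap.mul' k B (TensorProduct.map f.toLinearMap g.toLinearMap (1 ⊗ₜ 1)) = 1; simp)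
    (by
      intro x y
      induction x using Smash.induction_on with
      | zero => simp
      | add x x' hx hx' => simp only [add_mul, map_add, hx, hx']
      | mk r h =>
        induction y using Smash.induction_on with
        | zero => simp
        | add x x' hx hx' => simp only [mul_add, map_add, hx, hx']
        | mk r' h' =>
          have hΦ : ∀ (r : R) (h : H), (LinearMap.mul' k B ∘ₗ
              TensorProduct.map f.toLinearMap g.toLinearMap ∘ₗ ofTensor.symm.toLinearMap)
              (inl r * inr h : Smash k R H) = f r * g h := fun r h => by
            rw [inl_mul_inr]; simp [Smash.mk]
          rw [← inl_mul_inr, ← inl_mul_inr, hΦ, hΦ, mul_assoc, ← mul_assoc (inr h), inr_mul_inl,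
            mul_assoc (f r), ← mul_assoc (g h), hfg]
          generalize comul (R := k) h = t
          induction t using TensorProduct.induction_on with
          | zero => simp
          | add x y hx hy => simp only [map_add, add_mul, mul_add, hx, hy]
          | tmul a b =>
            rw [LinearMap.rTensor_tmul, ofTensor_tmul, mul_assoc, ← map_mul, ← mul_assoc,
              ← map_mul, hΦ]
            simp [mul_assoc])

theorem lift_inl (f : R →ₐ[k] B) (g : H →ₐ[k] B) (hfg) (r : R) :
    lift f g hfg (inl r) = f r := by
  change LinearMap.mul' k B (TensorProduct.map f.toLinearMap g.toLinearMap (r ⊗ₜ 1)) = _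
  simp

theorem lift_inr (f : R →ₐ[k] B) (g : H →ₐ[k] B) (hfg) (h : H) :
    lift f g hfg (inr h) = g h := by
  change LinearMap.mul' k B (TensorProduct.map f.toLinearMap g.toLinearMap (1 ⊗ₜ h)) = _
  simp

theorem algHom_ext {f g : Smash k R H →ₐ[k] B} (h1 : ∀ r, f (inl r) = g (inl r))
    (h2 : ∀ h, f (inr h) = g (inr h)) : f = g := by
  refine AlgHom.ext fun x => ?_
  induction x using Smash.induction_on with
  | zero => simp
  | add x y hx hy => simp only [map_add, hx, hy]
  | mk r h => rw [← inl_mul_inr, map_mul, map_mul, h1, h2]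

end Lift

end Ring

end Smash

open LeftComodule

section Radford

variable {k H : Type*} [Field k] [Ring H] [HopfAlgebra k H]

/-- The Yetter-Drinfel'd condition in the form
`(h₍₁₎ m)₍₋₁₎ h₍₂₎ ⊗ (h₍₁₎ m)₍₀₎ = h₍₁₎ m₍₋₁₎ ⊗ h₍₂₎ m₍₀₎`. -/
theorem yd_condition {M : Type*} [AddCommGroup M] [Module k M] [Module H M] [IsScalarTower k H M]
    [YetterDrinfeld k H M]
    (Ψ : H ⊗[k] H →ₗ[k] (H ⊗[k] M)) (m : M)
    (hΨ : ∀ a b, Ψ (a ⊗ₜ b) = (LinearMap.mulRight k b).rTensor M (coact k H (a • m))) (h : H) :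
    Ψ (comul h) = TensorProduct.map₂ (LinearMap.mul k H) (act k H M) (comul h) (coact k H m) := by
  let Ψ' : (H ⊗[k] M) →ₗ[k] H ⊗[k] H →ₗ[k] (H ⊗[k] M) :=
    LinearMap.flip <| TensorProduct.lift <| LinearMap.flip <|
      (LinearMap.mul k (Module.End k (H ⊗[k] M))).compl₁₂
      (LinearMap.rTensorHom M ∘ₗ (LinearMap.mul k H).flip)
      (ydMap k H M ∘ₗ comul.lTensor H ∘ₗ comul)
  have hΨ' : Ψ = Ψ' (coact k H m) := by
    refine TensorProduct.ext' fun a b => ?_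
    rw [hΨ, YetterDrinfeld.coact_smul]
    rfl
  rw [hΨ']
  generalize coact k H m = u
  induction u using TensorProduct.induction_on with
  | zero => simp
  | add x y hx hy => simp only [map_add, LinearMap.add_apply, hx, hy]
  | tmul g n =>
    let L2 : H ⊗[k] (H ⊗[k] H) →ₗ[k] H ⊗[k] M :=
      (TensorProduct.comm k M H).toLinearMap ∘ₗ
        TensorProduct.map ((act k H M).flip n)
          (LinearMap.mulLeft k g ∘ₗ LinearMap.mul' k H ∘ₗ
            (HopfAlgebra.antipode k (A := H)).rTensor H)
    let L : H ⊗[k] H →ₗ[k] H ⊗[k] M :=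
      L2 ∘ₗ (TensorProduct.assoc k H H H).toLinearMap ∘ₗ comul.rTensor H
    have hL : ∀ b : H, L (comul b) = g ⊗ₜ (b • n) := by
      intro b
      have : ∀ t : H ⊗[k] H, L2 (comul.lTensor H t) =
          g ⊗ₜ (TensorProduct.rid k H (counit.lTensor H t) • n) := by
        intro t
        induction t using TensorProduct.induction_on with
        | zero => simp
        | add x y hx hy => simp only [map_add, hx, hy, TensorProduct.tmul_add, add_smul]
        | tmul a b =>
          simp [L2, HopfAlgebra.mul_antipode_rTensor_comul_apply, Algebra.algebraMap_eq_smul_one]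
      simp only [L, LinearMap.comp_apply, LinearEquiv.coe_coe]
      rw [coassoc_apply, this]
      simp
    let G : H ⊗[k] (H ⊗[k] H) →ₗ[k] H ⊗[k] M :=
      TensorProduct.lift ((LinearMap.rTensorHom M ∘ₗ LinearMap.mul k H).compl₂ L)
    have h1 : ∀ t : H ⊗[k] H, Ψ' (g ⊗ₜ n) t =
        G (TensorProduct.assoc k H H H (comul.rTensor H t)) := by
      intro t
      induction t using TensorProduct.induction_on with
      | zero => simp
      | add x y hx hy => simp only [map_add, hx, hy]
      | tmul a b =>
        change (LinearMap.mulRight k b).rTensor M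
          (ydMap k H M (comul.lTensor H (comul a)) (g ⊗ₜ n)) = _
        rw [LinearMap.rTensor_tmul]
        generalize comul (R := k) a = s
        induction s using TensorProduct.induction_on with
        | zero => simp
        | add x y hx hy => simp only [map_add, LinearMap.add_apply, TensorProduct.add_tmul, hx, hy]
        | tmul c d =>
          simp only [LinearMap.lTensor_tmul, TensorProduct.assoc_tmul, G, TensorProduct.lift.tmul,
            LinearMap.compl₂_apply, L, LinearMap.comp_apply, LinearMap.rTensor_tmul]
          generalize comul (R := k) d = s
          induction s using TensorProduct.induction_on with
          | zero => simp
          | add x y hx hy =>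
            simp only [map_add, LinearMap.add_apply, TensorProduct.add_tmul, TensorProduct.tmul_add,
              hx, hy]
          | tmul e f => simp [L2, mul_assoc]
    have h2 : ∀ t : H ⊗[k] H, G (comul.lTensor H t) =
        TensorProduct.map₂ (LinearMap.mul k H) (act k H M) t (g ⊗ₜ n) := by
      intro t
      induction t using TensorProduct.induction_on with
      | zero => simp
      | add x y hx hy => simp only [map_add, LinearMap.add_apply, hx, hy]
      | tmul a b => simp [G, hL]
    rw [h1, coassoc_apply, h2]

/-- `g h f r = f (h₍₁₎ r) g h₍₂₎`. -/
def SkewComm {M B : Type*} [AddCommGroup M] [Module k M] [Module H M] [IsScalarTower k H M]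
    [Ring B] [Algebra k B] (g : H →ₗ[k] B) (f : M →ₗ[k] B) : Prop :=
  ∀ h r, g h * f r =
    LinearMap.mul' k B (TensorProduct.map (f ∘ₗ (act k H M).flip r) g (comul h))

theorem SkewComm.mul {M N B : Type*}
    [AddCommGroup M] [Module k M] [Module H M] [IsScalarTower k H M]
    [AddCommGroup N] [Module k N] [Module H N] [IsScalarTower k H N]
    [Ring B] [Algebra k B] {g : H →ₗ[k] B} {f : M →ₗ[k] B} {f' : N →ₗ[k] B}
    (hf : SkewComm g f) (hf' : SkewComm g f') (h : H) (s : M ⊗[k] N) :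
    g h * LinearMap.mul' k B (TensorProduct.map f f' s) =
      LinearMap.mul' k B (TensorProduct.map
        (LinearMap.mul' k B ∘ₗ TensorProduct.map f f' ∘ₗ (diagAct k H M N).flip s) g (comul h)) := by
  induction s using TensorProduct.induction_on with
  | zero => simp [TensorProduct.map_zero_left]
  | add x y hx hy =>
    simp only [map_add, LinearMap.add_apply, hx, hy, mul_add, LinearMap.comp_add, TensorProduct.map_add_left]
  | tmul m n =>
    let F : H ⊗[k] (H ⊗[k] H) →ₗ[k] B :=
      LinearMap.mul' k B ∘ₗ TensorProduct.map (f ∘ₗ (act k H M).flip m)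
        (LinearMap.mul' k B ∘ₗ TensorProduct.map (f' ∘ₗ (act k H N).flip n) g)
    have h1 : ∀ t : H ⊗[k] H, LinearMap.mul' k B (TensorProduct.map (f ∘ₗ (act k H M).flip m) g t)
        * f' n = F (comul.lTensor H t) := by
      intro t
      induction t using TensorProduct.induction_on with
      | zero => simp
      | add x y hx hy => simp only [map_add, add_mul, hx, hy]
      | tmul a b =>
        simp only [F, TensorProduct.map_tmul, LinearMap.mul'_apply, LinearMap.comp_apply,
          LinearMap.lTensor_tmul, mul_assoc, ← hf' b n]
    have h2 : ∀ t : H ⊗[k] H, F (TensorProduct.assoc k H H H (comul.rTensor H t)) =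
        LinearMap.mul' k B (TensorProduct.map
        (LinearMap.mul' k B ∘ₗ TensorProduct.map f f' ∘ₗ (diagAct k H M N).flip (m ⊗ₜ n)) g t) := by
      intro t
      induction t using TensorProduct.induction_on with
      | zero => simp
      | add x y hx hy => simp only [map_add, hx, hy]
      | tmul a b =>
        simp only [TensorProduct.map_tmul, LinearMap.mul'_apply, LinearMap.comp_apply,
          LinearMap.rTensor_tmul, LinearMap.flip_apply, Smash.diagAct_apply]
        generalize comul (R := k) a = s
        induction s using TensorProduct.induction_on with
        | zero => simp
        | add x y hx hy =>
          simp only [map_add, add_mul, LinearMap.add_apply, TensorProduct.add_tmul, hx, hy]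
        | tmul c d => simp [F, mul_assoc]
    rw [TensorProduct.map_tmul, LinearMap.mul'_apply, ← mul_assoc, hf, h1, ← coassoc_apply, h2]

variable {R : Type*} [Ring R] [Algebra k R] [Module H R] [IsScalarTower k H R] [Coalgebra k R]
  [BraidedHopfAlgebra k H R]

namespace Smash

variable (k H R)

/-- `y ↦ (1 # y₍₋₁₎) ⊗ (y₍₀₎ # 1)`. -/
def coactA : R →ₐ[k] (Smash k R H ⊗[k] Smash k R H) :=
  AlgHom.ofLinearMap
    (TensorProduct.map (inr : H →ₐ[k] Smash k R H).toLinearMap (inl : R →ₐ[k] Smash k R H).toLinearMap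
      ∘ₗ coact k H)
    (by simp [BraidedHopfAlgebra.coact_one, Algebra.TensorProduct.one_def])
    (by
      intro a b
      simp only [LinearMap.comp_apply, BraidedHopfAlgebra.coact_mul, codiagCoact, TensorProduct.map_tmul]
      generalize coact k H a = u
      generalize coact k H b = v
      induction u using TensorProduct.induction_on with
      | zero => simp
      | add x y hx hy => simp only [map_add, add_mul, TensorProduct.add_tmul, hx, hy]
      | tmul c d =>
        induction v using TensorProduct.induction_on with
        | zero => simp
        | add x y hx hy => simp only [map_add, mul_add, TensorProduct.tmul_add, hx, hy]
        | tmul e f => simp)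

/-- `h ↦ (1 # h₍₁₎) ⊗ (1 # h₍₂₎)`. -/
def comulInr : H →ₐ[k] (Smash k R H ⊗[k] Smash k R H) :=
  (Algebra.TensorProduct.map inr inr).comp (Bialgebra.comulAlgHom k H)

/-- `x ↦ (x # 1) ⊗ (1 # 1)`. -/
def inlLeft : R →ₐ[k] (Smash k R H ⊗[k] Smash k R H) :=
  Algebra.TensorProduct.includeLeft.comp inl

theorem skewComm_inlLeft : SkewComm (comulInr k H R).toLinearMap (inlLeft k H R).toLinearMap := by
  intro h r
  let F : H ⊗[k] (H ⊗[k] H) →ₗ[k] (Smash k R H ⊗[k] Smash k R H) :=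
    LinearMap.mul' k _ ∘ₗ TensorProduct.map ((inlLeft k H R).toLinearMap ∘ₗ (act k H R).flip r)
      (TensorProduct.map inr.toLinearMap inr.toLinearMap)
  have h1 : ∀ t : H ⊗[k] H, TensorProduct.map inr.toLinearMap inr.toLinearMap t * inlLeft k H R r =
      F (TensorProduct.assoc k H H H (comul.rTensor H t)) := by
    intro t
    induction t using TensorProduct.induction_on with
    | zero => simp
    | add x y hx hy => simp only [map_add, add_mul, hx, hy]
    | tmul a b =>
      simp only [TensorProduct.map_tmul, AlgHom.toLinearMap_apply, inlLeft, AlgHom.comp_apply,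
        Algebra.TensorProduct.includeLeft_apply, Algebra.TensorProduct.tmul_mul_tmul, mul_one,
        inr_mul_inl, LinearMap.rTensor_tmul]
      generalize comul (R := k) a = s
      induction s using TensorProduct.induction_on with
      | zero => simp
      | add x y hx hy => simp only [map_add, TensorProduct.add_tmul, hx, hy]
      | tmul c d => simp [F, inlLeft, ofTensor_tmul]
  have h2 : ∀ t : H ⊗[k] H, F (comul.lTensor H t) =
      LinearMap.mul' k _ (TensorProduct.map ((inlLeft k H R).toLinearMap ∘ₗ (act k H R).flip r)
        (comulInr k H R).toLinearMap t) := by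
    intro t
    induction t using TensorProduct.induction_on with
    | zero => simp
    | add x y hx hy => simp only [map_add, hx, hy]
    | tmul a b => simp [F, comulInr]; rfl
  rw [← h2, ← coassoc_apply, ← h1]
  rfl

theorem skewComm_coactA : SkewComm (comulInr k H R).toLinearMap (coactA k H R).toLinearMap := by
  intro h y
  let j : H ⊗[k] R →ₗ[k] (Smash k R H ⊗[k] Smash k R H) :=
    TensorProduct.map (inr : H →ₐ[k] Smash k R H).toLinearMap (inl : R →ₐ[k] Smash k R H).toLinearMap
  let Ψ : H ⊗[k] H →ₗ[k] (H ⊗[k] R) :=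
    TensorProduct.lift <| LinearMap.flip <|
      (LinearMap.rTensorHom R ∘ₗ (LinearMap.mul k H).flip).compl₂ (coact k H ∘ₗ (act k H R).flip y)
  have hΨ := yd_condition Ψ y (fun a b => by simp [Ψ]; rfl)
  let F : (H ⊗[k] H) ⊗[k] H →ₗ[k] (Smash k R H ⊗[k] Smash k R H) :=
    LinearMap.mul' k _ ∘ₗ TensorProduct.map (j ∘ₗ Ψ)
      (Algebra.TensorProduct.includeRight.comp (inr : H →ₐ[k] Smash k R H)).toLinearMap
  have h1 : F (comul.rTensor H (comul h)) = comulInr k H R h * coactA k H R y := by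
    have h3 : ∀ t : H ⊗[k] H, F (comul.rTensor H t) = LinearMap.mul' k _ (TensorProduct.map
        (j ∘ₗ (TensorProduct.map₂ (LinearMap.mul k H) (act k H R)).flip (coact k H y))
        (Algebra.TensorProduct.includeRight.comp (inr : H →ₐ[k] Smash k R H)).toLinearMap
        (comul.rTensor H t)) := by
      intro t
      induction t using TensorProduct.induction_on with
      | zero => simp
      | add x y hx hy => simp only [map_add, hx, hy]
      | tmul a b =>
        simp only [F, LinearMap.rTensor_tmul, LinearMap.comp_apply, TensorProduct.map_tmul, hΨ,
          LinearMap.flip_apply]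
    have h4 : coactA k H R y = j (coact k H y) := rfl
    rw [h3, h4]
    generalize coact k H y = u
    induction u using TensorProduct.induction_on with
    | zero => simp [TensorProduct.map_zero_left]
    | add x y hx hy =>
      simp only [map_add, mul_add, LinearMap.comp_add, TensorProduct.map_add_left,
        LinearMap.add_apply, hx, hy]
    | tmul g n =>
      let F2 : H ⊗[k] (H ⊗[k] H) →ₗ[k] (Smash k R H ⊗[k] Smash k R H) :=
        TensorProduct.map (inr.toLinearMap ∘ₗ (LinearMap.mul k H).flip g)
          (LinearMap.mul' k _ ∘ₗ TensorProduct.map (inl.toLinearMap ∘ₗ (act k H R).flip n)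
            inr.toLinearMap)
      have h5 : ∀ t : (H ⊗[k] H) ⊗[k] H, LinearMap.mul' k _ (TensorProduct.map
          (j ∘ₗ (TensorProduct.map₂ (LinearMap.mul k H) (act k H R)).flip (g ⊗ₜ n))
          (Algebra.TensorProduct.includeRight.comp (inr : H →ₐ[k] Smash k R H)).toLinearMap t) =
          F2 (TensorProduct.assoc k H H H t) := by
        intro t
        refine LinearMap.congr_fun (f := LinearMap.mul' k _ ∘ₗ TensorProduct.map
          (j ∘ₗ (TensorProduct.map₂ (LinearMap.mul k H) (act k H R)).flip (g ⊗ₜ n))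
          (Algebra.TensorProduct.includeRight.comp (inr : H →ₐ[k] Smash k R H)).toLinearMap)
          (g := F2 ∘ₗ (TensorProduct.assoc k H H H).toLinearMap) ?_ t
        refine TensorProduct.ext_threefold fun a b c => ?_
        simp [F2, j]
      have h6 : ∀ t : H ⊗[k] H, F2 (comul.lTensor H t) =
          TensorProduct.map inr.toLinearMap inr.toLinearMap t * (inr g ⊗ₜ inl n) := by
        intro t
        induction t using TensorProduct.induction_on with
        | zero => simp
        | add x y hx hy => simp only [map_add, add_mul, hx, hy]
        | tmul a b =>
          simp only [F2, LinearMap.lTensor_tmul, TensorProduct.map_tmul, AlgHom.toLinearMap_apply,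
            Algebra.TensorProduct.tmul_mul_tmul, LinearMap.comp_apply, LinearMap.flip_apply,
            LinearMap.mul_apply', map_mul, inr_mul_inl]
          congr 1
          generalize comul (R := k) b = s
          induction s using TensorProduct.induction_on with
          | zero => simp
          | add x y hx hy => simp only [map_add, hx, hy]
          | tmul c d => simp [ofTensor_tmul]
      rw [h5, coassoc_apply, h6]
      rfl
  have h2 : ∀ t : H ⊗[k] H, F ((TensorProduct.assoc k H H H).symm (comul.lTensor H t)) =
      LinearMap.mul' k _ (TensorProduct.map ((coactA k H R).toLinearMap ∘ₗ (act k H R).flip y)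
        (comulInr k H R).toLinearMap t) := by
    intro t
    induction t using TensorProduct.induction_on with
    | zero => simp
    | add x y hx hy => simp only [map_add, hx, hy]
    | tmul a b =>
      have h7 : ∀ s : H ⊗[k] H, F ((TensorProduct.assoc k H H H).symm (a ⊗ₜ s)) =
          coactA k H R (a • y) * TensorProduct.map inr.toLinearMap inr.toLinearMap s := by
        intro s
        induction s using TensorProduct.induction_on with
        | zero => simp
        | add x y hx hy => simp only [map_add, mul_add, TensorProduct.tmul_add, hx, hy]
        | tmul c d =>
          have h8 : coactA k H R (a • y) = j (coact k H (a • y)) := rfl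
          rw [h8]
          simp only [TensorProduct.assoc_symm_tmul, F, LinearMap.comp_apply, TensorProduct.map_tmul,
            Ψ, TensorProduct.lift.tmul, LinearMap.flip_apply, LinearMap.compl₂_apply, act_apply,
            LinearMap.mul'_apply]
          generalize coact k H (a • y) = v
          induction v using TensorProduct.induction_on with
          | zero => simp
          | add x y hx hy => simp only [map_add, add_mul, hx, hy]
          | tmul e f => simp [j]
      simp only [LinearMap.lTensor_tmul, h7]
      rfl
  rw [← h2, coassoc_symm_apply, h1]
  rfl

end Smash

end Radford

section Radford2

variable {k H : Type*} [Field k] [Ring H] [HopfAlgebra k H]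
variable {R : Type*} [Ring R] [Algebra k R] [Module H R] [IsScalarTower k H R] [Coalgebra k R]
  [BraidedHopfAlgebra k H R]

namespace Smash

variable (k H R)

theorem coactA_apply (y : R) : coactA k H R y = TensorProduct.map
    (inr : H →ₐ[k] Smash k R H).toLinearMap (inl : R →ₐ[k] Smash k R H).toLinearMap (coact k H y) :=
  rfl

theorem coactA_mul_inlLeft (a b : R) : coactA k H R a * inlLeft k H R b =
    LinearMap.mul' k _ (TensorProduct.map ((inlLeft k H R).toLinearMap ∘ₗ (act k H R).flip b)
      (coactA k H R).toLinearMap (coact k H a)) := by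
  let W : H ⊗[k] (H ⊗[k] R) →ₗ[k] (Smash k R H ⊗[k] Smash k R H) :=
    LinearMap.mul' k _ ∘ₗ TensorProduct.map ((inlLeft k H R).toLinearMap ∘ₗ (act k H R).flip b)
      (TensorProduct.map inr.toLinearMap inl.toLinearMap)
  have h1 : ∀ t : H ⊗[k] R, W ((coact k H).lTensor H t) =
      LinearMap.mul' k _ (TensorProduct.map ((inlLeft k H R).toLinearMap ∘ₗ (act k H R).flip b)
      (coactA k H R).toLinearMap t) := by
    intro t
    induction t using TensorProduct.induction_on with
    | zero => simp
    | add x y hx hy => simp only [map_add, hx, hy]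
    | tmul a b => rfl
  have h2 : ∀ t : H ⊗[k] R, W (TensorProduct.assoc k H H R (comul.rTensor R t)) =
      TensorProduct.map inr.toLinearMap inl.toLinearMap t * inlLeft k H R b := by
    intro t
    induction t using TensorProduct.induction_on with
    | zero => simp
    | add x y hx hy => simp only [map_add, add_mul, hx, hy]
    | tmul a r =>
      simp only [TensorProduct.map_tmul, AlgHom.toLinearMap_apply, inlLeft, AlgHom.comp_apply,
        Algebra.TensorProduct.includeLeft_apply, Algebra.TensorProduct.tmul_mul_tmul, mul_one,
        inr_mul_inl, LinearMap.rTensor_tmul]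
      generalize comul (R := k) a = s
      induction s using TensorProduct.induction_on with
      | zero => simp
      | add x y hx hy => simp only [map_add, TensorProduct.add_tmul, hx, hy]
      | tmul c d => simp [W, inlLeft, ofTensor_tmul]
  rw [← h1, ← coact_coassoc, h2]
  rfl

/-- `x ⊗ y ↦ (x # y₍₋₁₎) ⊗ (y₍₀₎ # 1)`. -/
def cosmash : R ⊗[k] R →ₗ[k] (Smash k R H ⊗[k] Smash k R H) :=
  LinearMap.mul' k _ ∘ₗ TensorProduct.map (inlLeft k H R).toLinearMap (coactA k H R).toLinearMap

@[simp] theorem cosmash_tmul (x y : R) :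
    cosmash k H R (x ⊗ₜ y) = inlLeft k H R x * coactA k H R y := by
  simp [cosmash]

theorem cosmash_braidedMul (s t : R ⊗[k] R) :
    cosmash k H R (braidedMul k H R (s ⊗ₜ t)) = cosmash k H R s * cosmash k H R t := by
  induction s using TensorProduct.induction_on with
  | zero => simp
  | add x y hx hy => simp only [TensorProduct.add_tmul, map_add, add_mul, hx, hy]
  | tmul a a' =>
    induction t using TensorProduct.induction_on with
    | zero => simp
    | add x y hx hy => simp only [TensorProduct.tmul_add, map_add, mul_add, hx, hy]
    | tmul b b' =>
      rw [cosmash_tmul, cosmash_tmul, mul_assoc, ← mul_assoc (coactA k H R a'), coactA_mul_inlLeft]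
      simp only [braidedMul, braiding, LinearMap.comp_apply, LinearEquiv.coe_coe,
        TensorProduct.assoc_tmul, LinearMap.lTensor_tmul, TensorProduct.assoc_symm_tmul,
        LinearMap.rTensor_tmul]
      generalize coact k H a' = u
      induction u using TensorProduct.induction_on with
      | zero => simp
      | add x y hx hy => simp only [TensorProduct.add_tmul, TensorProduct.tmul_add, map_add,
          add_mul, mul_add, hx, hy]
      | tmul g n => simp [mul_assoc]

/-- `r ↦ (r⁽¹⁾ # r⁽²⁾₍₋₁₎) ⊗ (r⁽²⁾₍₀₎ # 1)`. -/
def comulInl : R →ₐ[k] (Smash k R H ⊗[k] Smash k R H) :=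
  AlgHom.ofLinearMap (cosmash k H R ∘ₗ comul)
    (by simp [BraidedHopfAlgebra.comul_one (k := k) (H := H)])
    (by
      intro a b
      simp only [LinearMap.comp_apply, BraidedHopfAlgebra.comul_mul (k := k) (H := H),
        cosmash_braidedMul])

theorem comulInl_apply (r : R) : comulInl k H R r = cosmash k H R (comul r) := rfl

/-- The comultiplication of the Radford biproduct, determined by
`Δ(r # h) = (r⁽¹⁾ # r⁽²⁾₍₋₁₎ h₍₁₎) ⊗ (r⁽²⁾₍₀₎ # h₍₂₎)`. -/
def comulA : Smash k R H →ₐ[k] (Smash k R H ⊗[k] Smash k R H) :=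
  lift (comulInl k H R) (comulInr k H R) (by
    intro h r
    have := (skewComm_inlLeft k H R).mul (skewComm_coactA k H R) h (comul r)
    refine this.trans ?_
    congr 2
    refine congrArg (fun f => TensorProduct.map f (comulInr k H R).toLinearMap) ?_
    refine LinearMap.ext fun a => ?_
    simp only [LinearMap.comp_apply, LinearMap.flip_apply, act_apply, AlgHom.toLinearMap_apply,
      comulInl_apply, BraidedHopfAlgebra.comul_smul]
    rfl)

/-- The counit `r # h ↦ ε(r) ε(h)` of the Radford biproduct. -/
def counitA : Smash k R H →ₐ[k] k :=
  lift
    (AlgHom.ofLinearMap (counit (R := k) (A := R)) (BraidedHopfAlgebra.counit_one (H := H))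
      (BraidedHopfAlgebra.counit_mul (H := H)))
    (Bialgebra.counitAlgHom k H) (by
      intro h r
      have : ∀ t : H ⊗[k] H, LinearMap.mul' k k (TensorProduct.map
          ((AlgHom.ofLinearMap (counit (R := k) (A := R)) (BraidedHopfAlgebra.counit_one (H := H))
      (BraidedHopfAlgebra.counit_mul (H := H))).toLinearMap ∘ₗ (act k H R).flip r)
          (Bialgebra.counitAlgHom k H).toLinearMap t) =
          counit (R := k) (TensorProduct.lid k H (counit.rTensor H t)) * counit (R := k) r := by
        intro t
        induction t using TensorProduct.induction_on with
        | zero => simp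
        | add x y hx hy => simp only [map_add, add_mul, hx, hy]
        | tmul a b => simp [BraidedHopfAlgebra.counit_smul (k := k) (H := H)]; ring
      rw [this]
      simp)

@[simp] theorem comulA_inl (r : R) : comulA k H R (inl r) = comulInl k H R r := lift_inl _ _ _ _
@[simp] theorem comulA_inr (h : H) : comulA k H R (inr h) = comulInr k H R h := lift_inr _ _ _ _
@[simp] theorem counitA_inl (r : R) : counitA k H R (inl r) = counit r := lift_inl _ _ _ _
@[simp] theorem counitA_inr (h : H) : counitA k H R (inr h) = counit h := lift_inr _ _ _ _

end Smash

end Radford2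

section Radford3

variable {k H : Type*} [Field k] [Ring H] [HopfAlgebra k H]
variable {R : Type*} [Ring R] [Algebra k R] [Module H R] [IsScalarTower k H R] [Coalgebra k R]
  [BraidedHopfAlgebra k H R]

namespace Smash

variable (k H R)

theorem comulInr_apply (h : H) : comulInr k H R h = TensorProduct.map
    (inr : H →ₐ[k] Smash k R H).toLinearMap (inr : H →ₐ[k] Smash k R H).toLinearMap (comul h) :=
  rfl

theorem inlLeft_apply (x : R) : inlLeft k H R x = inl x ⊗ₜ 1 := rfl

set_option maxHeartbeats 1000000 in
theorem comulA_coassoc :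
    (Algebra.TensorProduct.assoc k k k (Smash k R H) (Smash k R H) (Smash k R H)).toAlgHom.comp
      ((Algebra.TensorProduct.map (comulA k H R) (.id k (Smash k R H))).comp (comulA k H R))
      = (Algebra.TensorProduct.map (.id k (Smash k R H)) (comulA k H R)).comp (comulA k H R) := by
  let P1 : Smash k R H ⊗[k] Smash k R H →ₐ[k] Smash k R H ⊗[k] (Smash k R H ⊗[k] Smash k R H) :=
    (Algebra.TensorProduct.assoc k k k (Smash k R H) (Smash k R H) (Smash k R H)).toAlgHom.comp
      (Algebra.TensorProduct.map (comulA k H R) (.id k (Smash k R H)))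
  let P2 : Smash k R H ⊗[k] Smash k R H →ₐ[k] Smash k R H ⊗[k] (Smash k R H ⊗[k] Smash k R H) :=
    Algebra.TensorProduct.map (.id k (Smash k R H)) (comulA k H R)
  let as : (Smash k R H ⊗[k] Smash k R H) ⊗[k] Smash k R H →ₐ[k] Smash k R H ⊗[k] (Smash k R H ⊗[k] Smash k R H) :=
    (Algebra.TensorProduct.assoc k k k (Smash k R H) (Smash k R H) (Smash k R H)).toAlgHom
  have has : ∀ a b c : Smash k R H, as ((a ⊗ₜ b) ⊗ₜ c) = a ⊗ₜ (b ⊗ₜ c) := fun a b c => rfl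
  refine algHom_ext (f := P1.comp (comulA k H R)) (g := P2.comp (comulA k H R)) ?_ ?_
  · intro r
    change P1 (comulA k H R (inl r)) = P2 (comulA k H R (inl r))
    rw [comulA_inl, comulInl_apply]
    -- `Y b = (1 # b₍₋₂₎) ⊗ (1 # b₍₋₁₎) ⊗ (b₍₀₎ # 1)`
    have hY : ∀ b : R, P1 (coactA k H R b) =
        TensorProduct.map (inr : H →ₐ[k] Smash k R H).toLinearMap (coactA k H R).toLinearMap
          (coact k H b) := by
      intro b
      let X : H ⊗[k] (H ⊗[k] R) →ₗ[k] Smash k R H ⊗[k] (Smash k R H ⊗[k] Smash k R H) :=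
        TensorProduct.map inr.toLinearMap (TensorProduct.map inr.toLinearMap inl.toLinearMap)
      have h1 : ∀ t : H ⊗[k] R, P1 (TensorProduct.map inr.toLinearMap inl.toLinearMap t) =
          X (TensorProduct.assoc k H H R (comul.rTensor R t)) := by
        intro t
        induction t using TensorProduct.induction_on with
        | zero => simp
        | add x y hx hy => simp only [map_add, hx, hy]
        | tmul a r =>
          change as (comulA k H R (inr a) ⊗ₜ inl r) = _
          rw [comulA_inr, comulInr_apply, LinearMap.rTensor_tmul]
          generalize comul (R := k) a = s
          induction s using TensorProduct.induction_on with
          | zero => simp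
          | add x y hx hy => simp only [map_add, TensorProduct.add_tmul, hx, hy]
          | tmul c d => rfl
      have h2 : ∀ t : H ⊗[k] R, X ((coact k H).lTensor H t) =
          TensorProduct.map (inr : H →ₐ[k] Smash k R H).toLinearMap (coactA k H R).toLinearMap t := by
        intro t
        induction t using TensorProduct.induction_on with
        | zero => simp
        | add x y hx hy => simp only [map_add, hx, hy]
        | tmul a r => rfl
      rw [coactA_apply, h1, coact_coassoc, h2]
    have hP1 : ∀ x : R, P1 (inlLeft k H R x) = as (comulInl k H R x ⊗ₜ 1) := by
      intro x
      change as (comulA k H R (inl x) ⊗ₜ 1) = _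
      rw [comulA_inl]
    have hP2 : ∀ x : R, P2 (inlLeft k H R x) = inl x ⊗ₜ (1 ⊗ₜ 1) := by
      intro x
      change inl x ⊗ₜ comulA k H R 1 = _
      rw [map_one]; rfl
    have hP2' : ∀ y : R, P2 (coactA k H R y) =
        TensorProduct.map (inr : H →ₐ[k] Smash k R H).toLinearMap (comulInl k H R).toLinearMap
          (coact k H y) := by
      intro y
      rw [coactA_apply]
      generalize coact k H y = u
      induction u using TensorProduct.induction_on with
      | zero => simp
      | add x y hx hy => simp only [map_add, hx, hy]
      | tmul a r =>
        change inr a ⊗ₜ comulA k H R (inl r) = _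
        rw [comulA_inl]; rfl
    -- the linear map `y ⊗ z ↦ (C y ⊗ 1) * P1 (C z)`
    let Z : R ⊗[k] R →ₗ[k] Smash k R H ⊗[k] (Smash k R H ⊗[k] Smash k R H) :=
      LinearMap.mul' k (Smash k R H ⊗[k] (Smash k R H ⊗[k] Smash k R H)) ∘ₗ TensorProduct.map
        ((as.comp Algebra.TensorProduct.includeLeft).comp (coactA k H R)).toLinearMap
        (P1.comp (coactA k H R)).toLinearMap
    have hZ : ∀ y : R, P2 (coactA k H R y) = Z (comul y) := by
      intro y
      have h1 : ∀ u : H ⊗[k] R,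
          TensorProduct.map (inr : H →ₐ[k] Smash k R H).toLinearMap (comulInl k H R).toLinearMap u =
          TensorProduct.map (inr : H →ₐ[k] Smash k R H).toLinearMap (cosmash k H R)
            (comul.lTensor H u) := by
        intro u
        induction u using TensorProduct.induction_on with
        | zero => simp
        | add x y hx hy => simp only [map_add, hx, hy]
        | tmul a r => rfl
      rw [hP2', h1, BraidedHopfAlgebra.coact_comul]
      generalize comul (R := k) y = s
      induction s using TensorProduct.induction_on with
      | zero => simp
      | add x y hx hy => simp only [map_add, hx, hy]
      | tmul a b =>
        have h2 : Z (a ⊗ₜ b) = as (coactA k H R a ⊗ₜ 1) * P1 (coactA k H R b) := by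
          simp only [Z, LinearMap.comp_apply, TensorProduct.map_tmul, LinearMap.mul'_apply]; rfl
        rw [h2, hY, coactA_apply]
        simp only [codiagCoact, LinearMap.comp_apply, TensorProduct.map_tmul]
        generalize coact k H a = u
        generalize coact k H b = v
        induction u using TensorProduct.induction_on with
        | zero => simp
        | add x y hx hy => simp only [map_add, add_mul, TensorProduct.add_tmul, hx, hy]
        | tmul c d =>
          induction v using TensorProduct.induction_on with
          | zero => simp
          | add x y hx hy => simp only [map_add, mul_add, TensorProduct.tmul_add, hx, hy]
          | tmul e f =>
            rw [TensorProduct.map_tmul, has, TensorProduct.map_tmul,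
              Algebra.TensorProduct.tmul_mul_tmul]
            simp [inlLeft_apply]
    let F : R ⊗[k] (R ⊗[k] R) →ₗ[k] Smash k R H ⊗[k] (Smash k R H ⊗[k] Smash k R H) :=
      LinearMap.mul' k (Smash k R H ⊗[k] (Smash k R H ⊗[k] Smash k R H)) ∘ₗ TensorProduct.map
        ((as.comp Algebra.TensorProduct.includeLeft).comp (inlLeft k H R)).toLinearMap Z
    have h1 : ∀ s : R ⊗[k] R, P1 (cosmash k H R s) =
        F (TensorProduct.assoc k R R R (comul.rTensor R s)) := by
      intro s
      induction s using TensorProduct.induction_on with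
      | zero => simp
      | add x y hx hy => simp only [map_add, hx, hy]
      | tmul x y =>
        rw [cosmash_tmul, map_mul, hP1, comulInl_apply, LinearMap.rTensor_tmul]
        generalize comul (R := k) x = s
        induction s using TensorProduct.induction_on with
        | zero => simp
        | add x y hx hy => simp only [map_add, add_mul, TensorProduct.add_tmul, hx, hy]
        | tmul c d =>
          have h3 : ((inlLeft k H R c * coactA k H R d) ⊗ₜ[k] (1 : Smash k R H)) =
            (inlLeft k H R c ⊗ₜ[k] (1 : Smash k R H)) * (coactA k H R d ⊗ₜ[k] (1 : Smash k R H)) := by simp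
          rw [cosmash_tmul, h3, map_mul, mul_assoc]
          simp only [F, Z, TensorProduct.assoc_tmul, LinearMap.comp_apply, TensorProduct.map_tmul,
            LinearMap.mul'_apply]
          rfl
    have h2 : ∀ s : R ⊗[k] R, P2 (cosmash k H R s) = F (comul.lTensor R s) := by
      intro s
      induction s using TensorProduct.induction_on with
      | zero => simp
      | add x y hx hy => simp only [map_add, hx, hy]
      | tmul x y =>
        rw [cosmash_tmul, map_mul, hP2, hZ]
        simp only [F, LinearMap.lTensor_tmul, LinearMap.comp_apply, TensorProduct.map_tmul,
            LinearMap.mul'_apply]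
        rfl
    rw [h1, h2, coassoc_apply]
  · intro h
    change P1 (comulA k H R (inr h)) = P2 (comulA k H R (inr h))
    rw [comulA_inr, comulInr_apply]
    let F : H ⊗[k] (H ⊗[k] H) →ₗ[k] Smash k R H ⊗[k] (Smash k R H ⊗[k] Smash k R H) :=
      TensorProduct.map inr.toLinearMap (TensorProduct.map inr.toLinearMap inr.toLinearMap)
    have h1 : ∀ s : H ⊗[k] H, P1 (TensorProduct.map inr.toLinearMap inr.toLinearMap s) =
        F (TensorProduct.assoc k H H H (comul.rTensor H s)) := by
      intro s
      induction s using TensorProduct.induction_on with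
      | zero => simp
      | add x y hx hy => simp only [map_add, hx, hy]
      | tmul a b =>
        change as (comulA k H R (inr a) ⊗ₜ inr b) = _
        rw [comulA_inr, comulInr_apply, LinearMap.rTensor_tmul]
        generalize comul (R := k) a = s
        induction s using TensorProduct.induction_on with
        | zero => simp
        | add x y hx hy => simp only [map_add, TensorProduct.add_tmul, hx, hy]
        | tmul c d => rfl
    have h2 : ∀ s : H ⊗[k] H, P2 (TensorProduct.map inr.toLinearMap inr.toLinearMap s) =
        F (comul.lTensor H s) := by
      intro s
      induction s using TensorProduct.induction_on with
      | zero => simp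
      | add x y hx hy => simp only [map_add, hx, hy]
      | tmul a b =>
        change inr a ⊗ₜ comulA k H R (inr b) = _
        rw [comulA_inr]; rfl
    rw [h1, h2, coassoc_apply]

theorem counitA_rTensor :
    (Algebra.TensorProduct.map (counitA k H R) (.id k (Smash k R H))).comp (comulA k H R)
      = (Algebra.TensorProduct.lid k (Smash k R H)).symm := by
  let U : Smash k R H ⊗[k] Smash k R H →ₐ[k] k ⊗[k] Smash k R H := Algebra.TensorProduct.map (counitA k H R) (.id k (Smash k R H))
  refine algHom_ext (f := U.comp (comulA k H R))
    (g := (Algebra.TensorProduct.lid k (Smash k R H)).symm.toAlgHom) ?_ ?_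
  · intro r
    have hC : ∀ y : R, U (coactA k H R y) = 1 ⊗ₜ inl y := by
      intro y
      have : ∀ t : H ⊗[k] R, U (TensorProduct.map inr.toLinearMap inl.toLinearMap t) =
          1 ⊗ₜ inl (TensorProduct.lid k R (counit.rTensor R t)) := by
        intro t
        induction t using TensorProduct.induction_on with
        | zero => simp
        | add x y hx hy => simp only [map_add, TensorProduct.tmul_add, hx, hy]
        | tmul a b =>
          change counitA k H R (inr a) ⊗ₜ inl b = _
          simp [TensorProduct.tmul_smul, TensorProduct.smul_tmul']
      rw [coactA_apply, this, coact_counit]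
    have : ∀ t : R ⊗[k] R, U (cosmash k H R t) =
        1 ⊗ₜ inl (TensorProduct.lid k R (counit.rTensor R t)) := by
      intro t
      induction t using TensorProduct.induction_on with
      | zero => simp
      | add x y hx hy => simp only [map_add, TensorProduct.tmul_add, hx, hy]
      | tmul a b =>
        rw [cosmash_tmul, map_mul, hC]
        change counitA k H R (inl a) ⊗ₜ 1 * _ = _
        simp [TensorProduct.tmul_smul, TensorProduct.smul_tmul']
    rw [AlgHom.comp_apply, comulA_inl, comulInl_apply, this]
    simp
  · intro h
    have : ∀ t : H ⊗[k] H, U (TensorProduct.map inr.toLinearMap inr.toLinearMap t) =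
        1 ⊗ₜ inr (TensorProduct.lid k H (counit.rTensor H t)) := by
      intro t
      induction t using TensorProduct.induction_on with
      | zero => simp
      | add x y hx hy => simp only [map_add, TensorProduct.tmul_add, hx, hy]
      | tmul a b =>
        change counitA k H R (inr a) ⊗ₜ inr b = _
        simp [TensorProduct.tmul_smul, TensorProduct.smul_tmul']
    rw [AlgHom.comp_apply, comulA_inr, comulInr_apply, this]
    simp

theorem counitA_lTensor :
    (Algebra.TensorProduct.map (.id k (Smash k R H)) (counitA k H R)).comp (comulA k H R)
      = (Algebra.TensorProduct.rid k k (Smash k R H)).symm := by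
  let U : Smash k R H ⊗[k] Smash k R H →ₐ[k] Smash k R H ⊗[k] k := Algebra.TensorProduct.map (.id k (Smash k R H)) (counitA k H R)
  refine algHom_ext (f := U.comp (comulA k H R))
    (g := (Algebra.TensorProduct.rid k k (Smash k R H)).symm.toAlgHom) ?_ ?_
  · intro r
    have hC : ∀ y : R, U (coactA k H R y) = 1 ⊗ₜ counit y := by
      intro y
      have : ∀ t : H ⊗[k] R, U (TensorProduct.map inr.toLinearMap inl.toLinearMap t) =
          (inr : H →ₐ[k] Smash k R H).toLinearMap.rTensor k (counit.lTensor H t) := by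
        intro t
        induction t using TensorProduct.induction_on with
        | zero => simp
        | add x y hx hy => simp only [map_add, hx, hy]
        | tmul a b =>
          change inr a ⊗ₜ counitA k H R (inl b) = _
          simp
      rw [coactA_apply, this, BraidedHopfAlgebra.coact_counit']
      simp
    have : ∀ t : R ⊗[k] R, U (cosmash k H R t) =
        inl (TensorProduct.rid k R (counit.lTensor R t)) ⊗ₜ 1 := by
      intro t
      induction t using TensorProduct.induction_on with
      | zero => simp
      | add x y hx hy => simp only [map_add, TensorProduct.add_tmul, hx, hy]
      | tmul a b =>
        rw [cosmash_tmul, map_mul, hC]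
        change inl a ⊗ₜ counitA k H R 1 * _ = _
        simp [TensorProduct.smul_tmul]
    rw [AlgHom.comp_apply, comulA_inl, comulInl_apply, this]
    simp
  · intro h
    have : ∀ t : H ⊗[k] H, U (TensorProduct.map inr.toLinearMap inr.toLinearMap t) =
        inr (TensorProduct.rid k H (counit.lTensor H t)) ⊗ₜ 1 := by
      intro t
      induction t using TensorProduct.induction_on with
      | zero => simp
      | add x y hx hy => simp only [map_add, TensorProduct.add_tmul, hx, hy]
      | tmul a b =>
        change inr a ⊗ₜ counitA k H R (inr b) = _
        simp [TensorProduct.smul_tmul]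
    rw [AlgHom.comp_apply, comulA_inr, comulInr_apply, this]
    simp

instance : Bialgebra k (Smash k R H) :=
  Bialgebra.ofAlgHom (comulA k H R) (counitA k H R) (comulA_coassoc k H R)
    (counitA_rTensor k H R) (counitA_lTensor k H R)

end Smash

end Radford3

section Radford4

variable {k H : Type*} [Field k] [Ring H] [HopfAlgebra k H]
variable {R : Type*} [Ring R] [Algebra k R] [Module H R] [IsScalarTower k H R] [Coalgebra k R]
  [BraidedHopfAlgebra k H R]

namespace Smash

variable (k H R)

/-- `x ↦ (1 # S(x₍₋₁₎)) (S(x₍₀₎) # 1)`. -/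
def antipodeInl : R →ₗ[k] Smash k R H :=
  LinearMap.mul' k (Smash k R H) ∘ₗ
    TensorProduct.map (inr.toLinearMap ∘ₗ HopfAlgebra.antipode k)
      (inl.toLinearMap ∘ₗ BraidedHopfAlgebra.antipode k H) ∘ₗ coact k H

/-- The antipode `x # h ↦ (1 # S(x₍₋₁₎ h)) (S(x₍₀₎) # 1)` of the Radford biproduct. -/
def antipodeA : Smash k R H →ₗ[k] Smash k R H :=
  LinearMap.mul' k (Smash k R H) ∘ₗ
    (TensorProduct.comm k (Smash k R H) (Smash k R H)).toLinearMap ∘ₗ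
      TensorProduct.map (antipodeInl k H R) (inr.toLinearMap ∘ₗ HopfAlgebra.antipode k) ∘ₗ
        ofTensor.symm.toLinearMap

theorem antipodeA_inl_mul_inr (x : R) (h : H) : antipodeA k H R (inl x * inr h) =
    inr (HopfAlgebra.antipode k h) * antipodeInl k H R x := by
  rw [inl_mul_inr]
  simp only [antipodeA, LinearMap.comp_apply]
  change LinearMap.mul' k (Smash k R H) (TensorProduct.comm k _ _ (TensorProduct.map
    (antipodeInl k H R) (inr.toLinearMap ∘ₗ HopfAlgebra.antipode k) (x ⊗ₜ h))) = _
  simp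

theorem antipodeA_inl (x : R) : antipodeA k H R (inl x) = antipodeInl k H R x := by
  have := antipodeA_inl_mul_inr k H R x 1
  simpa using this

theorem antipodeA_mul_inr (z : Smash k R H) (h : H) : antipodeA k H R (z * inr h) =
    inr (HopfAlgebra.antipode k h) * antipodeA k H R z := by
  induction z using Smash.induction_on with
  | zero => simp
  | add x y hx hy => simp only [add_mul, mul_add, map_add, hx, hy]
  | mk r h' =>
    rw [← inl_mul_inr, mul_assoc, ← map_mul, antipodeA_inl_mul_inr, antipodeA_inl_mul_inr,
      HopfAlgebra.antipode_mul_antidistrib, map_mul, mul_assoc]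

theorem comul_inl_mul_inr (r : R) (h : H) : comul (R := k) (inl r * inr h : Smash k R H) =
    cosmash k H R (comul r) *
      TensorProduct.map inr.toLinearMap inr.toLinearMap (comul (R := k) h) := by
  change comulA k H R _ = _
  rw [map_mul, comulA_inl, comulA_inr, comulInl_apply, comulInr_apply]

theorem counit_inl_mul_inr (r : R) (h : H) : counit (R := k) (inl r * inr h : Smash k R H) =
    counit (R := k) r * counit (R := k) h := by
  change counitA k H R _ = _
  rw [map_mul, counitA_inl, counitA_inr]

theorem antipodeA_left (a : Smash k R H) :
    LinearMap.mul' k _ ((antipodeA k H R).rTensor _ (comul a)) =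
      algebraMap k (Smash k R H) (counit a) := by
  induction a using Smash.induction_on with
  | zero => simp
  | add x y hx hy => simp only [map_add, hx, hy]
  | mk r h =>
    rw [← inl_mul_inr, comul_inl_mul_inr, counit_inl_mul_inr]
    have h1 : ∀ (w : Smash k R H ⊗[k] Smash k R H) (c : k),
        LinearMap.mul' k _ ((antipodeA k H R).rTensor _ w) = algebraMap k (Smash k R H) c →
        LinearMap.mul' k _ ((antipodeA k H R).rTensor _ (w *
          TensorProduct.map inr.toLinearMap inr.toLinearMap (comul (R := k) h))) =
          algebraMap k (Smash k R H) (c * counit h) := by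
      intro w c hw
      have h2 : ∀ (a b : H), LinearMap.mul' k _ ((antipodeA k H R).rTensor _ (w *
          (inr a ⊗ₜ inr b))) = inr (HopfAlgebra.antipode k a) *
            LinearMap.mul' k _ ((antipodeA k H R).rTensor _ w) * inr b := by
        intro a b
        clear hw
        induction w using TensorProduct.induction_on with
        | zero => simp
        | add x y hx hy => simp only [map_add, add_mul, mul_add, hx, hy]
        | tmul x y => simp [antipodeA_mul_inr, mul_assoc]
      have h3 : ∀ t : H ⊗[k] H, LinearMap.mul' k _ ((antipodeA k H R).rTensor _ (w *
          TensorProduct.map inr.toLinearMap inr.toLinearMap t)) =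
          c • inr (LinearMap.mul' k H ((HopfAlgebra.antipode k (A := H)).rTensor H t)) := by
        intro t
        induction t using TensorProduct.induction_on with
        | zero => simp
        | add x y hx hy => simp only [map_add, smul_add, mul_add, hx, hy]
        | tmul a b =>
          rw [TensorProduct.map_tmul, AlgHom.toLinearMap_apply, AlgHom.toLinearMap_apply, h2, hw]
          simp [Algebra.algebraMap_eq_smul_one]
      rw [h3, HopfAlgebra.mul_antipode_rTensor_comul_apply]
      simp [Algebra.algebraMap_eq_smul_one, smul_smul]
    refine h1 _ _ ?_
    let K : H ⊗[k] (R ⊗[k] R) →ₗ[k] Smash k R H :=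
      LinearMap.mul' k (Smash k R H) ∘ₗ
        TensorProduct.map (inr.toLinearMap ∘ₗ HopfAlgebra.antipode k)
          (inl.toLinearMap ∘ₗ LinearMap.mul' k R ∘ₗ (BraidedHopfAlgebra.antipode k H).rTensor R)
    have h4 : ∀ s : R ⊗[k] R, LinearMap.mul' k _ ((antipodeA k H R).rTensor _ (cosmash k H R s)) =
        K (codiagCoact k H R R s) := by
      intro s
      induction s using TensorProduct.induction_on with
      | zero => simp
      | add x y hx hy => simp only [map_add, hx, hy]
      | tmul x y =>
        rw [cosmash_tmul, coactA_apply]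
        simp only [codiagCoact, LinearMap.comp_apply, TensorProduct.map_tmul]
        generalize coact k H y = v
        induction v using TensorProduct.induction_on with
        | zero => simp
        | add x y hx hy => simp only [map_add, mul_add, TensorProduct.tmul_add, hx, hy]
        | tmul p y' =>
          simp only [inlLeft_apply, TensorProduct.map_tmul, AlgHom.toLinearMap_apply,
            Algebra.TensorProduct.tmul_mul_tmul, one_mul, LinearMap.rTensor_tmul,
            LinearMap.mul'_apply, antipodeA_inl_mul_inr]
          simp only [antipodeInl, LinearMap.comp_apply]
          generalize coact k H x = u
          induction u using TensorProduct.induction_on with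
          | zero => simp
          | add x y hx hy => simp only [map_add, mul_add, add_mul, TensorProduct.add_tmul, hx, hy]
          | tmul g x' => simp [K, HopfAlgebra.antipode_mul_antidistrib, mul_assoc]
    have h5 : ∀ t : H ⊗[k] R, K (comul.lTensor H t) =
        LinearMap.mul' k (Smash k R H)
          (TensorProduct.map (inr.toLinearMap ∘ₗ HopfAlgebra.antipode k)
            (Algebra.linearMap k (Smash k R H)) (counit.lTensor H t)) := by
      intro t
      induction t using TensorProduct.induction_on with
      | zero => simp
      | add x y hx hy => simp only [map_add, hx, hy]
      | tmul a b => simp [K, BraidedHopfAlgebra.mul_antipode_left (k := k) (H := H)]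
    rw [h4, ← BraidedHopfAlgebra.coact_comul, h5, BraidedHopfAlgebra.coact_counit']
    simp

theorem antipodeA_right (a : Smash k R H) :
    LinearMap.mul' k _ ((antipodeA k H R).lTensor _ (comul a)) =
      algebraMap k (Smash k R H) (counit a) := by
  induction a using Smash.induction_on with
  | zero => simp
  | add x y hx hy => simp only [map_add, hx, hy]
  | mk r h =>
    rw [← inl_mul_inr, comul_inl_mul_inr, counit_inl_mul_inr]
    have h1 : ∀ (w : Smash k R H ⊗[k] Smash k R H),
        LinearMap.mul' k _ ((antipodeA k H R).lTensor _ (w *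
          TensorProduct.map inr.toLinearMap inr.toLinearMap (comul (R := k) h))) =
          counit (R := k) h • LinearMap.mul' k _ ((antipodeA k H R).lTensor _ w) := by
      intro w
      induction w using TensorProduct.induction_on with
      | zero => simp
      | add x y hx hy => simp only [map_add, add_mul, smul_add, hx, hy]
      | tmul x y =>
        have h3 : ∀ t : H ⊗[k] H, LinearMap.mul' k _ ((antipodeA k H R).lTensor _ ((x ⊗ₜ y) *
            TensorProduct.map inr.toLinearMap inr.toLinearMap t)) =
            x * inr (LinearMap.mul' k H ((HopfAlgebra.antipode k (A := H)).lTensor H t)) *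
              antipodeA k H R y := by
          intro t
          induction t using TensorProduct.induction_on with
          | zero => simp
          | add x y hx hy => simp only [map_add, add_mul, mul_add, hx, hy]
          | tmul a b => simp [antipodeA_mul_inr, mul_assoc]
        rw [h3, HopfAlgebra.mul_antipode_lTensor_comul_apply]
        simp [Algebra.algebraMap_eq_smul_one]
    have h2 : ∀ y : R, LinearMap.mul' k _ ((antipodeA k H R).lTensor _ (coactA k H R y)) =
        inl (BraidedHopfAlgebra.antipode k H y) := by
      intro y
      let K : H ⊗[k] (H ⊗[k] R) →ₗ[k] Smash k R H :=
        LinearMap.mul' k (Smash k R H) ∘ₗ TensorProduct.map inr.toLinearMap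
          (LinearMap.mul' k (Smash k R H) ∘ₗ
            TensorProduct.map (inr.toLinearMap ∘ₗ HopfAlgebra.antipode k)
              (inl.toLinearMap ∘ₗ BraidedHopfAlgebra.antipode k H))
      have h3 : ∀ t : H ⊗[k] R, LinearMap.mul' k _ ((antipodeA k H R).lTensor _
          (TensorProduct.map inr.toLinearMap inl.toLinearMap t)) =
          K ((coact k H).lTensor H t) := by
        intro t
        induction t using TensorProduct.induction_on with
        | zero => simp
        | add x y hx hy => simp only [map_add, hx, hy]
        | tmul a b => simp [K, antipodeA_inl, antipodeInl]
      have h4 : ∀ t : H ⊗[k] R, K (TensorProduct.assoc k H H R (comul.rTensor R t)) =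
          inl (BraidedHopfAlgebra.antipode k H (TensorProduct.lid k R (counit.rTensor R t))) := by
        intro t
        induction t using TensorProduct.induction_on with
        | zero => simp
        | add x y hx hy => simp only [map_add, hx, hy]
        | tmul a b =>
          have h5 : ∀ s : H ⊗[k] H, K (TensorProduct.assoc k H H R (s ⊗ₜ b)) =
              inr (LinearMap.mul' k H ((HopfAlgebra.antipode k (A := H)).lTensor H s)) *
                inl (BraidedHopfAlgebra.antipode k H b) := by
            intro s
            induction s using TensorProduct.induction_on with
            | zero => simp
            | add x y hx hy => simp only [map_add, add_mul, TensorProduct.add_tmul, hx, hy]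
            | tmul c d => simp [K, mul_assoc]
          rw [LinearMap.rTensor_tmul, h5, HopfAlgebra.mul_antipode_lTensor_comul_apply]
          simp [Algebra.algebraMap_eq_smul_one]
      rw [coactA_apply, h3, ← coact_coassoc, h4, coact_counit]
    have h6 : ∀ s : R ⊗[k] R, LinearMap.mul' k _ ((antipodeA k H R).lTensor _ (cosmash k H R s)) =
        inl (LinearMap.mul' k R ((BraidedHopfAlgebra.antipode k H).lTensor R s)) := by
      intro s
      induction s using TensorProduct.induction_on with
      | zero => simp
      | add x y hx hy => simp only [map_add, hx, hy]
      | tmul x y =>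
        have h7 : ∀ w : Smash k R H ⊗[k] Smash k R H, LinearMap.mul' k _
            ((antipodeA k H R).lTensor _ (inlLeft k H R x * w)) =
            inl x * LinearMap.mul' k _ ((antipodeA k H R).lTensor _ w) := by
          intro w
          induction w using TensorProduct.induction_on with
          | zero => simp
          | add x y hx hy => simp only [map_add, mul_add, hx, hy]
          | tmul a b => simp [inlLeft_apply, mul_assoc]
        rw [cosmash_tmul, h7, h2]
        simp
    rw [h1, h6, BraidedHopfAlgebra.mul_antipode_right]
    simp [Algebra.algebraMap_eq_smul_one, smul_smul, mul_comm]

/-- The Radford biproduct `R # H` is a Hopf algebra. -/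
instance : HopfAlgebra k (Smash k R H) where
  antipode := antipodeA k H R
  mul_antipode_rTensor_comul := LinearMap.ext (antipodeA_left k H R)
  mul_antipode_lTensor_comul := LinearMap.ext (antipodeA_right k H R)

end Smash

end Radford4

/-! ### The tensor algebra of an `H`-module -/

/-- The tensor algebra `T_c(M)` of an `H`-module `M`. -/
def Tc (k H M : Type*) [Field k] [Ring H] [AddCommGroup M] [Module k M] [Module H M] : Type _ :=
  TensorAlgebra k M

namespace Tc

section

variable {k H M : Type*} [Field k] [Ring H] [AddCommGroup M] [Module k M] [Module H M]

instance : Ring (Tc k H M) := inferInstanceAs (Ring (TensorAlgebra k M))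
instance : Algebra k (Tc k H M) := inferInstanceAs (Algebra k (TensorAlgebra k M))

variable (k H M) in
/-- The inclusion `M → T_c(M)`. -/
def ι : M →ₗ[k] Tc k H M := TensorAlgebra.ι k

/-- The unique algebra map `T_c(M) → B` extending the linear map `f : M → B`. -/
def lift {B : Type*} [Ring B] [Algebra k B] (f : M →ₗ[k] B) : Tc k H M →ₐ[k] B :=
  TensorAlgebra.lift k f

theorem lift_ι {B : Type*} [Ring B] [Algebra k B] (f : M →ₗ[k] B) (m : M) :
    lift f (ι k H M m) = f m := TensorAlgebra.lift_ι_apply f m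

@[elab_as_elim]
theorem induction {p : Tc k H M → Prop} (algebraMap : ∀ c, p (algebraMap k (Tc k H M) c))
    (ι : ∀ m, p (ι k H M m)) (mul : ∀ a b, p a → p b → p (a * b))
    (add : ∀ a b, p a → p b → p (a + b)) (x : Tc k H M) : p x :=
  TensorAlgebra.induction (C := p) algebraMap ι mul add x

end

variable {k H M : Type*} [Field k] [Ring H] [Bialgebra k H]
  [AddCommGroup M] [Module k M] [Module H M] [IsScalarTower k H M]

variable (k H M) in
/-- The map `t ↦ (h ↦ h t)`, as an algebra map into the convolution algebra. -/
def actConv : Tc k H M →ₐ[k] WithConv (H →ₗ[k] Tc k H M) :=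
  lift ((WithConv.linearEquiv k (H →ₗ[k] Tc k H M)).symm.toLinearMap ∘ₗ
    ((act k H M).compr₂ (ι k H M)).flip)

instance : SMul H (Tc k H M) := ⟨fun h t => (actConv k H M t).ofConv h⟩

theorem smul_def (h : H) (t : Tc k H M) : h • t = (actConv k H M t).ofConv h := rfl

theorem smul_algebraMap (h : H) (c : k) :
    h • algebraMap k (Tc k H M) c = algebraMap k _ (c * counit h) := by
  rw [smul_def, AlgHom.commutes]
  change c • algebraMap k (Tc k H M) (counit h) = _
  rw [map_mul, Algebra.smul_def]

theorem smul_ι (h : H) (m : M) : h • ι k H M m = ι k H M (h • m) := by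
  rw [smul_def, actConv, lift_ι]
  rfl

theorem smul_add' (h : H) (a b : Tc k H M) : h • (a + b) = h • a + h • b := by
  simp only [smul_def, map_add, WithConv.ofConv_add, LinearMap.add_apply]

theorem add_smul' (g h : H) (a : Tc k H M) : (g + h) • a = g • a + h • a := by
  simp only [smul_def, map_add]

/-- The action as a bilinear map. -/
def actL : H →ₗ[k] Tc k H M →ₗ[k] Tc k H M :=
  ((WithConv.linearEquiv k (H →ₗ[k] Tc k H M)).toLinearMap ∘ₗ (actConv k H M).toLinearMap).flip

theorem actL_apply (h : H) (t : Tc k H M) : actL h t = h • t := rfl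

theorem smul_mul' (h : H) (a b : Tc k H M) :
    h • (a * b) = LinearMap.mul' k _ (TensorProduct.map₂ actL actL (comul (R := k) h) (a ⊗ₜ b)) := by
  rw [smul_def, map_mul]
  change LinearMap.mul' k _ (TensorProduct.map (actConv k H M a).ofConv (actConv k H M b).ofConv
    (comul (R := k) h)) = _
  generalize comul (R := k) h = t
  induction t using TensorProduct.induction_on with
  | zero => simp
  | add x y hx hy => simp only [map_add, LinearMap.add_apply, hx, hy]
  | tmul a b => rfl

theorem one_smul' (t : Tc k H M) : (1 : H) • t = t := by
  induction t using Tc.induction with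
  | algebraMap c => simp [smul_algebraMap]
  | ι m => simp [smul_ι]
  | add a b ha hb => rw [smul_add', ha, hb]
  | mul a b ha hb =>
    rw [smul_mul', Bialgebra.comul_one, Algebra.TensorProduct.one_def]
    simp [actL_apply, ha, hb]

theorem mul_smul' (g h : H) (t : Tc k H M) : (g * h) • t = g • h • t := by
  induction t using Tc.induction generalizing g h with
  | algebraMap c => simp only [smul_algebraMap, Bialgebra.counit_mul]; congr 1; ring
  | ι m => simp only [smul_ι, mul_smul]
  | add a b ha hb => simp only [smul_add', ha, hb]
  | mul a b ha hb =>
    have key : ∀ s t : H ⊗[k] H, TensorProduct.map₂ actL actL (s * t) (a ⊗ₜ b) =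
        TensorProduct.map₂ actL actL s (TensorProduct.map₂ actL actL t (a ⊗ₜ b)) := by
      intro s t
      induction s using TensorProduct.induction_on with
      | zero => simp
      | add x y hx hy => simp only [add_mul, map_add, LinearMap.add_apply, hx, hy]
      | tmul c d =>
        induction t using TensorProduct.induction_on with
        | zero => simp
        | add x y hx hy => simp only [mul_add, map_add, LinearMap.add_apply, hx, hy]
        | tmul e f => simp [actL_apply, ha, hb]
    have h2 : ∀ x : Tc k H M ⊗[k] Tc k H M, g • LinearMap.mul' k _ x =
        LinearMap.mul' k _ (TensorProduct.map₂ actL actL (comul (R := k) g) x) := by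
      intro x
      rw [← actL_apply]
      induction x using TensorProduct.induction_on with
      | zero => simp
      | add x y hx hy => simp only [map_add, hx, hy]
      | tmul c d => rw [LinearMap.mul'_apply, actL_apply, smul_mul']
    rw [smul_mul', Bialgebra.comul_mul, key, smul_mul', h2]

/-- The action of `H` on `T_c(M)`, determined by `h 1 = ε(h) 1`,
`h (a b) = (h₍₁₎ a) (h₍₂₎ b)` and the given action on `M`. -/
instance : Module H (Tc k H M) where
  one_smul := one_smul'
  mul_smul := mul_smul'
  smul_zero h := map_zero (actL h)
  smul_add := smul_add'
  add_smul := add_smul'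
  zero_smul t := LinearMap.congr_fun (map_zero actL) t

instance : IsScalarTower k H (Tc k H M) :=
  ⟨fun c h t => LinearMap.congr_fun (map_smul actL c h) t⟩

instance : IsModuleAlgebra k H (Tc k H M) where
  smul_one h := by
    have := smul_algebraMap (k := k) (M := M) h 1
    simpa using this
  smul_mul := smul_mul'

end Tc

/-! ### Braided biproducts -/

/-- The braided biproduct `Q # R`, with underlying space `Q ⊗ R`. -/
def BraidedBiproduct (k H Q R : Type*) [Field k] [Ring H] [HopfAlgebra k H]
    [AddCommGroup Q] [Module k Q] [AddCommGroup R] [Module k R] : Type _ :=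
  Q ⊗[k] R

namespace BraidedBiproduct

variable {k H Q R : Type*} [Field k] [Ring H] [HopfAlgebra k H]
  [Ring R] [Algebra k R] [Module H R] [IsScalarTower k H R] [Coalgebra k R]
  [BraidedHopfAlgebra k H R]
  [Ring Q] [Algebra k Q] [Module (Smash k R H) Q] [IsScalarTower k (Smash k R H) Q]

instance (priority := 50) : AddCommGroup (BraidedBiproduct k H Q R) :=
  inferInstanceAs (AddCommGroup (Q ⊗[k] R))
instance (priority := 50) : Module k (BraidedBiproduct k H Q R) :=
  inferInstanceAs (Module k (Q ⊗[k] R))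

/-- The identification of `Q ⊗ R` with `Q # R`. -/
def ofTensor : (Q ⊗[k] R) ≃ₗ[k] BraidedBiproduct k H Q R := LinearEquiv.refl k _

variable (k H R) in
/-- `r ↦ (r⁽¹⁾ # r⁽²⁾₍₋₁₎) ⊗ r⁽²⁾₍₀₎`. -/
def halfComul : R →ₗ[k] Smash k R H ⊗[k] R :=
  Smash.ofTensor.toLinearMap.rTensor R ∘ₗ
    (TensorProduct.assoc k R H R).symm.toLinearMap ∘ₗ
      (coact k H).lTensor R ∘ₗ comul

variable (k H Q R) in
/-- The multiplication `(x # r) (x' # r') = x ((r⁽¹⁾ # r⁽²⁾₍₋₁₎) x') # r⁽²⁾₍₀₎ r'`. -/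
def mulL : (Q ⊗[k] R) →ₗ[k] Module.End k (Q ⊗[k] R) :=
  TensorProduct.lift <| (LinearMap.mul k (Module.End k (Q ⊗[k] R))).compl₁₂
    (LinearMap.rTensorHom R ∘ₗ LinearMap.mul k Q)
    (TensorProduct.map₂ (act k (Smash k R H) Q) (LinearMap.mul k R) ∘ₗ halfComul k H R)

instance : Mul (BraidedBiproduct k H Q R) :=
  ⟨fun x y => ofTensor (mulL k H Q R (ofTensor.symm x) (ofTensor.symm y))⟩
instance : One (BraidedBiproduct k H Q R) := ⟨ofTensor (1 ⊗ₜ 1)⟩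

variable [IsModuleAlgebra k (Smash k R H) Q]

variable (k H Q R) in
/-- The inclusion `Q # R → Q # (R # H)`. -/
def toSmash : Q ⊗[k] R →ₗ[k] Smash k Q (Smash k R H) :=
  Smash.ofTensor.toLinearMap ∘ₗ (Smash.inl : R →ₐ[k] Smash k R H).toLinearMap.lTensor Q

theorem inl_injective : Function.Injective (Smash.inl : R →ₐ[k] Smash k R H) := by
  have : ∀ r : R, TensorProduct.rid k R (counit.lTensor R
      (Smash.ofTensor.symm (Smash.inl r : Smash k R H))) = r := by
    intro r
    change TensorProduct.rid k R (counit.lTensor R (r ⊗ₜ (1 : H))) = r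
    simp
  exact Function.LeftInverse.injective
    (g := fun x : Smash k R H => TensorProduct.rid k R (counit.lTensor R (Smash.ofTensor.symm x)))
    this

theorem toSmash_injective : Function.Injective (toSmash k H Q R) := by
  have h := Module.Flat.lTensor_preserves_injective_linearMap (M := Q)
    (Smash.inl : R →ₐ[k] Smash k R H).toLinearMap inl_injective
  exact (Smash.ofTensor (k := k) (R := Q) (H := Smash k R H)).injective.comp h

theorem toSmash_mulL (x y : Q ⊗[k] R) :
    toSmash k H Q R (mulL k H Q R x y) = toSmash k H Q R x * toSmash k H Q R y := by
  induction x using TensorProduct.induction_on with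
  | zero => simp
  | add x x' hx hx' => simp only [map_add, LinearMap.add_apply, add_mul, hx, hx']
  | tmul q r =>
    induction y using TensorProduct.induction_on with
    | zero => simp
    | add x y hx hy => simp only [map_add, mul_add, hx, hy]
    | tmul q' r' =>
      change _ = Smash.mk q (Smash.inl r) * Smash.mk q' (Smash.inl r')
      rw [Smash.mk_mul_mk, Smash.diagAct_apply]
      have h1 : comul (R := k) (Smash.inl r : Smash k R H) = Smash.cosmash k H R (comul r) :=
        Smash.comulA_inl k H R r
      have h2 : mulL k H Q R (q ⊗ₜ r) (q' ⊗ₜ r') = (LinearMap.mulLeft k q).rTensor R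
        (TensorProduct.map₂ (act k (Smash k R H) Q) (LinearMap.mul k R)
          (Smash.ofTensor.toLinearMap.rTensor R ((TensorProduct.assoc k R H R).symm
            ((coact k H).lTensor R (comul r)))) (q' ⊗ₜ r')) := rfl
      rw [h1, h2]
      generalize comul (R := k) r = s
      induction s using TensorProduct.induction_on with
      | zero => simp
      | add x y hx hy => simp only [map_add, LinearMap.add_apply, hx, hy]
      | tmul a b =>
        rw [Smash.cosmash_tmul, Smash.coactA_apply, LinearMap.lTensor_tmul]
        generalize coact k H b = u
        induction u using TensorProduct.induction_on with
        | zero => simp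
        | add x y hx hy =>
          simp only [map_add, LinearMap.add_apply, mul_add, TensorProduct.tmul_add, hx, hy]
        | tmul g b' =>
          simp [Smash.inlLeft_apply, Smash.ofTensor_tmul, toSmash]

theorem mulL_assoc (x y z : Q ⊗[k] R) :
    mulL k H Q R (mulL k H Q R x y) z = mulL k H Q R x (mulL k H Q R y z) :=
  toSmash_injective (k := k) (H := H) (by simp only [toSmash_mulL, mul_assoc])

theorem one_mulL (x : Q ⊗[k] R) : mulL k H Q R (1 ⊗ₜ 1) x = x :=
  toSmash_injective (k := k) (H := H) (by
    have : toSmash k H Q R (1 ⊗ₜ 1) = 1 := rfl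
    rw [toSmash_mulL, this, one_mul])

theorem mulL_one (x : Q ⊗[k] R) : mulL k H Q R x (1 ⊗ₜ 1) = x :=
  toSmash_injective (k := k) (H := H) (by
    have : toSmash k H Q R (1 ⊗ₜ 1) = 1 := rfl
    rw [toSmash_mulL, this, mul_one])

instance : Ring (BraidedBiproduct k H Q R) where
  mul_assoc := mulL_assoc (k := k) (H := H) (Q := Q) (R := R)
  one_mul := one_mulL (k := k) (H := H) (Q := Q) (R := R)
  mul_one := mulL_one (k := k) (H := H) (Q := Q) (R := R)
  left_distrib x y z := map_add (mulL k H Q R x) y z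
  right_distrib x y z := LinearMap.congr_fun (map_add (mulL k H Q R) x y) z
  zero_mul x := LinearMap.congr_fun (map_zero (mulL k H Q R)) x
  mul_zero x := map_zero (mulL k H Q R x)
  zsmul := fun n x => n • x
  zsmul_zero' := SubNegMonoid.zsmul_zero'
  zsmul_succ' := SubNegMonoid.zsmul_succ'
  zsmul_neg' := SubNegMonoid.zsmul_neg'
  neg_add_cancel := neg_add_cancel

instance : Algebra k (BraidedBiproduct k H Q R) :=
  Algebra.ofModule
    (fun c x y => LinearMap.congr_fun (map_smul (mulL k H Q R) c x) y)
    (fun c x y => map_smul (mulL k H Q R x) c y)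

end BraidedBiproduct

/-! ### Direct sums and highest weight vectors -/

section Naturality

variable {k H A M N : Type*} [Field k] [Ring H] [HopfAlgebra k H] [Ring A] [HopfAlgebra k A]
  [AddCommGroup M] [Module k M] [AddCommGroup N] [Module k N]

theorem ydMap_map [Module A M] [IsScalarTower k A M] [Module H N] [IsScalarTower k H N] (φ : H →ₐ[k] A)
    (hS : ∀ h, HopfAlgebra.antipode k (φ h) = φ (HopfAlgebra.antipode k h))
    (f : N →ₗ[k] M) (hf : ∀ h n, f (h • n) = φ h • f n)
    (t : H ⊗[k] (H ⊗[k] H)) (w : H ⊗[k] N) :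
    TensorProduct.map φ.toLinearMap f (ydMap k H N t w) =
      ydMap k A M (TensorProduct.map φ.toLinearMap
        (TensorProduct.map φ.toLinearMap φ.toLinearMap) t)
        (TensorProduct.map φ.toLinearMap f w) := by
  induction w using TensorProduct.induction_on with
  | zero => simp
  | add x y hx hy => simp only [map_add, hx, hy]
  | tmul g n =>
    induction t using TensorProduct.induction_on with
    | zero => simp
    | add x y hx hy => simp only [map_add, LinearMap.add_apply, hx, hy]
    | tmul a s =>
      induction s using TensorProduct.induction_on with
      | zero => simp
      | add x y hx hy =>
        simp only [map_add, TensorProduct.tmul_add, LinearMap.add_apply, hx, hy]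
      | tmul b c => simp [hS, hf]

theorem comul_map (φ : H →ₐ[k] A)
    (hφ : ∀ h, comul (R := k) (φ h) =
      TensorProduct.map φ.toLinearMap φ.toLinearMap (comul (R := k) h)) (h : H) :
    comul.lTensor A (comul (R := k) (φ h)) = TensorProduct.map φ.toLinearMap
      (TensorProduct.map φ.toLinearMap φ.toLinearMap) (comul.lTensor H (comul (R := k) h)) := by
  rw [hφ]
  generalize comul (R := k) h = t
  induction t using TensorProduct.induction_on with
  | zero => simp
  | add x y hx hy => simp only [map_add, hx, hy]
  | tmul a b => simp [hφ]

theorem comul_rTensor_map (φ : H →ₐ[k] A)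
    (hφ : ∀ h, comul (R := k) (φ h) =
      TensorProduct.map φ.toLinearMap φ.toLinearMap (comul (R := k) h)) (f : N →ₗ[k] M)
    (w : H ⊗[k] N) :
    TensorProduct.map φ.toLinearMap (TensorProduct.map φ.toLinearMap f)
      (TensorProduct.assoc k H H N (comul.rTensor N w)) =
    TensorProduct.assoc k A A M (comul.rTensor M (TensorProduct.map φ.toLinearMap f w)) := by
  induction w using TensorProduct.induction_on with
  | zero => simp
  | add x y hx hy => simp only [map_add, hx, hy]
  | tmul g n =>
    simp only [LinearMap.rTensor_tmul, TensorProduct.map_tmul, AlgHom.toLinearMap_apply, hφ]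
    generalize comul (R := k) g = t
    induction t using TensorProduct.induction_on with
    | zero => simp
    | add x y hx hy => simp only [map_add, TensorProduct.add_tmul, hx, hy]
    | tmul a b => simp

end Naturality

section Prod

variable {k H M N : Type*} [Field k] [Ring H] [HopfAlgebra k H]
  [AddCommGroup M] [Module k M] [Module H M] [IsScalarTower k H M]
  [AddCommGroup N] [Module k N] [Module H N] [IsScalarTower k H N]

variable (k H M N) in
/-- The coaction of a direct sum. -/
def prodCoact [LeftComodule k H M] [LeftComodule k H N] : (M × N) →ₗ[k] H ⊗[k] (M × N) :=
  LinearMap.coprod ((LinearMap.inl k M N).lTensor H ∘ₗ coact k H)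
    ((LinearMap.inr k M N).lTensor H ∘ₗ coact k H)

/-- The direct sum of two comodules. -/
instance [LeftComodule k H M] [LeftComodule k H N] : LeftComodule k H (M × N) where
  coact := prodCoact k H M N
  coact_coassoc := by
    have h1 : ∀ t : H ⊗[k] M, TensorProduct.assoc k H H (M × N) (comul.rTensor (M × N)
        ((LinearMap.inl k M N).lTensor H t)) = ((LinearMap.inl k M N).lTensor H).lTensor H
          (TensorProduct.assoc k H H M (comul.rTensor M t)) := fun t =>
      (comul_rTensor_map (AlgHom.id k H) (by simp) (LinearMap.inl k M N) t).symm
    have h2 : ∀ t : H ⊗[k] N, TensorProduct.assoc k H H (M × N) (comul.rTensor (M × N)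
        ((LinearMap.inr k M N).lTensor H t)) = ((LinearMap.inr k M N).lTensor H).lTensor H
          (TensorProduct.assoc k H H N (comul.rTensor N t)) := fun t =>
      (comul_rTensor_map (AlgHom.id k H) (by simp) (LinearMap.inr k M N) t).symm
    have h3 : ∀ t : H ⊗[k] M, (prodCoact k H M N).lTensor H ((LinearMap.inl k M N).lTensor H t) =
        ((LinearMap.inl k M N).lTensor H).lTensor H ((coact k H).lTensor H t) := by
      intro t
      induction t using TensorProduct.induction_on with
      | zero => simp
      | add x y hx hy => simp only [map_add, hx, hy]
      | tmul a b => simp [prodCoact]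
    have h4 : ∀ t : H ⊗[k] N, (prodCoact k H M N).lTensor H ((LinearMap.inr k M N).lTensor H t) =
        ((LinearMap.inr k M N).lTensor H).lTensor H ((coact k H).lTensor H t) := by
      intro t
      induction t using TensorProduct.induction_on with
      | zero => simp
      | add x y hx hy => simp only [map_add, hx, hy]
      | tmul a b => simp [prodCoact]
    rintro ⟨m, n⟩
    have h5 : prodCoact k H M N (m, n) = (LinearMap.inl k M N).lTensor H (coact k H m) +
      (LinearMap.inr k M N).lTensor H (coact k H n) := by simp [prodCoact]
    rw [h5]
    simp only [map_add, h1, h2, h3, h4, coact_coassoc]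
  coact_counit := by
    have h1 : ∀ t : H ⊗[k] M, TensorProduct.lid k (M × N) (counit.rTensor (M × N)
        ((LinearMap.inl k M N).lTensor H t)) = LinearMap.inl k M N
          (TensorProduct.lid k M (counit.rTensor M t)) := by
      intro t
      induction t using TensorProduct.induction_on with
      | zero => simp only [map_zero]
      | add x y hx hy => simp only [map_add, hx, hy]
      | tmul a b => simp
    have h2 : ∀ t : H ⊗[k] N, TensorProduct.lid k (M × N) (counit.rTensor (M × N)
        ((LinearMap.inr k M N).lTensor H t)) = LinearMap.inr k M N
          (TensorProduct.lid k N (counit.rTensor N t)) := by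
      intro t
      induction t using TensorProduct.induction_on with
      | zero => simp only [map_zero]
      | add x y hx hy => simp only [map_add, hx, hy]
      | tmul a b => simp
    rintro ⟨m, n⟩
    have h5 : prodCoact k H M N (m, n) = (LinearMap.inl k M N).lTensor H (coact k H m) +
      (LinearMap.inr k M N).lTensor H (coact k H n) := by simp [prodCoact]
    rw [h5]
    simp only [map_add, h1, h2, coact_counit]
    simp

/-- The direct sum of two Yetter-Drinfel'd modules. -/
instance [YetterDrinfeld k H M] [YetterDrinfeld k H N] : YetterDrinfeld k H (M × N) where
  coact_smul := by
    rintro h ⟨m, n⟩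
    have h5 : ∀ m n, prodCoact k H M N (m, n) = (LinearMap.inl k M N).lTensor H (coact k H m) +
      (LinearMap.inr k M N).lTensor H (coact k H n) := by intros; simp [prodCoact]
    have h1 := fun t w => ydMap_map (AlgHom.id k H) (fun _ => rfl) (LinearMap.inl k M N)
      (by intros; simp) t w
    have h2 := fun t w => ydMap_map (AlgHom.id k H) (fun _ => rfl) (LinearMap.inr k M N)
      (by intros; simp) t w
    simp only [AlgHom.toLinearMap_id, TensorProduct.map_id, LinearMap.id_apply] at h1 h2
    change prodCoact k H M N (h • m, h • n) = ydMap k H _ _ (prodCoact k H M N (m, n))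
    rw [h5, h5, map_add, YetterDrinfeld.coact_smul, YetterDrinfeld.coact_smul]
    exact congrArg₂ (· + ·) (h1 _ _) (h2 _ _)

end Prod

section HighestWeight

variable (k H R M : Type*) [Field k] [Ring H] [HopfAlgebra k H]
  [Ring R] [Algebra k R] [Module H R] [IsScalarTower k H R] [Coalgebra k R]
  [BraidedHopfAlgebra k H R]
  [AddCommGroup M] [Module k M] [Module (Smash k R H) M] [IsScalarTower k (Smash k R H) M]
  [YetterDrinfeld k (Smash k R H) M]

/-- The space `M_H = {m | δ(m) ∈ H ⊗ M}` of highest weight vectors of a Yetter-Drinfel'd module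
over `R # H`. -/
def highestWeight : Submodule k M :=
  (LinearMap.range ((Smash.inr : H →ₐ[k] Smash k R H).toLinearMap.rTensor M)).comap
    (coact k (Smash k R H))

namespace highestWeight

theorem antipode_inr (h : H) : HopfAlgebra.antipode k (Smash.inr h : Smash k R H) =
    Smash.inr (HopfAlgebra.antipode k h) := by
  change Smash.antipodeA k H R _ = _
  have := Smash.antipodeA_inl_mul_inr k H R 1 h
  rw [map_one, one_mul] at this
  rw [this]
  have h1 : BraidedHopfAlgebra.antipode k H (1 : R) = 1 := by
    have h2 := BraidedHopfAlgebra.mul_antipode_left (k := k) (H := H) (1 : R)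
    rw [BraidedHopfAlgebra.comul_one (k := k) (H := H),
      BraidedHopfAlgebra.counit_one (k := k) (H := H)] at h2
    simpa using h2
  simp [Smash.antipodeInl, BraidedHopfAlgebra.coact_one, h1]

theorem comul_inr (h : H) : comul (R := k) (Smash.inr h : Smash k R H) =
    TensorProduct.map (Smash.inr : H →ₐ[k] Smash k R H).toLinearMap
      (Smash.inr : H →ₐ[k] Smash k R H).toLinearMap (comul (R := k) h) :=
  Smash.comulA_inr k H R h

theorem inr_injective : Function.Injective (Smash.inr : H →ₐ[k] Smash k R H) := by
  have : ∀ h : H, TensorProduct.lid k H (counit.rTensor H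
      (Smash.ofTensor.symm (Smash.inr h : Smash k R H))) = h := by
    intro h
    change TensorProduct.lid k H (counit.rTensor H ((1 : R) ⊗ₜ h)) = h
    simp [BraidedHopfAlgebra.counit_one (k := k) (H := H)]
  exact Function.LeftInverse.injective
    (g := fun x : Smash k R H => TensorProduct.lid k H (counit.rTensor H (Smash.ofTensor.symm x)))
    this

/-- The inclusion `H ⊗ M_H → (R # H) ⊗ M`. -/
def incl : H ⊗[k] highestWeight k H R M →ₗ[k] Smash k R H ⊗[k] M :=
  TensorProduct.map (Smash.inr : H →ₐ[k] Smash k R H).toLinearMap (highestWeight k H R M).subtype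

theorem incl_injective : Function.Injective (incl k H R M) :=
  TensorProduct.map_injective_of_flat_flat _ _ (inr_injective k H R)
    (highestWeight k H R M).subtype_injective

variable {k H R M}

theorem smul_mem (h : H) {m : M} (hm : m ∈ highestWeight k H R M) :
    (Smash.inr h : Smash k R H) • m ∈ highestWeight k H R M := by
  obtain ⟨w, hw⟩ := hm
  change coact k (Smash k R H) ((Smash.inr h : Smash k R H) • m) ∈
    LinearMap.range ((Smash.inr : H →ₐ[k] Smash k R H).toLinearMap.rTensor M)
  rw [YetterDrinfeld.coact_smul, ← hw, comul_map _ (comul_inr k H R)]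
  generalize comul.lTensor H (comul (R := k) h) = t
  clear hw
  induction w using TensorProduct.induction_on with
  | zero => simp
  | add x y hx hy => simp only [map_add]; exact Submodule.add_mem _ hx hy
  | tmul g n =>
    induction t using TensorProduct.induction_on with
    | zero => simp
    | add x y hx hy =>
      simp only [map_add, LinearMap.add_apply]; exact Submodule.add_mem _ hx hy
    | tmul a s =>
      induction s using TensorProduct.induction_on with
      | zero => simp
      | add x y hx hy =>
        simp only [map_add, TensorProduct.tmul_add, LinearMap.add_apply]
        exact Submodule.add_mem _ hx hy
      | tmul b c =>
        refine ⟨(a * (g * HopfAlgebra.antipode k c)) ⊗ₜ ((Smash.inr b : Smash k R H) • n), ?_⟩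
        simp [antipode_inr]

instance : SMul H (highestWeight k H R M) :=
  ⟨fun h m => ⟨(Smash.inr h : Smash k R H) • (m : M), smul_mem h m.2⟩⟩

theorem coe_smul (h : H) (m : highestWeight k H R M) :
    ((h • m : highestWeight k H R M) : M) = (Smash.inr h : Smash k R H) • (m : M) := rfl

/-- The restriction to `M_H` of the action of `H ⊆ R # H`. -/
instance : Module H (highestWeight k H R M) where
  one_smul m := Subtype.ext (by simp [coe_smul])
  mul_smul g h m := Subtype.ext (by simp [coe_smul, mul_smul])
  smul_zero h := Subtype.ext (by simp [coe_smul])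
  smul_add h m n := Subtype.ext (by simp [coe_smul])
  add_smul g h m := Subtype.ext (by simp [coe_smul, add_smul])
  zero_smul m := Subtype.ext (by simp [coe_smul])

instance : IsScalarTower k H (highestWeight k H R M) :=
  ⟨fun c h m => Subtype.ext (by simp [coe_smul])⟩

theorem coact_mem (m : highestWeight k H R M) :
    coact k (Smash k R H) (m : M) ∈ LinearMap.range (incl k H R M) := by
  obtain ⟨m, w, hw⟩ := m
  let inr' : H →ₗ[k] Smash k R H := (Smash.inr : H →ₐ[k] Smash k R H).toLinearMap
  let f : M →ₗ[k] _ := (LinearMap.range (inr'.rTensor M)).mkQ ∘ₗ coact k (Smash k R H)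
  have hf : LinearMap.ker f = highestWeight k H R M := by
    rw [LinearMap.ker_comp, Submodule.ker_mkQ]; rfl
  have h1 : (coact k (Smash k R H)).lTensor H w =
      (inr'.rTensor M).lTensor H (TensorProduct.assoc k H H M (comul.rTensor M w)) := by
    have hinj : Function.Injective (inr'.rTensor (Smash k R H ⊗[k] M)) :=
      Module.Flat.rTensor_preserves_injective_linearMap _ (inr_injective k H R)
    refine hinj ?_
    have h2 : inr'.rTensor (Smash k R H ⊗[k] M) ((coact k (Smash k R H)).lTensor H w) =
        (coact k (Smash k R H)).lTensor (Smash k R H) (inr'.rTensor M w) := by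
      rw [← LinearMap.comp_apply, ← LinearMap.comp_apply, LinearMap.rTensor_comp_lTensor,
        LinearMap.lTensor_comp_rTensor]
    have h3 := comul_rTensor_map (Smash.inr : H →ₐ[k] Smash k R H) (comul_inr k H R)
      (LinearMap.id (R := k) (M := M)) w
    rw [h2, hw, ← coact_coassoc, ← hw]
    refine h3.symm.trans ?_
    generalize TensorProduct.assoc k H H M (comul.rTensor M w) = t
    induction t using TensorProduct.induction_on with
    | zero => simp
    | add x y hx hy => simp only [map_add, hx, hy]
    | tmul a b => rfl
  have h4 : w ∈ LinearMap.ker (f.lTensor H) := by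
    rw [LinearMap.mem_ker, LinearMap.lTensor_comp, LinearMap.comp_apply, h1,
      ← LinearMap.comp_apply, ← LinearMap.lTensor_comp]
    have h5 : (LinearMap.range (inr'.rTensor M)).mkQ ∘ₗ inr'.rTensor M = 0 :=
      LinearMap.range_mkQ_comp _
    rw [h5]
    simp
  have h6 : w ∈ LinearMap.ker (TensorProduct.AlgebraTensorModule.lTensor k H f) := h4
  rw [Module.Flat.ker_lTensor_eq, hf] at h6
  obtain ⟨v, hv⟩ := h6
  have hv' : (highestWeight k H R M).subtype.lTensor H v = w := hv
  refine ⟨v, ?_⟩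
  change _ = coact k (Smash k R H) m
  rw [← hw, ← hv', ← LinearMap.comp_apply, LinearMap.rTensor_comp_lTensor]
  rfl

variable (k H R M) in
/-- The restriction to `M_H` of the coaction. -/
def coactH : highestWeight k H R M →ₗ[k] H ⊗[k] highestWeight k H R M :=
  (LinearEquiv.ofInjective (incl k H R M) (incl_injective k H R M)).symm.toLinearMap ∘ₗ
    (coact k (Smash k R H) ∘ₗ (highestWeight k H R M).subtype).codRestrict
      (LinearMap.range (incl k H R M)) coact_mem

theorem incl_coactH (m : highestWeight k H R M) :
    incl k H R M (coactH k H R M m) = coact k (Smash k R H) (m : M) := by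
  have := LinearEquiv.apply_symm_apply
    (LinearEquiv.ofInjective (incl k H R M) (incl_injective k H R M))
    ⟨coact k (Smash k R H) (m : M), coact_mem m⟩
  exact congrArg Subtype.val this

/-- `M_H` is a comodule over `H`. -/
instance : LeftComodule k H (highestWeight k H R M) where
  coact := coactH k H R M
  coact_coassoc m := by
    have hinj : Function.Injective (TensorProduct.map (Smash.inr : H →ₐ[k] Smash k R H).toLinearMap
        (incl k H R M)) :=
      TensorProduct.map_injective_of_flat_flat _ _ (inr_injective k H R) (incl_injective k H R M)
    refine hinj ?_
    have h1 := comul_rTensor_map (Smash.inr : H →ₐ[k] Smash k R H) (comul_inr k H R)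
      (highestWeight k H R M).subtype (coactH k H R M m)
    refine h1.trans ?_
    change TensorProduct.assoc k _ _ M (comul.rTensor M (incl k H R M (coactH k H R M m))) = _
    rw [incl_coactH, coact_coassoc, ← incl_coactH]
    generalize coactH k H R M m = t
    induction t using TensorProduct.induction_on with
    | zero => simp
    | add x y hx hy => simp only [map_add, hx, hy]
    | tmul a b => simp [incl_coactH]; simp [incl]
  coact_counit m := by
    refine Subtype.ext ?_
    have h1 : TensorProduct.lid k M (counit.rTensor M (coact k (Smash k R H) (m : M))) = m :=
      coact_counit _
    rw [← incl_coactH] at h1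
    refine Eq.trans ?_ h1
    generalize coactH k H R M m = t
    induction t using TensorProduct.induction_on with
    | zero => simp
    | add x y hx hy => simp only [map_add, Submodule.coe_add, hx, hy]
    | tmul a b =>
      have : counit (R := k) (Smash.inr a : Smash k R H) = counit a := Smash.counitA_inr k H R a
      simp [incl, this]

/-- `M_H` is a Yetter-Drinfel'd module over `H`. -/
instance : YetterDrinfeld k H (highestWeight k H R M) where
  coact_smul h m := by
    refine incl_injective k H R M ?_
    refine (incl_coactH (h • m)).trans ?_
    rw [coe_smul, YetterDrinfeld.coact_smul, comul_map _ (comul_inr k H R), ← incl_coactH]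
    exact (ydMap_map _ (antipode_inr k H R) (highestWeight k H R M).subtype (fun h n => rfl)
      _ _).symm

end highestWeight

end HighestWeight

/-! ### Gradings and Nichols algebras -/

section Grading

variable {k A B : Type*} [Field k] [AddCommGroup A] [Module k A] [AddCommGroup B] [Module k B]

/-- The span `U ⊗ W ⊆ A ⊗ B` for subspaces `U ⊆ A` and `W ⊆ B`. -/
def subTensor (U : Submodule k A) (W : Submodule k B) : Submodule k (A ⊗[k] B) :=
  LinearMap.range (TensorProduct.map U.subtype W.subtype)

/-- The degree `n` part `∑_{i + j = n} A(i) ⊗ B(j)` of a tensor product of graded spaces. -/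
def tensorDegree (𝒜 : ℕ → Submodule k A) (ℬ : ℕ → Submodule k B) (n : ℕ) :
    Submodule k (A ⊗[k] B) :=
  ⨆ p ∈ Finset.HasAntidiagonal.antidiagonal n, subTensor (𝒜 p.1) (ℬ p.2)

end Grading

/-- The braided Hopf algebra `R` over `H` with the grading `R = ⨁ R(n)` (here `R(n) = 𝒢 n`) is a
Nichols algebra of the Yetter-Drinfel'd module `W`, where `ι : W → R` identifies `W` with `R(1)`. -/
structure IsNicholsAlgebra {k H W R : Type*} [Field k] [Ring H] [HopfAlgebra k H]
    [AddCommGroup W] [Module k W] [Module H W] [IsScalarTower k H W] [YetterDrinfeld k H W]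
    [Ring R] [Algebra k R] [Module H R] [IsScalarTower k H R] [Coalgebra k R]
    [BraidedHopfAlgebra k H R] (ι : W →ₗ[k] R) (𝒢 : ℕ → Submodule k R) : Prop where
  isInternal : DirectSum.IsInternal 𝒢
  one_mem : (1 : R) ∈ 𝒢 0
  mul_mem : ∀ i j, ∀ x ∈ 𝒢 i, ∀ y ∈ 𝒢 j, x * y ∈ 𝒢 (i + j)
  comul_mem : ∀ n, ∀ x ∈ 𝒢 n, comul (R := k) x ∈ tensorDegree 𝒢 𝒢 n
  counit_eq_zero : ∀ n, n ≠ 0 → ∀ x ∈ 𝒢 n, counit (R := k) x = 0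
  braiding_mem : ∀ i j, ∀ x ∈ 𝒢 i, ∀ y ∈ 𝒢 j,
    braiding k H R R (x ⊗ₜ y) ∈ subTensor (𝒢 j) (𝒢 i)
  ι_injective : Function.Injective ι
  range_ι : LinearMap.range ι = 𝒢 1
  ι_smul : ∀ (h : H) (w : W), ι (h • w) = h • ι w
  coact_ι : ∀ w : W, coact k H (ι w) = ι.lTensor H (coact k H w)
  adjoin_eq_top : Algebra.adjoin k (𝒢 1 : Set R) = ⊤
  /-- `R(1)` is the space of primitive elements -/
  mem_one_iff : ∀ x : R, x ∈ 𝒢 1 ↔ comul (R := k) x = x ⊗ₜ 1 + 1 ⊗ₜ x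

/-- The grading `A(n) = R(n) # H` of `A = R # H` given by a grading of `R`. -/
def smashGrading {k R : Type*} (H : Type*) [Field k] [AddCommGroup R] [Module k R]
    [AddCommGroup H] [Module k H] (𝒢 : ℕ → Submodule k R) (n : ℕ) : Submodule k (Smash k R H) :=
  (subTensor (𝒢 n) (⊤ : Submodule k H)).map Smash.ofTensor.toLinearMap

/-- `M = ⨁_{n ≥ 1} M(n)` is a graded Yetter-Drinfel'd module over `A = ⨁ A(n)`. -/
structure IsGradedYD {k A M : Type*} [Field k] [Ring A] [HopfAlgebra k A]
    [AddCommGroup M] [Module k M] [Module A M] [IsScalarTower k A M] [YetterDrinfeld k A M]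
    (𝒜 : ℕ → Submodule k A) (ℳ : ℕ → Submodule k M) : Prop where
  isInternal : DirectSum.IsInternal ℳ
  zero : ℳ 0 = ⊥
  smul_mem : ∀ i j, ∀ a ∈ 𝒜 i, ∀ m ∈ ℳ j, a • m ∈ ℳ (i + j)
  coact_mem : ∀ n, ∀ m ∈ ℳ n, coact k A m ∈ tensorDegree 𝒜 ℳ n

section Main

variable {k H V R M : Type*} [Field k] [Ring H] [HopfAlgebra k H]
  [AddCommGroup V] [Module k V] [Module H V]
  [Ring R] [Algebra k R] [Module H R] [IsScalarTower k H R] [Coalgebra k R]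
  [BraidedHopfAlgebra k H R]
  [AddCommGroup M] [Module k M] [Module (Smash k R H) M] [IsScalarTower k (Smash k R H) M]
  [YetterDrinfeld k (Smash k R H) M]

/-- The graded Yetter-Drinfel'd module `M` over `R # H` (with `(R # H)(n) = R(n) # H`) is of highest
weight: `M_H = M(1)`, and `M` is generated by `M_H` as a module. -/
structure IsHighestWeight (𝒢 : ℕ → Submodule k R) (ℳ : ℕ → Submodule k M) : Prop
    extends IsGradedYD (smashGrading H 𝒢) ℳ where
  highestWeight_eq : highestWeight k H R M = ℳ 1
  span_eq_top : Submodule.span (Smash k R H) (highestWeight k H R M : Set M) = ⊤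

/-- The algebra map `p : T_c(M_H ⊕ V) → T_c(M) # R` that sends `m ∈ M_H` to `m # 1` and `v ∈ V` to
`1 # ι(v)`. -/
def projBiproduct (ι : V →ₗ[k] R) :
    Tc k H (highestWeight k H R M × V) →ₐ[k] BraidedBiproduct k H (Tc k (Smash k R H) M) R :=
  Tc.lift <| LinearMap.coprod
    (BraidedBiproduct.ofTensor.toLinearMap ∘ₗ
      (TensorProduct.mk k (Tc k (Smash k R H) M) R).flip 1 ∘ₗ
        Tc.ι k (Smash k R H) M ∘ₗ (highestWeight k H R M).subtype)
    (BraidedBiproduct.ofTensor.toLinearMap ∘ₗ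
      TensorProduct.mk k (Tc k (Smash k R H) M) R 1 ∘ₗ ι)

/-- The linear map `T_c(M) # R → T_c(M)`, `∑ m_i # v_i ↦ ∑ m_i ((v_i # 1) m)`. -/
def applyTo (m : Tc k (Smash k R H) M) :
    BraidedBiproduct k H (Tc k (Smash k R H) M) R →ₗ[k] Tc k (Smash k R H) M :=
  LinearMap.mul' k (Tc k (Smash k R H) M) ∘ₗ
    ((act k (Smash k R H) (Tc k (Smash k R H) M)).flip m ∘ₗ
      (Smash.inl : R →ₐ[k] Smash k R H).toLinearMap).lTensor (Tc k (Smash k R H) M) ∘ₗ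
    BraidedBiproduct.ofTensor.symm.toLinearMap

/-- The set of all elements `∑ m_i^x ((v_i^x # 1) m)` with `x ∈ X`, `m ∈ T_c(M)`, where
`p(x) = ∑ m_i^x # v_i^x`. -/
def hatSet (ι : V →ₗ[k] R) (X : Set (Tc k H (highestWeight k H R M × V))) :
    Set (Tc k (Smash k R H) M) :=
  {y | ∃ x ∈ X, ∃ m : Tc k (Smash k R H) M, y = applyTo m (projBiproduct ι x)}

set_option linter.unusedSectionVars false in
/-- The formula for `applyTo` on a sum `∑ a_i # v_i`. -/
theorem applyTo_sum {I : Type*} (s : Finset I) (m : Tc k (Smash k R H) M)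
    (a : I → Tc k (Smash k R H) M) (v : I → R) :
    applyTo m (BraidedBiproduct.ofTensor (H := H) (∑ i ∈ s, a i ⊗ₜ[k] v i)) =
      ∑ i ∈ s, a i * ((Smash.inl (v i) : Smash k R H) • m) := by
  simp [applyTo]

end Main

end YDNichols

end

open scoped TensorProduct
open Coalgebra

noncomputable section

namespace YDNichols

open LeftComodule

attribute [local instance 2000] zeroHomClass_linearEquiv zeroHomClass_linearMap
  addHomClass_linearEquiv addHomClass_linearMap

/-! ### Linear algebra of gradings -/

section LinearAlgebra

variable {k : Type*} [Field k]

/-! Write `A` for `R # H`, where `R`, `Q` and `N` are the Nichols algebras of `V`, `M` and `M_H ⊕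
V`, and write `T` for the tensor algebra of `M`. The proof rests on two facts. The kernel of `q` is
also the kernel of the composite `projQ` of `p` with `π ⊗ id : T # R → Q # R`, and the image of `p`
contains `T # 1`.

The first fact is obtained without constructing an isomorphism between `N` and `Q # R`. Call `D` a
skew derivation if `D(1) = 0` and `D(w y) = w D(y) + w₍₋₁₎ y ⊗ w₍₀₎` for generators `w`. The tensor
algebra of `M_H ⊕ V` has one, and so has every Nichols algebra, namely `(id ⊗ pr₁) Δ`. In a Nichols
algebra its constants are the scalars, because primitive elements have degree one
(`IsNicholsAlgebra.eq_of_deriv_eq_zero`). On `Q # R` a skew derivation is written down by hand: its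
`V`-component is `id ⊗ D_R`, and its `M_H`-component sends `x # r` to `(id ⊗ E_r) D_Q(x)` with
`E_r(m) = π_R(m₍₋₁₎ r) ⊗ pr(m₍₀₎)`, where `pr` projects `M` to `M(1) = M_H`. The product rule comes
from the Yetter-Drinfel'd condition (`coactProj_inl_smul`, `derivL_mul_ι`). The constants are the
scalars because `E_1` is injective (`eq_zero_of_coactProj_one`), and here `M_H = M(1)` enters: the
coinvariants of `M` over `R` are highest weight vectors, and `pr` fixes these. Since the derivation
lowers degree in the tensor algebra, an induction on degree shows that two quotient maps compatible
with such derivations and with counits have the same kernel (`Tc.ker_le_of_deriv`,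
`lift_eq_zero_iff`).

The second fact uses that `M` is generated by `M_H`. In `T # A` the action of `H` on `M` is adjoint,
and the action of `v ∈ V` is a braided commutator with `v`. Hence the image of `p`, which contains
`M_H` and `R`, contains all of `M` (`inl_mem_range`).

To conclude, let `T # A` act on `T` by `(x # a) m = x (a m)`, so that the elements of the set `X̂`
are the values of the operators `p(x)`. If `q(x) = 0`, then `π` kills these values, as their images
under `π` depend only on `projQ x`. Conversely, let `J` be the ideal generated by `A X̂`, which is
stable under `A`. The elements of `T # A` that map `T` into `J` form a two-sided ideal, which
contains `p(x)` for `x ∈ X` and then also `p(h x) = h₍₁₎ p(x) S(h₍₂₎)`. For `y ∈ ker π` choose `t`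
with `p(t) = y # 1`. Then `projQ t = 0`, so `t ∈ ker q`, which is generated by `H X`. Hence `y # 1`
maps `T` into `J`, and applying it to `1` gives `y ∈ J`. -/

theorem exists_comp_of_ker_le {A B C : Type*} [AddCommGroup A] [Module k A]
    [AddCommGroup B] [Module k B] [AddCommGroup C] [Module k C] (f : A →ₗ[k] B) (g : A →ₗ[k] C)
    (h : LinearMap.ker f ≤ LinearMap.ker g) : ∃ e : B →ₗ[k] C, e ∘ₗ f = g := by
  -- Over a field, `f` has a section over its range, and `g ∘ s` extends from the range of `f` to
  -- all of `B`.
  obtain ⟨s, hs⟩ := f.rangeRestrict.exists_rightInverse_of_surjective f.range_rangeRestrict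
  obtain ⟨e, he⟩ := LinearMap.exists_extend (g ∘ₗ s)
  refine ⟨e, LinearMap.ext fun x => ?_⟩
  have h1 : e (f x) = g (s (f.rangeRestrict x)) := LinearMap.congr_fun he (f.rangeRestrict x)
  have h2 : f.rangeRestrict (s (f.rangeRestrict x)) = f.rangeRestrict x :=
    LinearMap.congr_fun hs _
  have h3 : f (s (f.rangeRestrict x)) = f x := congrArg Subtype.val h2
  have h4 : s (f.rangeRestrict x) - x ∈ LinearMap.ker g := h (by simp [h3])
  rw [LinearMap.comp_apply, h1]
  rw [LinearMap.mem_ker, map_sub, sub_eq_zero] at h4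
  exact h4

/-- If `f` and `g` are linear maps on `A` such that `f x = 0` implies `g x = 0` for `x ∈ U`, then
the same holds for `id ⊗ f` and `id ⊗ g` on `B ⊗ U`. -/
theorem lTensor_eq_zero {A B C D : Type*} [AddCommGroup A] [Module k A]
    [AddCommGroup B] [Module k B] [AddCommGroup C] [Module k C] [AddCommGroup D] [Module k D]
    (U : Submodule k A) (f : A →ₗ[k] C) (g : A →ₗ[k] D) (h : ∀ x ∈ U, f x = 0 → g x = 0)
    {t : B ⊗[k] A} (ht : t ∈ LinearMap.range (U.subtype.lTensor B)) (hf : f.lTensor B t = 0) :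
    g.lTensor B t = 0 := by
  -- The pointwise implication says nothing directly about sums of tensors. The factorization `g = e
  -- ∘ f` on `U`, however, survives tensoring.
  obtain ⟨e, he⟩ := exists_comp_of_ker_le (f ∘ₗ U.subtype) (g ∘ₗ U.subtype)
    (fun x hx => h x x.2 hx)
  obtain ⟨s, rfl⟩ := ht
  rw [← LinearMap.comp_apply, ← LinearMap.lTensor_comp] at hf ⊢
  rw [← he, LinearMap.lTensor_comp, LinearMap.comp_apply, hf, map_zero]

theorem rTensor_eq_zero {A B C D : Type*} [AddCommGroup A] [Module k A]
    [AddCommGroup B] [Module k B] [AddCommGroup C] [Module k C] [AddCommGroup D] [Module k D]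
    (U : Submodule k A) (f : A →ₗ[k] C) (g : A →ₗ[k] D) (h : ∀ x ∈ U, f x = 0 → g x = 0)
    {t : A ⊗[k] B} (ht : t ∈ LinearMap.range (U.subtype.rTensor B)) (hf : f.rTensor B t = 0) :
    g.rTensor B t = 0 := by
  obtain ⟨e, he⟩ := exists_comp_of_ker_le (f ∘ₗ U.subtype) (g ∘ₗ U.subtype)
    (fun x hx => h x x.2 hx)
  obtain ⟨s, rfl⟩ := ht
  rw [← LinearMap.comp_apply, ← LinearMap.rTensor_comp] at hf ⊢
  rw [← he, LinearMap.rTensor_comp, LinearMap.comp_apply, hf, map_zero]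

theorem rTensor_lTensor_comm {A B C D : Type*} [AddCommGroup A] [Module k A]
    [AddCommGroup B] [Module k B] [AddCommGroup C] [Module k C] [AddCommGroup D] [Module k D]
    (f : A →ₗ[k] B) (g : C →ₗ[k] D) (t : A ⊗[k] C) :
    f.rTensor D (g.lTensor A t) = g.lTensor B (f.rTensor C t) := by
  rw [← LinearMap.comp_apply, ← LinearMap.comp_apply, LinearMap.rTensor_comp_lTensor,
    LinearMap.lTensor_comp_rTensor]

theorem eq_zero_of_lTensor_inl_add_inr {A B C : Type*} [AddCommGroup A] [Module k A]
    [AddCommGroup B] [Module k B] [AddCommGroup C] [Module k C] {s : A ⊗[k] B} {t : A ⊗[k] C}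
    (h : (LinearMap.inl k B C).lTensor A s + (LinearMap.inr k B C).lTensor A t = 0) :
    s = 0 ∧ t = 0 := by
  constructor
  · have h1 := congrArg ((LinearMap.fst k B C).lTensor A) h
    rw [map_add, map_zero, ← LinearMap.lTensor_comp_apply, ← LinearMap.lTensor_comp_apply,
      LinearMap.fst_comp_inl, LinearMap.fst_comp_inr, LinearMap.lTensor_id,
      LinearMap.lTensor_zero] at h1
    simpa using h1
  · have h1 := congrArg ((LinearMap.snd k B C).lTensor A) h
    rw [map_add, map_zero, ← LinearMap.lTensor_comp_apply, ← LinearMap.lTensor_comp_apply,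
      LinearMap.snd_comp_inl, LinearMap.snd_comp_inr, LinearMap.lTensor_id,
      LinearMap.lTensor_zero] at h1
    simpa using h1

/-- This serves to apply `lTensor_eq_zero` with `U = ⊤`. -/
theorem mem_range_lTensor_top {A B : Type*} [AddCommGroup A] [Module k A]
    [AddCommGroup B] [Module k B] (t : A ⊗[k] B) :
    t ∈ LinearMap.range ((⊤ : Submodule k B).subtype.lTensor A) :=
  LinearMap.lTensor_surjective A (fun b => ⟨⟨b, trivial⟩, rfl⟩) t

variable {A : Type*} [AddCommGroup A] [Module k A]

/-- The projection to the degree `n` part of an internal direct sum. -/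
def gradedProj {𝒜 : ℕ → Submodule k A} (h : DirectSum.IsInternal 𝒜) (n : ℕ) : A →ₗ[k] 𝒜 n :=
  DirectSum.component k ℕ (fun i => 𝒜 i) n ∘ₗ
    (LinearEquiv.ofBijective (DirectSum.coeLinearMap 𝒜) h).symm.toLinearMap

theorem gradedProj_coe {𝒜 : ℕ → Submodule k A} (h : DirectSum.IsInternal 𝒜) (n : ℕ) (x : 𝒜 n) :
    gradedProj h n (x : A) = x := by
  have : (LinearEquiv.ofBijective (DirectSum.coeLinearMap 𝒜) h).symm (x : A) =
      DirectSum.lof k ℕ (fun i => 𝒜 i) n x := by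
    rw [LinearEquiv.symm_apply_eq]
    exact (DirectSum.coeLinearMap_lof _ _ _).symm
  rw [gradedProj, LinearMap.comp_apply, LinearEquiv.coe_coe, this, DirectSum.component.lof_self]

theorem gradedProj_of_ne {𝒜 : ℕ → Submodule k A} (h : DirectSum.IsInternal 𝒜) {m n : ℕ}
    (hmn : m ≠ n) {x : A} (hx : x ∈ 𝒜 m) : gradedProj h n x = 0 := by
  have : (LinearEquiv.ofBijective (DirectSum.coeLinearMap 𝒜) h).symm x =
      DirectSum.lof k ℕ (fun i => 𝒜 i) m ⟨x, hx⟩ := by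
    rw [LinearEquiv.symm_apply_eq]
    exact (DirectSum.coeLinearMap_lof 𝒜 m ⟨x, hx⟩).symm
  rw [gradedProj, LinearMap.comp_apply, LinearEquiv.coe_coe, this, DirectSum.component.of,
    dif_neg hmn]

theorem graded_induction {𝒜 : ℕ → Submodule k A} (h : DirectSum.IsInternal 𝒜) {p : A → Prop}
    (zero : p 0) (mem : ∀ n, ∀ x ∈ 𝒜 n, p x) (add : ∀ x y, p x → p y → p (x + y)) (x : A) : p x := by
  have hx : x ∈ ⨆ n, 𝒜 n := by rw [h.submodule_iSup_eq_top]; trivial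
  induction hx using Submodule.iSup_induction' with
  | mem i x hx => exact mem i x hx
  | zero => exact zero
  | add x y _ _ hx hy => exact add x y hx hy

/-- The part of degree less than `n`. -/
def degreeLT (𝒜 : ℕ → Submodule k A) (n : ℕ) : Submodule k A := ⨆ i : Fin n, 𝒜 i

theorem le_degreeLT (𝒜 : ℕ → Submodule k A) {i n : ℕ} (h : i < n) : 𝒜 i ≤ degreeLT 𝒜 n :=
  le_iSup (fun i : Fin n => 𝒜 i) ⟨i, h⟩

theorem degreeLT_zero (𝒜 : ℕ → Submodule k A) : degreeLT 𝒜 0 = ⊥ := by simp [degreeLT]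

theorem degreeLT_mono (𝒜 : ℕ → Submodule k A) {m n : ℕ} (h : m ≤ n) :
    degreeLT 𝒜 m ≤ degreeLT 𝒜 n :=
  iSup_le fun i => le_degreeLT 𝒜 (i.2.trans_le h)

theorem exists_mem_degreeLT {𝒜 : ℕ → Submodule k A} (h : DirectSum.IsInternal 𝒜) (x : A) :
    ∃ n, x ∈ degreeLT 𝒜 n := by
  induction x using graded_induction h with
  | zero => exact ⟨0, zero_mem _⟩
  | mem n x hx => exact ⟨n + 1, le_degreeLT 𝒜 n.lt_succ_self hx⟩
  | add x y hx hy =>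
    obtain ⟨m, hm⟩ := hx
    obtain ⟨n, hn⟩ := hy
    exact ⟨max m n, add_mem (degreeLT_mono 𝒜 (le_max_left m n) hm)
      (degreeLT_mono 𝒜 (le_max_right m n) hn)⟩

/-- A map `id ⊗ f` that vanishes on the summand with `i = 0` lowers the degree on the right. -/
theorem rTensor_mem_of_tensorDegree {B C : Type*} [AddCommGroup B] [Module k B]
    [AddCommGroup C] [Module k C] (ℬ : ℕ → Submodule k B) (𝒜 : ℕ → Submodule k A)
    (f : B →ₗ[k] C) (hf : ∀ b ∈ ℬ 0, f b = 0) {n N : ℕ} (hn : n ≤ N) {t : B ⊗[k] A}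
    (ht : t ∈ tensorDegree ℬ 𝒜 n) :
    f.rTensor A t ∈ LinearMap.range ((degreeLT 𝒜 N).subtype.lTensor C) := by
  suffices h : tensorDegree ℬ 𝒜 n ≤
      (LinearMap.range ((degreeLT 𝒜 N).subtype.lTensor C)).comap (f.rTensor A) from h ht
  refine iSup₂_le fun p hp => ?_
  rintro _ ⟨s, rfl⟩
  rw [Finset.HasAntidiagonal.mem_antidiagonal] at hp
  induction s using TensorProduct.induction_on with
  | zero => simp
  | add x y hx hy => rw [map_add]; exact add_mem hx hy
  | tmul b a =>
    change f b ⊗ₜ (a : A) ∈ LinearMap.range ((degreeLT 𝒜 N).subtype.lTensor C)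
    by_cases h0 : p.1 = 0
    · rw [hf b (h0 ▸ b.2), TensorProduct.zero_tmul]
      exact zero_mem _
    -- From `p.1 > 0` and `p.1 + p.2 = n ≤ N` it follows that `p.2 < N`.
    · exact ⟨f b ⊗ₜ ⟨a, le_degreeLT 𝒜 (by omega) a.2⟩, rfl⟩

end LinearAlgebra

/-! ### Skew derivations of Nichols algebras -/

namespace IsNicholsAlgebra

variable {k H W R : Type*} [Field k] [Ring H] [HopfAlgebra k H]
  [AddCommGroup W] [Module k W] [Module H W] [IsScalarTower k H W] [YetterDrinfeld k H W]
  [Ring R] [Algebra k R] [Module H R] [IsScalarTower k H R] [Coalgebra k R]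
  [BraidedHopfAlgebra k H R] {ι : W →ₗ[k] R} {𝒢 : ℕ → Submodule k R}

theorem ι_mem (hR : IsNicholsAlgebra (H := H) ι 𝒢) (w : W) : ι w ∈ 𝒢 1 := by
  rw [← hR.range_ι]; exact ⟨w, rfl⟩

theorem counit_ι (hR : IsNicholsAlgebra (H := H) ι 𝒢) (w : W) : counit (R := k) (ι w) = 0 :=
  hR.counit_eq_zero 1 one_ne_zero _ (hR.ι_mem w)

theorem comul_ι (hR : IsNicholsAlgebra (H := H) ι 𝒢) (w : W) :
    comul (R := k) (ι w) = ι w ⊗ₜ 1 + 1 ⊗ₜ ι w :=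
  (hR.mem_one_iff _).1 (hR.ι_mem w)

theorem adjoin_range (hR : IsNicholsAlgebra (H := H) ι 𝒢) :
    Algebra.adjoin k (Set.range ι) = ⊤ := by
  rw [← hR.adjoin_eq_top, ← hR.range_ι]; rfl

/-- Everything is a linear combination of products of elements of degree one. -/
theorem mul_induction (hR : IsNicholsAlgebra (H := H) ι 𝒢) (S : Submodule k R) (one : 1 ∈ S)
    (mul : ∀ w, ∀ y ∈ S, ι w * y ∈ S) (x : R) : x ∈ S := by
  have hx : x ∈ Algebra.adjoin k (Set.range ι) := by rw [hR.adjoin_range]; trivial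
  -- The stability of `S` under left multiplication by `x` passes to sums and products in `x`. The
  -- claim is the case `y = 1`.
  suffices h : ∀ y ∈ S, x * y ∈ S by simpa using h 1 one
  induction hx using Algebra.adjoin_induction with
  | mem x hx => obtain ⟨w, rfl⟩ := hx; exact mul w
  | algebraMap c => intro y hy; rw [← Algebra.smul_def]; exact S.smul_mem c hy
  | add a b _ _ ha hb => intro y hy; rw [add_mul]; exact add_mem (ha y hy) (hb y hy)
  | mul a b _ _ ha hb => intro y hy; rw [mul_assoc]; exact ha _ (hb y hy)

/-- That `R(0)` consists of scalars is not an axiom here; it follows from generation in degree one.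
Both sides agree at `1`, and both vanish on a product `w y` with `w` of degree one: the left side
because the components of `w y` have positive degree, the right side because the counit vanishes on
`w`. -/
theorem gradedProj_zero (hR : IsNicholsAlgebra (H := H) ι 𝒢) (x : R) :
    (gradedProj hR.isInternal 0 x : R) = counit (R := k) x • 1 := by
  let S : Submodule k R := LinearMap.ker ((𝒢 0).subtype ∘ₗ gradedProj hR.isInternal 0 -
    LinearMap.toSpanSingleton k R 1 ∘ₗ counit)
  have hS : ∀ x, x ∈ S ↔ (gradedProj hR.isInternal 0 x : R) = counit (R := k) x • 1 := by
    intro x; simp [S, sub_eq_zero]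
  rw [← hS]
  refine hR.mul_induction S ?_ ?_ x
  · rw [hS, gradedProj_coe hR.isInternal 0 ⟨1, hR.one_mem⟩,
      BraidedHopfAlgebra.counit_one (k := k) (H := H)]
    simp
  · intro w y hy
    rw [hS, BraidedHopfAlgebra.counit_mul (k := k) (H := H), hR.counit_ι]
    clear x hy
    induction y using graded_induction hR.isInternal with
    | zero => simp
    | add x y hx hy =>
      rw [mul_add, map_add, Submodule.coe_add, hx, hy]; simp
    | mem n y hy =>
      rw [gradedProj_of_ne hR.isInternal (m := 1 + n) (by omega)
        (hR.mul_mem 1 n _ (hR.ι_mem w) _ hy)]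
      simp

theorem eq_counit_smul_of_mem_zero (hR : IsNicholsAlgebra (H := H) ι 𝒢) {x : R} (hx : x ∈ 𝒢 0) :
    x = counit (R := k) x • 1 := by
  rw [← hR.gradedProj_zero, gradedProj_coe hR.isInternal 0 ⟨x, hx⟩]

/-- The projection to `W ≅ R(1)`. -/
def projOne (hR : IsNicholsAlgebra (H := H) ι 𝒢) : R →ₗ[k] W :=
  (LinearEquiv.ofInjective ι hR.ι_injective).symm.toLinearMap ∘ₗ
    (LinearEquiv.ofEq _ _ hR.range_ι.symm).toLinearMap ∘ₗ gradedProj hR.isInternal 1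

theorem ι_projOne (hR : IsNicholsAlgebra (H := H) ι 𝒢) (x : R) :
    ι (hR.projOne x) = gradedProj hR.isInternal 1 x := by
  have := LinearEquiv.apply_symm_apply (LinearEquiv.ofInjective ι hR.ι_injective)
    (LinearEquiv.ofEq _ _ hR.range_ι.symm (gradedProj hR.isInternal 1 x))
  exact congrArg Subtype.val this

theorem projOne_ι (hR : IsNicholsAlgebra (H := H) ι 𝒢) (w : W) : hR.projOne (ι w) = w :=
  hR.ι_injective (by rw [hR.ι_projOne, gradedProj_coe hR.isInternal 1 ⟨ι w, hR.ι_mem w⟩])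

theorem projOne_of_ne (hR : IsNicholsAlgebra (H := H) ι 𝒢) {n : ℕ} (hn : n ≠ 1) {x : R}
    (hx : x ∈ 𝒢 n) : hR.projOne x = 0 :=
  hR.ι_injective (by rw [hR.ι_projOne, gradedProj_of_ne hR.isInternal hn hx]; simp)

theorem projOne_one (hR : IsNicholsAlgebra (H := H) ι 𝒢) : hR.projOne 1 = 0 :=
  hR.projOne_of_ne zero_ne_one hR.one_mem

/-- Only the degree zero component of `y` can contribute to degree one of the product, and this
component is the scalar `ε(y)`. -/
theorem projOne_ι_mul (hR : IsNicholsAlgebra (H := H) ι 𝒢) (w : W) (y : R) :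
    hR.projOne (ι w * y) = counit (R := k) y • w := by
  induction y using graded_induction hR.isInternal with
  | zero => simp
  | add x y hx hy => rw [mul_add, map_add, hx, hy, map_add, add_smul]
  | mem n y hy =>
    by_cases hn : n = 0
    · subst hn
      rw [hR.eq_counit_smul_of_mem_zero hy, mul_smul_comm, map_smul, mul_one, hR.projOne_ι]
      simp [BraidedHopfAlgebra.counit_one (k := k) (H := H)]
    · rw [hR.projOne_of_ne (n := 1 + n) (by omega) (hR.mul_mem 1 n _ (hR.ι_mem w) _ hy),
        hR.counit_eq_zero n hn y hy, zero_smul]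

/-- Stability of every `R(n)` under `H` is not an axiom, so linearity of the projection is deduced
from generation in degree one: on a product `w y` both sides are computed by `projOne_ι_mul`, and
the counit of `H` absorbs the second leg of `Δ(h)`. -/
theorem projOne_smul (hR : IsNicholsAlgebra (H := H) ι 𝒢) (h : H) (y : R) :
    hR.projOne (h • y) = h • hR.projOne y := by
  let S : Submodule k R := LinearMap.ker
    (hR.projOne ∘ₗ act k H R h - act k H W h ∘ₗ hR.projOne)
  have hS : ∀ y, y ∈ S ↔ hR.projOne (h • y) = h • hR.projOne y := by
    intro y; simp [S, sub_eq_zero]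
  rw [← hS]
  refine hR.mul_induction S ?_ ?_ y
  · rw [hS, IsModuleAlgebra.smul_one (k := k), Algebra.algebraMap_eq_smul_one, map_smul,
      hR.projOne_one]
    simp
  · intro w y _
    rw [hS, hR.projOne_ι_mul, IsModuleAlgebra.smul_mul (k := k), Smash.diagAct_apply]
    have : ∀ t : H ⊗[k] H, hR.projOne (LinearMap.mul' k R
        (TensorProduct.map₂ (act k H R) (act k H R) t (ι w ⊗ₜ y))) =
        counit (R := k) y • (TensorProduct.rid k H (counit.lTensor H t) • w) := by
      intro t
      induction t using TensorProduct.induction_on with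
      | zero => simp
      | add x y hx hy => simp only [map_add, LinearMap.add_apply, hx, hy, add_smul, smul_add]
      | tmul a b =>
        simp only [TensorProduct.map₂_apply_tmul, TensorProduct.map_tmul, act_apply,
          LinearMap.mul'_apply, ← hR.ι_smul, hR.projOne_ι_mul,
          BraidedHopfAlgebra.counit_smul (k := k) (H := H), LinearMap.lTensor_tmul,
          TensorProduct.rid_tmul]
        rw [smul_assoc, smul_smul, mul_comm]
    rw [this, lTensor_counit_comul, TensorProduct.rid_tmul, one_smul, smul_algebra_smul_comm]

/-- The skew derivation `(id ⊗ pr₁) Δ`. -/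
def deriv (hR : IsNicholsAlgebra (H := H) ι 𝒢) : R →ₗ[k] R ⊗[k] W :=
  hR.projOne.lTensor R ∘ₗ comul

theorem deriv_apply (hR : IsNicholsAlgebra (H := H) ι 𝒢) (x : R) :
    hR.deriv x = hR.projOne.lTensor R (comul x) := rfl

theorem deriv_one (hR : IsNicholsAlgebra (H := H) ι 𝒢) : hR.deriv 1 = 0 := by
  rw [deriv_apply, BraidedHopfAlgebra.comul_one (k := k) (H := H), LinearMap.lTensor_tmul,
    hR.projOne_one, TensorProduct.tmul_zero]

theorem deriv_ι (hR : IsNicholsAlgebra (H := H) ι 𝒢) (w : W) : hR.deriv (ι w) = 1 ⊗ₜ w := by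
  rw [deriv_apply, hR.comul_ι, map_add, LinearMap.lTensor_tmul, LinearMap.lTensor_tmul,
    hR.projOne_one, hR.projOne_ι, TensorProduct.tmul_zero, zero_add]

/-- `D(w y) = w D(y) + w₍₋₁₎ y ⊗ w₍₀₎`. -/
theorem deriv_ι_mul (hR : IsNicholsAlgebra (H := H) ι 𝒢) (w : W) (y : R) :
    hR.deriv (ι w * y) = (LinearMap.mulLeft k (ι w)).rTensor W (hR.deriv y) +
      ((act k H R).flip y).rTensor W (coact k H w) := by
  -- The tensor `s = a ⊗ b` stands for `Δ(y)`. The summand `w ⊗ 1` of `Δ(w)` multiplies the left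
  -- leg. The summand `1 ⊗ w` is braided past `a` and gives `w₍₋₁₎ a ⊗ pr₁(w₍₀₎ b)`, which is `w₍₋₁₎
  -- a ⊗ ε(b) w₍₀₎`.
  have h1 : ∀ s : R ⊗[k] R, hR.projOne.lTensor R
      (braidedMul k H R ((ι w ⊗ₜ 1 + 1 ⊗ₜ ι w) ⊗ₜ s)) =
      (LinearMap.mulLeft k (ι w)).rTensor W (hR.projOne.lTensor R s) +
      ((act k H R).flip (TensorProduct.rid k R (counit.lTensor R s))).rTensor W (coact k H w) := by
    intro s
    induction s using TensorProduct.induction_on with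
    | zero => simp
    | add x y hx hy =>
      simp only [TensorProduct.tmul_add, map_add, hx, hy, LinearMap.rTensor_add,
        LinearMap.add_apply]
      abel
    | tmul a b =>
      simp only [TensorProduct.add_tmul, map_add, braidedMul, braiding, LinearMap.comp_apply,
        LinearEquiv.coe_coe, TensorProduct.assoc_tmul, LinearMap.lTensor_tmul,
        TensorProduct.assoc_symm_tmul, LinearMap.rTensor_tmul, hR.coact_ι,
        BraidedHopfAlgebra.coact_one]
      congr 1
      · simp
      · generalize coact k H w = u
        induction u using TensorProduct.induction_on with
        | zero => simp
        | add x y hx hy => simp only [TensorProduct.add_tmul, TensorProduct.tmul_add, map_add, hx, hy]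
        | tmul g n => simp [hR.projOne_ι_mul]
  rw [deriv_apply, BraidedHopfAlgebra.comul_mul (k := k) (H := H), hR.comul_ι, h1,
    lTensor_counit_comul, TensorProduct.rid_tmul, one_smul, ← deriv_apply]

/-- `D(h y) = h D(y)` for the diagonal action. -/
theorem deriv_smul (hR : IsNicholsAlgebra (H := H) ι 𝒢) (h : H) (y : R) :
    hR.deriv (h • y) = diagAct k H R W h (hR.deriv y) := by
  rw [deriv_apply, deriv_apply, BraidedHopfAlgebra.comul_smul, Smash.diagAct_apply,
    Smash.diagAct_apply]
  generalize comul (R := k) h = t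
  generalize comul (R := k) y = s
  induction t using TensorProduct.induction_on with
  | zero => simp
  | add x y hx hy => simp only [map_add, LinearMap.add_apply, hx, hy]
  | tmul a b =>
    induction s using TensorProduct.induction_on with
    | zero => simp
    | add x y hx hy => simp only [map_add, hx, hy]
    | tmul c d => simp [hR.projOne_smul]

/-- The difference is `(G ⊗ id) Δ(x)` for `G = id - ε 1`, and `G` kills `R(0)`. Every surviving
summand of `Δ(x)` has positive degree on the left and thus smaller degree on the right. -/
theorem comul_sub_mem (hR : IsNicholsAlgebra (H := H) ι 𝒢) {n : ℕ} {x : R}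
    (hx : x ∈ degreeLT 𝒢 (n + 1)) :
    comul (R := k) x - 1 ⊗ₜ x ∈ LinearMap.range ((degreeLT 𝒢 n).subtype.lTensor R) := by
  let G : R →ₗ[k] R := LinearMap.id - LinearMap.toSpanSingleton k R 1 ∘ₗ counit
  have hG : ∀ x : R, comul (R := k) x - 1 ⊗ₜ x = G.rTensor R (comul (R := k) x) := by
    intro x
    rw [LinearMap.rTensor_sub, LinearMap.sub_apply, LinearMap.rTensor_comp, LinearMap.comp_apply,
      rTensor_counit_comul]
    simp
  suffices h : degreeLT 𝒢 (n + 1) ≤ (LinearMap.range ((degreeLT 𝒢 n).subtype.lTensor R)).comap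
      (G.rTensor R ∘ₗ comul) by
    rw [hG]; exact h hx
  refine iSup_le fun i x hx => ?_
  refine rTensor_mem_of_tensorDegree 𝒢 𝒢 G ?_ (Nat.le_of_lt_succ i.2) (hR.comul_mem i x hx)
  intro b hb
  rw [LinearMap.sub_apply, LinearMap.id_apply, sub_eq_zero]
  simpa using hR.eq_counit_smul_of_mem_zero hb

/-- The constants of the skew derivation are the scalars. -/
theorem eq_of_deriv_eq_zero (hR : IsNicholsAlgebra (H := H) ι 𝒢) {x : R} (hx : hR.deriv x = 0) :
    x = counit (R := k) x • 1 := by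
  obtain ⟨n, hn⟩ := exists_mem_degreeLT hR.isInternal x
  induction n generalizing x with
  | zero =>
    rw [degreeLT_zero, Submodule.mem_bot] at hn
    simp [hn]
  | succ n ih =>
    let e : R →ₗ[k] R := LinearMap.id - LinearMap.toSpanSingleton k R 1 ∘ₗ counit
    -- By coassociativity `(id ⊗ D) Δ = (Δ ⊗ id) D`, which vanishes at `x`, and `D(x) = 0` kills the
    -- subtracted term `1 ⊗ x` as well.
    have h1 : hR.deriv.lTensor R (comul (R := k) x - 1 ⊗ₜ x) = 0 := by
      have h2 : hR.deriv.lTensor R (comul (R := k) x) =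
          TensorProduct.assoc k R R W (comul.rTensor W (hR.deriv x)) := by
        rw [deriv, LinearMap.lTensor_comp, LinearMap.comp_apply, ← coassoc_apply,
          LinearMap.comp_apply]
        generalize comul (R := k) x = s
        induction s using TensorProduct.induction_on with
        | zero => simp
        | add x y hx hy => simp only [map_add, hx, hy]
        | tmul a b =>
          simp only [LinearMap.rTensor_tmul, LinearMap.lTensor_tmul]
          generalize comul (R := k) a = s
          induction s using TensorProduct.induction_on with
          | zero => simp
          | add x y hx hy => simp only [map_add, TensorProduct.add_tmul, hx, hy]
          | tmul c d => simp
      rw [map_sub, h2, LinearMap.lTensor_tmul, hx]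
      simp
    -- The right legs have smaller degree, where by induction `D(y) = 0` implies `y = ε(y) 1`. So
    -- `D` may be replaced by `e = id - ε 1`.
    have h3 : e.lTensor R (comul (R := k) x - 1 ⊗ₜ x) = 0 := by
      refine lTensor_eq_zero (degreeLT 𝒢 n) hR.deriv e (fun y hy hy0 => ?_)
        (hR.comul_sub_mem hn) h1
      rw [LinearMap.sub_apply, LinearMap.id_apply, sub_eq_zero]
      simpa using ih hy0 hy
    have h4 : comul (R := k) x = 1 ⊗ₜ x + x ⊗ₜ 1 - counit (R := k) x • (1 ⊗ₜ 1) := by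
      rw [LinearMap.lTensor_sub, LinearMap.sub_apply, LinearMap.lTensor_id, LinearMap.id_apply,
        LinearMap.lTensor_comp, LinearMap.comp_apply, map_sub, lTensor_counit_comul, sub_eq_zero,
        sub_eq_iff_eq_add] at h3
      rw [h3]
      simp only [LinearMap.lTensor_tmul, map_sub, LinearMap.toSpanSingleton_apply, one_smul,
        TensorProduct.tmul_smul]
      abel
    -- By `h4` this element is primitive, hence of degree one. It must vanish, since `D(w) = 1 ⊗ w`
    -- is injective on `W`.
    have h5 : x - counit (R := k) x • 1 ∈ 𝒢 1 := by
      rw [hR.mem_one_iff, map_sub, map_smul, BraidedHopfAlgebra.comul_one (k := k) (H := H), h4]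
      simp only [TensorProduct.sub_tmul, TensorProduct.tmul_sub, TensorProduct.tmul_smul,
        TensorProduct.smul_tmul']
      abel
    rw [← hR.range_ι] at h5
    obtain ⟨w, hw⟩ := h5
    have h6 : hR.deriv (ι w) = 0 := by rw [hw, map_sub, map_smul, hx, hR.deriv_one]; simp
    have h7 : w = 0 := by
      rw [hR.deriv_ι] at h6
      have := congrArg (TensorProduct.lid k W ∘ (counit (R := k) (A := R)).rTensor W) h6
      simpa [BraidedHopfAlgebra.counit_one (k := k) (H := H)] using this
    rw [h7, map_zero, eq_comm, sub_eq_zero] at hw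
    exact hw

end IsNicholsAlgebra

/-! ### The skew derivation of a tensor algebra -/

namespace Tc

/-! ### Generation and filtration of the tensor algebra -/

section

variable {k H W : Type*} [Field k] [Ring H] [AddCommGroup W] [Module k W] [Module H W]

/-- Everything is a linear combination of products of generators. -/
theorem mul_induction (S : Submodule k (Tc k H W)) (one : 1 ∈ S)
    (mul : ∀ w, ∀ y ∈ S, ι k H W w * y ∈ S) (x : Tc k H W) : x ∈ S := by
  suffices h : ∀ y ∈ S, x * y ∈ S by simpa using h 1 one
  induction x using Tc.induction with
  | ι w => exact mul w
  | algebraMap c => intro y hy; rw [← Algebra.smul_def]; exact S.smul_mem c hy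
  | add a b ha hb => intro y hy; rw [add_mul]; exact add_mem (ha y hy) (hb y hy)
  | mul a b ha hb => intro y hy; rw [mul_assoc]; exact ha _ (hb y hy)

variable (k H W) in
/-- The part of degree less than `n` of the tensor algebra. -/
def filtration : ℕ → Submodule k (Tc k H W)
  | 0 => ⊥
  | n + 1 => Submodule.span k {1} ⊔ Submodule.span k {x | ∃ w, ∃ y ∈ filtration n, x = ι k H W w * y}

theorem one_mem_filtration (n : ℕ) : 1 ∈ filtration k H W (n + 1) :=
  Submodule.mem_sup_left (Submodule.mem_span_singleton_self 1)

theorem ι_mul_mem_filtration {n : ℕ} (w : W) {y : Tc k H W} (hy : y ∈ filtration k H W n) :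
    ι k H W w * y ∈ filtration k H W (n + 1) :=
  Submodule.mem_sup_right (Submodule.subset_span ⟨w, y, hy, rfl⟩)

theorem filtration_succ_le {n : ℕ} {S : Submodule k (Tc k H W)} (one : 1 ∈ S)
    (mul : ∀ w, ∀ y ∈ filtration k H W n, ι k H W w * y ∈ S) : filtration k H W (n + 1) ≤ S := by
  refine sup_le ((Submodule.span_singleton_le_iff_mem _ _).2 one) (Submodule.span_le.2 ?_)
  rintro _ ⟨w, y, hy, rfl⟩
  exact mul w y hy

theorem filtration_mono : Monotone (filtration k H W) := by
  refine monotone_nat_of_le_succ fun n => ?_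
  induction n with
  | zero => exact bot_le
  | succ n ih =>
    exact filtration_succ_le (one_mem_filtration _) fun w y hy => ι_mul_mem_filtration w (ih hy)

theorem exists_mem_filtration (x : Tc k H W) : ∃ n, x ∈ filtration k H W n := by
  have hdir : Directed (· ≤ ·) (filtration k H W) := filtration_mono.directed_le
  have hx : x ∈ ⨆ n, filtration k H W n := by
    refine mul_induction _ (Submodule.mem_iSup_of_mem 1 (one_mem_filtration 0)) ?_ x
    intro w y hy
    obtain ⟨n, hn⟩ := (Submodule.mem_iSup_of_directed _ hdir).1 hy
    exact Submodule.mem_iSup_of_mem (n + 1) (ι_mul_mem_filtration w hn)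
  exact (Submodule.mem_iSup_of_directed _ hdir).1 hx

end

/-! ### The skew derivation and the comparison of kernels -/

section

variable {k H W : Type*} [Field k] [Ring H] [HopfAlgebra k H]
  [AddCommGroup W] [Module k W] [Module H W] [IsScalarTower k H W]

theorem smul_mem_filtration {n : ℕ} (h : H) {x : Tc k H W} (hx : x ∈ filtration k H W n) :
    h • x ∈ filtration k H W n := by
  induction n generalizing h x with
  | zero =>
    have : x = 0 := hx
    rw [this, smul_zero]
    exact zero_mem _
  | succ n ih =>
    suffices hle : filtration k H W (n + 1) ≤ (filtration k H W (n + 1)).comap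
        (act k H (Tc k H W) h) from hle hx
    refine filtration_succ_le ?_ fun w y hy => ?_
    · change h • (1 : Tc k H W) ∈ filtration k H W (n + 1)
      rw [IsModuleAlgebra.smul_one (k := k), Algebra.algebraMap_eq_smul_one]
      exact Submodule.smul_mem _ _ (one_mem_filtration n)
    · change h • (ι k H W w * y) ∈ filtration k H W (n + 1)
      rw [IsModuleAlgebra.smul_mul (k := k), Smash.diagAct_apply]
      generalize comul (R := k) h = t
      induction t using TensorProduct.induction_on with
      | zero => simp
      | add x y hx hy => simp only [map_add, LinearMap.add_apply]; exact add_mem hx hy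
      | tmul a b =>
        change (a • ι k H W w) * (b • y) ∈ filtration k H W (n + 1)
        rw [smul_ι]
        exact ι_mul_mem_filtration _ (ih b hy)

variable [LeftComodule k H W]

/-- Multiplication by `w` on the square zero extension of `T_c(W)` by `T_c(W) ⊗ W`. -/
def derivStep : W →ₗ[k] Module.End k (Tc k H W × (Tc k H W ⊗[k] W)) :=
  LinearMap.mk₂ k
    -- The second component is the desired product rule for `D(w y)`, with `x` playing the role of
    -- `(y, D(y))`. As an operator that is linear in `w`, it extends to the tensor algebra by the
    -- universal property, and `D(a)` is then read off from `a` applied to `(1, 0)`.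
    (fun w x => (ι k H W w * x.1, LinearMap.rTensorHom W (LinearMap.mul k _ (ι k H W w)) x.2 +
      LinearMap.rTensorHom W ((act k H (Tc k H W)).flip x.1) (coact k H w)))
    (fun w w' x => by
      simp only [map_add, add_mul, Prod.mk_add_mk, LinearMap.add_apply, Prod.mk.injEq, true_and]
      abel)
    (fun c w x => by
      simp only [map_smul, smul_mul_assoc, LinearMap.smul_apply, Prod.smul_mk, smul_add])
    (fun w x y => by
      simp only [map_add, mul_add, Prod.mk_add_mk, Prod.fst_add,
        Prod.snd_add, LinearMap.add_apply, Prod.mk.injEq, true_and]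
      abel)
    (fun c w x => by
      simp only [map_smul, mul_smul_comm, LinearMap.smul_apply, Prod.smul_mk, smul_add,
        Prod.smul_fst, Prod.smul_snd])

/-- The action of `T_c(W)` on its square zero extension by `T_c(W) ⊗ W`. -/
def derivAct : Tc k H W →ₐ[k] Module.End k (Tc k H W × (Tc k H W ⊗[k] W)) :=
  lift (B := Module.End k (Tc k H W × (Tc k H W ⊗[k] W))) derivStep

/-- The skew derivation `T_c(W) → T_c(W) ⊗ W` that sends `w ∈ W` to `1 ⊗ w`. -/
def deriv : Tc k H W →ₗ[k] Tc k H W ⊗[k] W :=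
  LinearMap.snd k (Tc k H W) (Tc k H W ⊗[k] W) ∘ₗ
    (LinearMap.applyₗ (R := k) ((1, 0) : Tc k H W × (Tc k H W ⊗[k] W))) ∘ₗ
      (derivAct (k := k) (H := H) (W := W)).toLinearMap

theorem deriv_one : deriv (1 : Tc k H W) = 0 := by simp [deriv]

/-- The first component of `y` applied to `(1, 0)` is `y` itself, so the correction term in the
action of `w` involves exactly `y`. -/
theorem deriv_ι_mul (w : W) (y : Tc k H W) :
    deriv (ι k H W w * y) = (LinearMap.mulLeft k (ι k H W w)).rTensor W (deriv y) +
      ((act k H (Tc k H W)).flip y).rTensor W (coact k H w) := by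
  have h1 : ∀ (a : Tc k H W) (x : Tc k H W × (Tc k H W ⊗[k] W)),
      (derivAct a x).1 = a * x.1 := by
    intro a
    induction a using Tc.induction with
    | algebraMap c => intro x; simp [Algebra.smul_def]
    | ι w => intro x; rw [derivAct, lift_ι]; rfl
    | add a b ha hb => intro x; rw [map_add, LinearMap.add_apply, Prod.fst_add, ha, hb, add_mul]
    | mul a b ha hb => intro x; rw [map_mul, Module.End.mul_apply, ha, hb, mul_assoc]
  change (derivAct (ι k H W w * y) (1, 0)).2 = _
  have h2 : derivAct (ι k H W w) = derivStep w := lift_ι _ _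
  rw [map_mul, Module.End.mul_apply, h2]
  change (LinearMap.mulLeft k (ι k H W w)).rTensor W _ +
      ((act k H (Tc k H W)).flip (derivAct y (1, 0)).1).rTensor W
        (coact k H w) = _
  rw [h1]
  simp only [mul_one]
  rfl

/-- In the product rule, `w D(y)` gains one degree over `D(y)`, and `w₍₋₁₎ y` has the same degree as
`y` because the action preserves the filtration. This drop of the degree by one drives the induction
in `ker_le_of_deriv`. -/
theorem deriv_mem {n : ℕ} {x : Tc k H W} (hx : x ∈ filtration k H W (n + 1)) :
    deriv x ∈ LinearMap.range ((filtration k H W n).subtype.rTensor W) := by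
  suffices hle : filtration k H W (n + 1) ≤
      (LinearMap.range ((filtration k H W n).subtype.rTensor W)).comap deriv from hle hx
  clear hx x
  induction n with
  | zero =>
    refine filtration_succ_le ?_ fun w y hy => ?_
    · rw [Submodule.mem_comap, deriv_one]; exact zero_mem _
    · have : y = 0 := hy
      rw [this, mul_zero]; exact zero_mem _
  | succ n ih =>
    refine filtration_succ_le ?_ fun w y hy => ?_
    · rw [Submodule.mem_comap, deriv_one]; exact zero_mem _
    · rw [Submodule.mem_comap, deriv_ι_mul]
      refine add_mem ?_ ?_
      · obtain ⟨s, hs⟩ := ih hy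
        rw [← hs]
        clear hs
        induction s using TensorProduct.induction_on with
        | zero => simp
        | add x y hx hy => simp only [map_add]; exact add_mem hx hy
        | tmul a b => exact ⟨⟨_, ι_mul_mem_filtration w a.2⟩ ⊗ₜ b, rfl⟩
      · generalize coact k H w = u
        induction u using TensorProduct.induction_on with
        | zero => simp
        | add x y hx hy => simp only [map_add]; exact add_mem hx hy
        | tmul a b => exact ⟨⟨a • y, smul_mem_filtration a hy⟩ ⊗ₜ b, rfl⟩

/-- Two linear maps on a tensor algebra that are compatible with skew derivations whose constants
are the scalars satisfy `ker f ≤ ker g`. -/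
theorem ker_le_of_deriv {B C : Type*} [AddCommGroup B] [Module k B] [AddCommGroup C] [Module k C]
    (f : Tc k H W →ₗ[k] B) (g : Tc k H W →ₗ[k] C)
    (Df : B →ₗ[k] B ⊗[k] W) (Dg : C →ₗ[k] C ⊗[k] W) (εf : B →ₗ[k] k) (εg : C →ₗ[k] k)
    (hf : ∀ x, f.rTensor W (deriv x) = Df (f x)) (hg : ∀ x, g.rTensor W (deriv x) = Dg (g x))
    (hε : ∀ x, εf (f x) = εg (g x)) (h0 : ∀ y, Dg y = 0 → εg y = 0 → y = 0)
    {x : Tc k H W} (hx : f x = 0) : g x = 0 := by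
  obtain ⟨n, hn⟩ := exists_mem_filtration x
  induction n generalizing x with
  | zero =>
    have : x = 0 := hn
    rw [this, map_zero]
  | succ n ih =>
    refine h0 _ ?_ ?_
    · rw [← hg]
      -- The left legs of `D(x)` have smaller degree, so by induction `f` may be replaced by `g` on
      -- them.
      refine rTensor_eq_zero (filtration k H W n) f g (fun y hy hy0 => ih hy0 hy) (deriv_mem hn) ?_
      rw [hf, hx, map_zero]
    · rw [← hε, hx, map_zero]

/-- Compatibility with skew derivations is checked on generators. -/
theorem rTensor_deriv_eq {B : Type*} [AddCommGroup B] [Module k B] (f : Tc k H W →ₗ[k] B)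
    (D : B →ₗ[k] B ⊗[k] W) (m : W → B →ₗ[k] B) (α : H →ₗ[k] B →ₗ[k] B)
    (hm : ∀ w y, f (ι k H W w * y) = m w (f y)) (hα : ∀ (h : H) y, f (h • y) = α h (f y))
    (h1 : D (f 1) = 0)
    (hD : ∀ w y, D (m w y) = (m w).rTensor W (D y) + (α.flip y).rTensor W (coact k H w))
    (x : Tc k H W) : f.rTensor W (deriv x) = D (f x) := by
  suffices h : x ∈ LinearMap.ker (f.rTensor W ∘ₗ deriv - D ∘ₗ f) by
    simpa [sub_eq_zero] using h
  refine mul_induction _ ?_ (fun w y hy => ?_) x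
  · simp [deriv_one, h1]
  · simp only [LinearMap.mem_ker, LinearMap.sub_apply, LinearMap.comp_apply, sub_eq_zero] at hy ⊢
    rw [deriv_ι_mul, map_add, hm, hD, ← hy]
    have e1 : f ∘ₗ LinearMap.mulLeft k (ι k H W w) = m w ∘ₗ f := LinearMap.ext fun z => hm w z
    have e2 : f ∘ₗ (act k H (Tc k H W)).flip y = α.flip (f y) := LinearMap.ext fun a => hα a y
    rw [← e2, LinearMap.rTensor_comp, LinearMap.comp_apply, ← LinearMap.comp_apply,
      ← LinearMap.rTensor_comp, e1, LinearMap.rTensor_comp, LinearMap.comp_apply]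

end

end Tc

/-! ### The projections of a Radford biproduct -/

namespace Smash

variable {k H R : Type*} [Field k] [Ring H] [HopfAlgebra k H]
  [Ring R] [Algebra k R] [Module H R] [IsScalarTower k H R] [Coalgebra k R]
  [BraidedHopfAlgebra k H R]

variable (k H R) in
/-- The linear projection `r # h ↦ ε(h) r`. -/
def projL : Smash k R H →ₗ[k] R :=
  (TensorProduct.rid k R).toLinearMap ∘ₗ counit.lTensor R ∘ₗ ofTensor.symm.toLinearMap

variable (k H R) in
/-- The linear projection `r # h ↦ ε(r) h`. -/
def projR : Smash k R H →ₗ[k] H :=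
  (TensorProduct.lid k H).toLinearMap ∘ₗ counit.rTensor H ∘ₗ ofTensor.symm.toLinearMap

theorem projL_ofTensor (r : R) (h : H) :
    projL k H R (ofTensor (r ⊗ₜ h)) = counit (R := k) h • r := by
  simp [projL]

theorem projL_inl_mul_inr (r : R) (h : H) :
    projL k H R (inl r * inr h) = counit (R := k) h • r := by
  rw [← ofTensor_tmul, projL_ofTensor]

theorem projR_inl_mul_inr (r : R) (h : H) :
    projR k H R (inl r * inr h) = counit (R := k) r • h := by
  rw [← ofTensor_tmul]
  simp [projR]

theorem projL_inl_mul (r : R) (a : Smash k R H) :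
    projL k H R (inl r * a) = r * projL k H R a := by
  induction a using Smash.induction_on with
  | zero => simp
  | add x y hx hy => simp only [mul_add, map_add, hx, hy]
  | mk s h =>
    rw [← inl_mul_inr, ← mul_assoc, ← map_mul, projL_inl_mul_inr, projL_inl_mul_inr, mul_smul_comm]

theorem projL_inr_mul_inl (h : H) (r : R) : projL k H R (inr h * inl r) = h • r := by
  have : ∀ t : H ⊗[k] H, projL k H R (ofTensor (((act k H R).flip r).rTensor H t)) =
      TensorProduct.rid k H (counit.lTensor H t) • r := by
    intro t
    induction t using TensorProduct.induction_on with
    | zero => simp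
    | add x y hx hy => simp only [map_add, add_smul, hx, hy]
    | tmul a b => simp [projL_ofTensor]
  rw [inr_mul_inl, this]
  simp

/-- Applying `id # ε` to both legs of `(r⁽¹⁾ # r⁽²⁾₍₋₁₎ h₍₁₎) ⊗ (r⁽²⁾₍₀₎ # h₍₂₎)` removes the
coaction by counitality and leaves `ε(h) Δ_R(r)`. Since `π_R` is thus compatible with the
comultiplications, it turns comodules over `R # H` into comodules over `R`. -/
theorem comul_projL (a : Smash k R H) : comul (R := k) (projL k H R a) =
    TensorProduct.map (projL k H R) (projL k H R) (comul (R := k) a) := by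
  induction a using Smash.induction_on with
  | zero => simp
  | add x y hx hy => simp only [map_add, hx, hy]
  | mk r h =>
    rw [← inl_mul_inr, projL_inl_mul_inr, comul_inl_mul_inr, map_smul]
    have h1 : ∀ (s : R ⊗[k] R) (t : H ⊗[k] H), TensorProduct.map (projL k H R) (projL k H R)
        (cosmash k H R s * TensorProduct.map inr.toLinearMap inr.toLinearMap t) =
        counit (R := k) (TensorProduct.lid k H (counit.rTensor H t)) • s := by
      intro s t
      induction s using TensorProduct.induction_on with
      | zero => simp
      | add x y hx hy => simp only [map_add, add_mul, smul_add, hx, hy]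
      | tmul x y =>
        induction t using TensorProduct.induction_on with
        | zero => simp
        | add x y hx hy => simp only [map_add, mul_add, add_smul, hx, hy]
        | tmul c d =>
          have h2 : ∀ u : H ⊗[k] R, TensorProduct.map (projL k H R) (projL k H R)
              (inlLeft k H R x * TensorProduct.map inr.toLinearMap inl.toLinearMap u *
                TensorProduct.map inr.toLinearMap inr.toLinearMap (c ⊗ₜ d)) =
              (counit (R := k) c * counit (R := k) d) •
                (x ⊗ₜ (TensorProduct.lid k R (counit.rTensor R u))) := by
            intro u
            induction u using TensorProduct.induction_on with
            | zero => simp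
            | add x y hx hy =>
              simp only [map_add, mul_add, add_mul, smul_add, TensorProduct.tmul_add, hx, hy]
            | tmul g b =>
              simp only [inlLeft_apply, TensorProduct.map_tmul, AlgHom.toLinearMap_apply,
                Algebra.TensorProduct.tmul_mul_tmul, one_mul, mul_assoc, ← map_mul,
                projL_inl_mul_inr, LinearMap.rTensor_tmul, TensorProduct.lid_tmul,
                TensorProduct.tmul_smul, TensorProduct.smul_tmul', smul_smul, Bialgebra.counit_mul]
              congr 2
              ring
          rw [cosmash_tmul, coactA_apply, h2, coact_counit]
          simp
    rw [h1]
    simp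

/-- `a = (π_R(a₍₁₎) # 1) (1 # π_H(a₍₂₎))`. -/
theorem mul_proj_comul (a : Smash k R H) :
    LinearMap.mul' k (Smash k R H) (TensorProduct.map (inl.toLinearMap ∘ₗ projL k H R)
      (inr.toLinearMap ∘ₗ projR k H R) (comul (R := k) a)) = a := by
  induction a using Smash.induction_on with
  | zero => simp
  | add x y hx hy => simp only [map_add, hx, hy]
  | mk r h =>
    rw [← inl_mul_inr, comul_inl_mul_inr]
    have h1 : ∀ (s : R ⊗[k] R) (t : H ⊗[k] H), LinearMap.mul' k (Smash k R H)
        (TensorProduct.map (inl.toLinearMap ∘ₗ projL k H R) (inr.toLinearMap ∘ₗ projR k H R)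
        (cosmash k H R s * TensorProduct.map inr.toLinearMap inr.toLinearMap t)) =
        inl (TensorProduct.rid k R (counit.lTensor R s)) *
          inr (TensorProduct.lid k H (counit.rTensor H t)) := by
      intro s t
      induction s using TensorProduct.induction_on with
      | zero => simp
      | add x y hx hy => simp only [map_add, add_mul, hx, hy]
      | tmul x y =>
        induction t using TensorProduct.induction_on with
        | zero => simp
        | add x y hx hy => simp only [map_add, mul_add, hx, hy]
        | tmul c d =>
          have h2 : ∀ u : H ⊗[k] R, LinearMap.mul' k (Smash k R H)
              (TensorProduct.map (inl.toLinearMap ∘ₗ projL k H R) (inr.toLinearMap ∘ₗ projR k H R)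
              (inlLeft k H R x * TensorProduct.map inr.toLinearMap inl.toLinearMap u *
                TensorProduct.map inr.toLinearMap inr.toLinearMap (c ⊗ₜ d))) =
              (counit (R := k) c * counit (R := k) (TensorProduct.lid k R (counit.rTensor R u))) •
                (inl x * inr d) := by
            intro u
            induction u using TensorProduct.induction_on with
            | zero => simp
            | add x y hx hy =>
              simp only [map_add, mul_add, add_mul, add_smul, hx, hy]
            | tmul g b =>
              simp only [inlLeft_apply, TensorProduct.map_tmul, AlgHom.toLinearMap_apply,
                Algebra.TensorProduct.tmul_mul_tmul, one_mul, mul_assoc, ← map_mul inr,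
                LinearMap.comp_apply, projL_inl_mul_inr, projR_inl_mul_inr, LinearMap.rTensor_tmul,
                TensorProduct.lid_tmul, map_smul, LinearMap.mul'_apply, smul_mul_assoc,
                mul_smul_comm, smul_smul, Bialgebra.counit_mul, smul_eq_mul]
              congr 1
              ring
          rw [cosmash_tmul, coactA_apply, h2, coact_counit]
          simp [smul_smul]
    rw [h1]
    simp

end Smash

/-- `Δ(v # 1) = (v # 1) ⊗ 1 + (1 # v₍₋₁₎) ⊗ (v₍₀₎ # 1)`. -/
theorem IsNicholsAlgebra.comul_inl_ι {k H V R : Type*} [Field k] [Ring H] [HopfAlgebra k H]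
    [AddCommGroup V] [Module k V] [Module H V] [IsScalarTower k H V] [YetterDrinfeld k H V]
    [Ring R] [Algebra k R] [Module H R] [IsScalarTower k H R] [Coalgebra k R]
    [BraidedHopfAlgebra k H R] {ιV : V →ₗ[k] R} {𝒱 : ℕ → Submodule k R}
    (hR : IsNicholsAlgebra (H := H) ιV 𝒱) (v : V) :
    comul (R := k) (Smash.inl (ιV v) : Smash k R H) =
      Smash.inl (ιV v) ⊗ₜ 1 + TensorProduct.map Smash.inr.toLinearMap
        (Smash.inl.toLinearMap ∘ₗ ιV) (coact k H v) := by
  have h1 : comul (R := k) (Smash.inl (ιV v) : Smash k R H) =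
    Smash.cosmash k H R (comul (ιV v)) := Smash.comulA_inl k H R (ιV v)
  rw [h1, hR.comul_ι, map_add, Smash.cosmash_tmul, Smash.cosmash_tmul, map_one, mul_one,
    map_one, one_mul, Smash.inlLeft_apply, Smash.coactA_apply, hR.coact_ι]
  congr 1
  generalize coact k H v = u
  induction u using TensorProduct.induction_on with
  | zero => simp
  | add x y hx hy => simp only [map_add, hx, hy]
  | tmul h w => rfl

/-! ### Highest weight modules -/

namespace IsHighestWeight

variable {k H V R M : Type*} [Field k] [Ring H] [HopfAlgebra k H]
  [AddCommGroup V] [Module k V] [Module H V] [IsScalarTower k H V] [YetterDrinfeld k H V]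
  [Ring R] [Algebra k R] [Module H R] [IsScalarTower k H R] [Coalgebra k R]
  [BraidedHopfAlgebra k H R]
  [AddCommGroup M] [Module k M] [Module (Smash k R H) M] [IsScalarTower k (Smash k R H) M]
  [YetterDrinfeld k (Smash k R H) M] {ιV : V →ₗ[k] R} {𝒱 : ℕ → Submodule k R}
  {ℳ : ℕ → Submodule k M}

/-- The projection to the space `M_H = M(1)` of highest weight vectors. -/
def proj (hM : IsHighestWeight (H := H) 𝒱 ℳ) : M →ₗ[k] highestWeight k H R M :=
  (LinearEquiv.ofEq _ _ hM.highestWeight_eq.symm).toLinearMap ∘ₗ gradedProj hM.isInternal 1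

theorem proj_coe (hM : IsHighestWeight (H := H) 𝒱 ℳ) (m : highestWeight k H R M) :
    hM.proj (m : M) = m := by
  have hm : (m : M) ∈ ℳ 1 := by rw [← hM.highestWeight_eq]; exact m.2
  refine Subtype.ext ?_
  have h1 : ((gradedProj hM.isInternal 1 (m : M) : ℳ 1) : M) = m :=
    congrArg Subtype.val (gradedProj_coe hM.isInternal 1 ⟨m, hm⟩)
  exact h1

theorem proj_of_ne (hM : IsHighestWeight (H := H) 𝒱 ℳ) {n : ℕ} (hn : n ≠ 1) {m : M}
    (hm : m ∈ ℳ n) : hM.proj m = 0 := by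
  rw [proj, LinearMap.comp_apply, gradedProj_of_ne hM.isInternal hn hm, map_zero]

/-- As `M(0) = 0`, the action of `R(1)` takes values in degrees at least two, which the projection
to `M(1)` kills. -/
theorem proj_inl_smul (hM : IsHighestWeight (H := H) 𝒱 ℳ) {r : R} (hr : r ∈ 𝒱 1) (m : M) :
    hM.proj ((Smash.inl r : Smash k R H) • m) = 0 := by
  induction m using graded_induction hM.isInternal with
  | zero => simp
  | add x y hx hy => rw [smul_add, map_add, hx, hy, add_zero]
  | mem n m hm =>
    by_cases hn : n = 0
    · subst hn
      rw [hM.zero, Submodule.mem_bot] at hm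
      simp [hm]
    · refine hM.proj_of_ne (n := 1 + n) (by omega) (hM.smul_mem 1 n _ ?_ _ hm)
      exact ⟨r ⊗ₜ 1, ⟨⟨r, hr⟩ ⊗ₜ ⟨1, trivial⟩, rfl⟩, rfl⟩

/-- `r` and `m` are sent to `π_R(m₍₋₁₎ (r # 1)) ⊗ pr(m₍₀₎)`. -/
def coactProj (hM : IsHighestWeight (H := H) 𝒱 ℳ) :
    R →ₗ[k] M →ₗ[k] R ⊗[k] highestWeight k H R M :=
  (LinearMap.rTensorHom (highestWeight k H R M) ∘ₗ
    ((LinearMap.mul k (Smash k R H)).flip ∘ₗ Smash.inl.toLinearMap).compr₂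
      (Smash.projL k H R)).compl₂ (hM.proj.lTensor (Smash k R H) ∘ₗ coact k (Smash k R H))

theorem coactProj_apply (hM : IsHighestWeight (H := H) 𝒱 ℳ) (r : R) (m : M) :
    hM.coactProj r m = TensorProduct.map
      (Smash.projL k H R ∘ₗ LinearMap.mulRight k (Smash.inl r : Smash k R H)) hM.proj
      (coact k (Smash k R H) m) := by
  rw [← LinearMap.rTensor_comp_lTensor]
  rfl

/-- On highest weight vectors, this is `m₍₋₁₎ r ⊗ m₍₀₎`. -/
theorem coactProj_coe (hM : IsHighestWeight (H := H) 𝒱 ℳ) (r : R) (m : highestWeight k H R M) :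
    hM.coactProj r (m : M) = ((act k H R).flip r).rTensor _ (coact k H m) := by
  rw [coactProj_apply, ← highestWeight.incl_coactH]
  change _ = ((act k H R).flip r).rTensor _ (highestWeight.coactH k H R M m)
  generalize highestWeight.coactH k H R M m = t
  induction t using TensorProduct.induction_on with
  | zero => simp
  | add x y hx hy => simp only [map_add, hx, hy]
  | tmul h p => simp [highestWeight.incl, Smash.projL_inr_mul_inl, hM.proj_coe]

/-- `E_r(v m) + E_{v₍₀₎ r}(v₍₋₁₎ m) = v E_r(m)`. -/
theorem coactProj_inl_smul (hR : IsNicholsAlgebra (H := H) ιV 𝒱)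
    (hM : IsHighestWeight (H := H) 𝒱 ℳ) (v : V) (r : R) (m : M)
    (G : H ⊗[k] R →ₗ[k] R ⊗[k] highestWeight k H R M)
    (hG : ∀ h s, G (h ⊗ₜ s) = hM.coactProj (s * r) ((Smash.inr h : Smash k R H) • m)) :
    hM.coactProj r ((Smash.inl (ιV v) : Smash k R H) • m) + G (coact k H (ιV v)) =
      (LinearMap.mulLeft k (ιV v)).rTensor _ (hM.coactProj r m) := by
  let A := Smash k R H
  let L : A ⊗[k] M →ₗ[k] R ⊗[k] highestWeight k H R M := TensorProduct.map
    (Smash.projL k H R ∘ₗ LinearMap.mulRight k (Smash.inl r : Smash k R H)) hM.proj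
  have hL : ∀ m, hM.coactProj r m = L (coact k A m) := hM.coactProj_apply r
  let Ψ : A ⊗[k] A →ₗ[k] A ⊗[k] M :=
    TensorProduct.lift <| LinearMap.flip <|
      (LinearMap.rTensorHom M ∘ₗ (LinearMap.mul k A).flip).compl₂ (coact k A ∘ₗ (act k A M).flip m)
  have hΨ' : ∀ a b, Ψ (a ⊗ₜ b) = (LinearMap.mulRight k b).rTensor M (coact k A (a • m)) := by
    intro a b; rfl
  -- Since `Δ(v # 1) = v ⊗ 1 + v₍₋₁₎ ⊗ v₍₀₎`, the Yetter-Drinfel'd condition for `v # 1` has two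
  -- terms on each side. Under `L` they become `E_r(v m)`, `E_{v₍₀₎ r}(v₍₋₁₎ m)`, `v E_r(m)`, and a
  -- term containing `pr(v₍₀₎ m₍₀₎)`, which is zero by `proj_inl_smul`.
  have hΨ := congrArg L (yd_condition Ψ m hΨ' (Smash.inl (ιV v)))
  rw [hR.comul_inl_ι, map_add, map_add, map_add, LinearMap.add_apply, map_add] at hΨ
  have e1 : L (Ψ (Smash.inl (ιV v) ⊗ₜ 1)) =
      hM.coactProj r ((Smash.inl (ιV v) : Smash k R H) • m) := by
    rw [hΨ', hL, LinearMap.mulRight_one, LinearMap.rTensor_id, LinearMap.id_apply]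
  have e2 : ∀ u : H ⊗[k] V, L (Ψ (TensorProduct.map (Smash.inr : H →ₐ[k] A).toLinearMap
      ((Smash.inl : R →ₐ[k] A).toLinearMap ∘ₗ ιV) u)) = G (ιV.lTensor H u) := by
    intro u
    induction u using TensorProduct.induction_on with
    | zero => simp
    | add x y hx hy => simp only [map_add, hx, hy]
    | tmul h s =>
      rw [TensorProduct.map_tmul, LinearMap.lTensor_tmul, hG, hΨ', hM.coactProj_apply]
      change (L ∘ₗ (LinearMap.mulRight k (Smash.inl (ιV s) : A)).rTensor M) _ = _
      have h2 : L ∘ₗ (LinearMap.mulRight k (Smash.inl (ιV s) : A)).rTensor M = TensorProduct.map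
          (Smash.projL k H R ∘ₗ LinearMap.mulRight k (Smash.inl (ιV s * r) : A)) hM.proj := by
        refine TensorProduct.ext' fun a n => ?_
        simp [L, mul_assoc]
      rw [h2]
      rfl
  have e3 : ∀ w : A ⊗[k] M, L (TensorProduct.map₂ (LinearMap.mul k A) (act k A M)
      (Smash.inl (ιV v) ⊗ₜ 1) w) = (LinearMap.mulLeft k (ιV v)).rTensor _ (L w) := by
    intro w
    induction w using TensorProduct.induction_on with
    | zero => simp
    | add x y hx hy => simp only [map_add, hx, hy]
    | tmul a n =>
      have h3 : Smash.projL k H R (Smash.inl (ιV v) * (a * Smash.inl r)) =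
          ιV v * Smash.projL k H R (a * Smash.inl r) := Smash.projL_inl_mul _ _
      simp [L, mul_assoc, h3]
  have e4 : ∀ (u : H ⊗[k] V) (w : A ⊗[k] M), L (TensorProduct.map₂ (LinearMap.mul k A) (act k A M)
      (TensorProduct.map (Smash.inr : H →ₐ[k] A).toLinearMap
        ((Smash.inl : R →ₐ[k] A).toLinearMap ∘ₗ ιV) u) w) = 0 := by
    intro u w
    induction u using TensorProduct.induction_on with
    | zero => simp
    | add x y hx hy => simp only [map_add, LinearMap.add_apply, hx, hy, add_zero]
    | tmul h s =>
      induction w using TensorProduct.induction_on with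
      | zero => simp
      | add x y hx hy => simp only [map_add, hx, hy, add_zero]
      | tmul a n =>
        simp [L, hM.proj_inl_smul (hR.ι_mem s)]
  rw [e1, e2, e3, e4, add_zero, ← hL] at hΨ
  rw [hR.coact_ι]
  exact hΨ

/-- The `R`-comodule structure of `M` given by `m ↦ π_R(m₍₋₁₎) ⊗ m₍₀₎`. -/
def coactL (k H R M : Type*) [Field k] [Ring H] [HopfAlgebra k H]
    [Ring R] [Algebra k R] [Module H R] [IsScalarTower k H R] [Coalgebra k R]
    [BraidedHopfAlgebra k H R]
    [AddCommGroup M] [Module k M] [Module (Smash k R H) M] [IsScalarTower k (Smash k R H) M]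
    [YetterDrinfeld k (Smash k R H) M] : M →ₗ[k] R ⊗[k] M :=
  (Smash.projL k H R).rTensor M ∘ₗ coact k (Smash k R H)

theorem coactProj_one (hM : IsHighestWeight (H := H) 𝒱 ℳ) (m : M) :
    hM.coactProj 1 m = hM.proj.lTensor R (coactL k H R M m) := by
  rw [coactProj_apply, map_one, LinearMap.mulRight_one, LinearMap.comp_id,
    ← LinearMap.lTensor_comp_rTensor]
  rfl

/-- Coassociativity over `R # H` passes to `R` because `π_R` is compatible with the
comultiplications, by `Smash.comul_projL`. -/
theorem lTensor_coactL (m : M) : (coactL k H R M).lTensor R (coactL k H R M m) =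
    TensorProduct.assoc k R R M (comul.rTensor M (coactL k H R M m)) := by
  have h1 : ∀ t : Smash k R H ⊗[k] M, (coactL k H R M).lTensor R
      ((Smash.projL k H R).rTensor M t) = TensorProduct.map (Smash.projL k H R)
        ((Smash.projL k H R).rTensor M) ((coact k (Smash k R H)).lTensor (Smash k R H) t) := by
    intro t
    induction t using TensorProduct.induction_on with
    | zero => simp
    | add x y hx hy => simp only [map_add, hx, hy]
    | tmul a n => simp [coactL]
  have h2 : ∀ t : Smash k R H ⊗[k] M, TensorProduct.assoc k R R M (comul.rTensor M
      ((Smash.projL k H R).rTensor M t)) = TensorProduct.map (Smash.projL k H R)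
        ((Smash.projL k H R).rTensor M)
        (TensorProduct.assoc k (Smash k R H) (Smash k R H) M (comul.rTensor M t)) := by
    intro t
    induction t using TensorProduct.induction_on with
    | zero => simp
    | add x y hx hy => simp only [map_add, hx, hy]
    | tmul a n =>
      simp only [LinearMap.rTensor_tmul, Smash.comul_projL]
      generalize comul (R := k) a = s
      induction s using TensorProduct.induction_on with
      | zero => simp
      | add x y hx hy => simp only [map_add, TensorProduct.add_tmul, hx, hy]
      | tmul c d => simp
  rw [coactL, LinearMap.comp_apply, h2, ← coactL, h1, coact_coassoc]

/-- The coinvariants of the `R`-comodule `M` are highest weight vectors. -/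
theorem mem_highestWeight_of_coactL {m : M} (hm : coactL k H R M m = 1 ⊗ₜ m) :
    m ∈ highestWeight k H R M := by
  let A := Smash k R H
  -- The identity `a = π_R(a₍₁₎) π_H(a₍₂₎)` gives `δ(m) = π_R(m₍₋₂₎) π_H(m₍₋₁₎) ⊗ m₍₀₎`. Applying
  -- `F` to `δ(m)` produces the right side; moreover `F` sees its argument only through `π_R ⊗ id`.
  let F : A ⊗[k] M →ₗ[k] A ⊗[k] M :=
    (LinearMap.mul' k A).rTensor M ∘ₗ (TensorProduct.assoc k A A M).symm.toLinearMap ∘ₗ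
      TensorProduct.map (Smash.inl.toLinearMap ∘ₗ Smash.projL k H R)
        (((Smash.inr : H →ₐ[k] A).toLinearMap ∘ₗ Smash.projR k H R).rTensor M ∘ₗ coact k A)
  have h1 : ∀ t : A ⊗[k] M, F t = (LinearMap.mul' k A ∘ₗ TensorProduct.map
      (Smash.inl.toLinearMap ∘ₗ Smash.projL k H R)
      (Smash.inr.toLinearMap ∘ₗ Smash.projR k H R)).rTensor M
        ((TensorProduct.assoc k A A M).symm ((coact k A).lTensor A t)) := by
    intro t
    induction t using TensorProduct.induction_on with
    | zero => simp
    | add x y hx hy => simp only [map_add, hx, hy]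
    | tmul a n =>
      simp only [F, LinearMap.comp_apply, TensorProduct.map_tmul, LinearMap.lTensor_tmul]
      generalize coact k A n = s
      induction s using TensorProduct.induction_on with
      | zero => simp
      | add x y hx hy => simp only [map_add, TensorProduct.tmul_add, hx, hy]
      | tmul c d => simp
  have h2 : F (coact k A m) = coact k A m := by
    rw [h1, ← coact_coassoc, LinearEquiv.symm_apply_apply, ← LinearMap.comp_apply,
      ← LinearMap.rTensor_comp]
    have : (LinearMap.mul' k A ∘ₗ TensorProduct.map
      (Smash.inl.toLinearMap ∘ₗ Smash.projL k H R)
      (Smash.inr.toLinearMap ∘ₗ Smash.projR k H R)) ∘ₗ comul = LinearMap.id :=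
      LinearMap.ext Smash.mul_proj_comul
    rw [this, LinearMap.rTensor_id, LinearMap.id_apply]
  let G : R ⊗[k] M →ₗ[k] A ⊗[k] M :=
    (LinearMap.mul' k A).rTensor M ∘ₗ (TensorProduct.assoc k A A M).symm.toLinearMap ∘ₗ
      TensorProduct.map Smash.inl.toLinearMap
        (((Smash.inr : H →ₐ[k] A).toLinearMap ∘ₗ Smash.projR k H R).rTensor M ∘ₗ coact k A)
  have h3 : ∀ t : A ⊗[k] M, F t = G ((Smash.projL k H R).rTensor M t) := by
    intro t
    induction t using TensorProduct.induction_on with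
    | zero => simp
    | add x y hx hy => simp only [map_add, hx, hy]
    | tmul a n => rfl
  -- With `π_R(m₍₋₁₎) ⊗ m₍₀₎ = 1 ⊗ m` the formula becomes `δ(m) = π_H(m₍₋₁₎) ⊗ m₍₀₎`, which lies in
  -- `H ⊗ M`.
  have h4 : coact k A m = G (1 ⊗ₜ m) := by rw [← h2, h3, ← hm]; rfl
  change coact k A m ∈ LinearMap.range ((Smash.inr : H →ₐ[k] A).toLinearMap.rTensor M)
  rw [h4]
  simp only [G, LinearMap.comp_apply, TensorProduct.map_tmul, AlgHom.toLinearMap_apply, map_one]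
  generalize coact k A m = s
  clear h4 h3 h2 h1
  induction s using TensorProduct.induction_on with
  | zero => simp
  | add x y hx hy => simp only [map_add, TensorProduct.tmul_add]; exact add_mem hx hy
  | tmul c d => exact ⟨Smash.projR k H R c ⊗ₜ d, by simp⟩

/-- The argument is that of `IsNicholsAlgebra.comul_sub_mem`: the difference is `(G ⊗ id) δ(m)` for
`G = π_R - ε 1`. This `G` kills `A(0) = R(0) # H`, as `R(0)` consists of scalars. -/
theorem coactL_sub_mem (hR : IsNicholsAlgebra (H := H) ιV 𝒱)
    (hM : IsHighestWeight (H := H) 𝒱 ℳ) {n : ℕ} {m : M} (hm : m ∈ degreeLT ℳ (n + 1)) :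
    coactL k H R M m - 1 ⊗ₜ m ∈ LinearMap.range ((degreeLT ℳ n).subtype.lTensor R) := by
  let G : Smash k R H →ₗ[k] R :=
    Smash.projL k H R - LinearMap.toSpanSingleton k R 1 ∘ₗ counit
  have hG : ∀ m : M, coactL k H R M m - 1 ⊗ₜ m = G.rTensor M (coact k (Smash k R H) m) := by
    intro m
    have h1 : counit.rTensor M (coact k (Smash k R H) m) = 1 ⊗ₜ m := by
      rw [← LinearEquiv.symm_apply_apply (TensorProduct.lid k M) (counit.rTensor M _), coact_counit]
      simp
    rw [LinearMap.rTensor_sub, LinearMap.sub_apply, LinearMap.rTensor_comp, LinearMap.comp_apply,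
      h1]
    simp [coactL]
  suffices h : degreeLT ℳ (n + 1) ≤ (LinearMap.range ((degreeLT ℳ n).subtype.lTensor R)).comap
      (G.rTensor M ∘ₗ coact k (Smash k R H)) by
    rw [hG]; exact h hm
  refine iSup_le fun i x hx => ?_
  refine rTensor_mem_of_tensorDegree (smashGrading H 𝒱) ℳ G ?_ (Nat.le_of_lt_succ i.2)
    (hM.coact_mem i x hx)
  rintro _ ⟨_, ⟨t, rfl⟩, rfl⟩
  induction t using TensorProduct.induction_on with
  | zero => simp
  | add x y hx hy => simp only [map_add, hx, hy, add_zero]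
  | tmul r h =>
    change G (Smash.ofTensor ((r : R) ⊗ₜ (h : H))) = 0
    rw [LinearMap.sub_apply, Smash.projL_ofTensor, sub_eq_zero, Smash.ofTensor_tmul,
      LinearMap.comp_apply, Smash.counit_inl_mul_inr, LinearMap.toSpanSingleton_apply, mul_comm,
      mul_smul, ← hR.eq_counit_smul_of_mem_zero r.2]

/-- The map `m ↦ π_R(m₍₋₁₎) ⊗ pr(m₍₀₎)` is injective. -/
theorem eq_zero_of_coactProj_one (hR : IsNicholsAlgebra (H := H) ιV 𝒱)
    (hM : IsHighestWeight (H := H) 𝒱 ℳ) {m : M} (hm : hM.coactProj 1 m = 0) : m = 0 := by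
  obtain ⟨n, hn⟩ := exists_mem_degreeLT hM.isInternal m
  induction n generalizing m with
  | zero => rwa [degreeLT_zero, Submodule.mem_bot] at hn
  | succ n ih =>
    -- By coassociativity of the `R`-coaction, `id ⊗ E_1` sends it to `(Δ ⊗ id) E_1(m)`, and it
    -- sends `1 ⊗ m` to `1 ⊗ E_1(m)`. Both vanish.
    have h1 : (hM.coactProj 1).lTensor R (coactL k H R M m - 1 ⊗ₜ m) = 0 := by
      have e : hM.coactProj 1 = hM.proj.lTensor R ∘ₗ coactL k H R M :=
        LinearMap.ext hM.coactProj_one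
      have h2 : ∀ t : R ⊗[k] M, (hM.proj.lTensor R).lTensor R
          (TensorProduct.assoc k R R M (comul.rTensor M t)) =
          TensorProduct.assoc k R R _ (comul.rTensor _ (hM.proj.lTensor R t)) := by
        intro t
        induction t using TensorProduct.induction_on with
        | zero => simp
        | add x y hx hy => simp only [map_add, hx, hy]
        | tmul a n =>
          simp only [LinearMap.rTensor_tmul, LinearMap.lTensor_tmul]
          generalize comul (R := k) a = s
          induction s using TensorProduct.induction_on with
          | zero => simp
          | add x y hx hy => simp only [map_add, TensorProduct.add_tmul, hx, hy]
          | tmul c d => simp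
      rw [map_sub, LinearMap.lTensor_tmul, hm, TensorProduct.tmul_zero, sub_zero, e,
        LinearMap.lTensor_comp, LinearMap.comp_apply, lTensor_coactL, h2, ← hM.coactProj_one, hm]
      simp
    -- By induction `E_1` is injective on the right legs, which have smaller degree. Therefore `m`
    -- is coinvariant and so a highest weight vector. Then `E_1(m) = 1 ⊗ pr(m)` with `pr(m) = m`,
    -- which forces `m = 0`.
    have h3 := lTensor_eq_zero (degreeLT ℳ n) (hM.coactProj 1) LinearMap.id
      (fun y hy hy0 => ih hy0 hy) (hM.coactL_sub_mem hR hn) h1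
    rw [LinearMap.lTensor_id, LinearMap.id_apply, sub_eq_zero] at h3
    have h4 := hM.proj_coe ⟨m, mem_highestWeight_of_coactL h3⟩
    rw [coactProj_one, h3, LinearMap.lTensor_tmul] at hm
    have h5 : hM.proj m = 0 := by
      have := congrArg (TensorProduct.lid k _ ∘ (counit (R := k) (A := R)).rTensor _) hm
      simpa [BraidedHopfAlgebra.counit_one (k := k) (H := H)] using this
    change hM.proj m = _ at h4
    rw [h5] at h4
    exact (congrArg Subtype.val h4).symm

end IsHighestWeight

/-! ### Multiplication in braided biproducts -/

namespace BraidedBiproduct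

variable {k H Q R : Type*} [Field k] [Ring H] [HopfAlgebra k H]
  [Ring R] [Algebra k R] [Module H R] [IsScalarTower k H R] [Coalgebra k R]
  [BraidedHopfAlgebra k H R]
  [Ring Q] [Algebra k Q] [Module (Smash k R H) Q] [IsScalarTower k (Smash k R H) Q]

variable (k H Q R) in
/-- The diagonal action of `H` on `Q ⊗ R`. -/
def actH : H →ₗ[k] (Q ⊗[k] R) →ₗ[k] (Q ⊗[k] R) :=
  TensorProduct.map₂ (act k (Smash k R H) Q ∘ₗ Smash.inr.toLinearMap) (act k H R) ∘ₗ comul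

theorem halfComul_one : halfComul k H R 1 = 1 ⊗ₜ 1 := by
  have h1 : (Smash.ofTensor ((1 : R) ⊗ₜ (1 : H)) : Smash k R H) = 1 := rfl
  simp [halfComul, BraidedHopfAlgebra.comul_one (k := k) (H := H), BraidedHopfAlgebra.coact_one, h1]

theorem mulL_tmul_one (x : Q) (y : Q ⊗[k] R) :
    mulL k H Q R (x ⊗ₜ 1) y = (LinearMap.mulLeft k x).rTensor R y := by
  change (LinearMap.mulLeft k x).rTensor R (TensorProduct.map₂ (act k (Smash k R H) Q)
    (LinearMap.mul k R) (halfComul k H R 1) y) = _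
  rw [halfComul_one]
  congr 1
  induction y using TensorProduct.induction_on with
  | zero => simp
  | add x y hx hy => simp only [map_add, hx, hy]
  | tmul a b => simp

variable {V : Type*} [AddCommGroup V] [Module k V] [Module H V] [IsScalarTower k H V]
  [YetterDrinfeld k H V] {ιV : V →ₗ[k] R} {𝒱 : ℕ → Submodule k R}

theorem halfComul_ι (hR : IsNicholsAlgebra (H := H) ιV 𝒱) (v : V) : halfComul k H R (ιV v) =
    Smash.inl (ιV v) ⊗ₜ 1 + TensorProduct.map Smash.inr.toLinearMap ιV (coact k H v) := by
  simp only [halfComul, LinearMap.comp_apply, hR.comul_ι, map_add, LinearMap.lTensor_tmul,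
    BraidedHopfAlgebra.coact_one, hR.coact_ι]
  congr 1
  generalize coact k H v = u
  induction u using TensorProduct.induction_on with
  | zero => simp
  | add x y hx hy => simp only [map_add, TensorProduct.tmul_add, hx, hy]
  | tmul h w => rfl

/-- `(1 # v) (x # r) = v x # r + v₍₋₁₎ x # v₍₀₎ r`. -/
theorem mulL_one_tmul_ι (hR : IsNicholsAlgebra (H := H) ιV 𝒱) (v : V) (x : Q) (r : R) :
    mulL k H Q R (1 ⊗ₜ ιV v) (x ⊗ₜ r) = ((Smash.inl (ιV v) : Smash k R H) • x) ⊗ₜ r +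
      TensorProduct.map ((act k (Smash k R H) Q).flip x ∘ₗ Smash.inr.toLinearMap)
        ((LinearMap.mul k R).flip r ∘ₗ ιV) (coact k H v) := by
  have h1 : mulL k H Q R (1 ⊗ₜ ιV v) (x ⊗ₜ r) = (LinearMap.mulLeft k (1 : Q)).rTensor R
    (TensorProduct.map₂ (act k (Smash k R H) Q) (LinearMap.mul k R)
      (halfComul k H R (ιV v)) (x ⊗ₜ r)) := rfl
  rw [h1, LinearMap.mulLeft_one, LinearMap.rTensor_id, LinearMap.id_apply, halfComul_ι hR,
    map_add, LinearMap.add_apply]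
  congr 1
  · simp
  · generalize coact k H v = u
    induction u using TensorProduct.induction_on with
    | zero => simp
    | add x y hx hy => simp only [map_add, LinearMap.add_apply, hx, hy]
    | tmul h w => simp

/-- The coassociativity of the coaction, in the form
`w₍₋₁₎ (x ⊗ r) ⊗ w₍₀₎ = (w₍₋₂₎ x ⊗ w₍₋₁₎ r) ⊗ w₍₀₎`. -/
theorem rTensor_actH_coact {W : Type*} [AddCommGroup W] [Module k W] [LeftComodule k H W]
    (w : W) (x : Q) (r : R) :
    ((actH k H Q R).flip (x ⊗ₜ r)).rTensor W (coact k H w) =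
      (TensorProduct.assoc k Q R W).symm (TensorProduct.map
        ((act k (Smash k R H) Q).flip x ∘ₗ Smash.inr.toLinearMap)
        (((act k H R).flip r).rTensor W ∘ₗ coact k H) (coact k H w)) := by
  let Φ : H ⊗[k] (H ⊗[k] W) →ₗ[k] (Q ⊗[k] R) ⊗[k] W :=
    (TensorProduct.assoc k Q R W).symm.toLinearMap ∘ₗ TensorProduct.map
        ((act k (Smash k R H) Q).flip x ∘ₗ Smash.inr.toLinearMap)
        (((act k H R).flip r).rTensor W)
  have h1 : ∀ u : H ⊗[k] W, (TensorProduct.assoc k Q R W).symm (TensorProduct.map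
        ((act k (Smash k R H) Q).flip x ∘ₗ Smash.inr.toLinearMap)
        (((act k H R).flip r).rTensor W ∘ₗ coact k H) u) = Φ ((coact k H).lTensor H u) := by
    intro u
    induction u using TensorProduct.induction_on with
    | zero => simp
    | add x y hx hy => simp only [map_add, hx, hy]
    | tmul h w => rfl
  have h2 : ∀ u : H ⊗[k] W, Φ (TensorProduct.assoc k H H W (comul.rTensor W u)) =
      ((actH k H Q R).flip (x ⊗ₜ r)).rTensor W u := by
    intro u
    induction u using TensorProduct.induction_on with
    | zero => simp
    | add x y hx hy => simp only [map_add, hx, hy]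
    | tmul h w =>
      simp only [LinearMap.rTensor_tmul, LinearMap.flip_apply, actH, LinearMap.comp_apply]
      generalize comul (R := k) h = t
      induction t using TensorProduct.induction_on with
      | zero => simp
      | add x y hx hy => simp only [map_add, TensorProduct.add_tmul, LinearMap.add_apply, hx, hy]
      | tmul a b => simp [Φ]
  rw [h1, ← coact_coassoc, h2]

/-- This is `mulL_one_tmul_ι` with a passive third tensor factor, in the form needed when the
product is taken after a derivation. -/
theorem rTensor_mulL_ι (hR : IsNicholsAlgebra (H := H) ιV 𝒱) {W : Type*} [AddCommGroup W]
    [Module k W] (v : V) (x : Q) (t : R ⊗[k] W) :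
    (mulL k H Q R (1 ⊗ₜ ιV v)).rTensor W ((TensorProduct.assoc k Q R W).symm (x ⊗ₜ t)) =
      (TensorProduct.assoc k Q R W).symm (((Smash.inl (ιV v) : Smash k R H) • x) ⊗ₜ t) +
      (TensorProduct.assoc k Q R W).symm (TensorProduct.map
        ((act k (Smash k R H) Q).flip x ∘ₗ Smash.inr.toLinearMap)
        ((LinearMap.rTensorHom W ∘ₗ LinearMap.mul k R ∘ₗ ιV).flip t) (coact k H v)) := by
  induction t using TensorProduct.induction_on with
  | zero => simp [TensorProduct.map_zero_right]
  | add x y hx hy =>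
    simp only [map_add, TensorProduct.tmul_add, TensorProduct.map_add_right,
      LinearMap.add_apply, hx, hy]
    abel
  | tmul a b =>
    rw [TensorProduct.assoc_symm_tmul, LinearMap.rTensor_tmul, mulL_one_tmul_ι hR,
      TensorProduct.add_tmul, TensorProduct.assoc_symm_tmul]
    congr 1
    generalize coact k H v = u
    induction u using TensorProduct.induction_on with
    | zero => simp
    | add x y hx hy => simp only [map_add, TensorProduct.add_tmul, hx, hy]
    | tmul h w => simp

/-! ### The skew derivation of a braided biproduct of Nichols algebras -/

/-- The part of the skew derivation of `Q # R` with values in `(Q # R) ⊗ V`. -/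
def derivR (hR : IsNicholsAlgebra (H := H) ιV 𝒱) : Q ⊗[k] R →ₗ[k] (Q ⊗[k] R) ⊗[k] V :=
  (TensorProduct.assoc k Q R V).symm.toLinearMap ∘ₗ hR.deriv.lTensor Q

-- The derivation of `R` touches only the right factor, so multiplication by elements of `Q`
-- contributes no correction term to the `V`-component.
set_option linter.unusedSectionVars false in
theorem derivR_mulLeft (hR : IsNicholsAlgebra (H := H) ιV 𝒱) (x : Q) (y : Q ⊗[k] R) :
    derivR hR ((LinearMap.mulLeft k x).rTensor R y) =
      ((LinearMap.mulLeft k x).rTensor R).rTensor V (derivR hR y) := by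
  induction y using TensorProduct.induction_on with
  | zero => simp
  | add x y hx hy => simp only [map_add, hx, hy]
  | tmul z r =>
    simp only [derivR, LinearMap.comp_apply, LinearMap.rTensor_tmul, LinearMap.lTensor_tmul]
    generalize hR.deriv r = t
    induction t using TensorProduct.induction_on with
    | zero => simp
    | add x y hx hy => simp only [map_add, TensorProduct.tmul_add, hx, hy]
    | tmul a b => simp

/-- In `(1 # v)(x # r) = v x # r + v₍₋₁₎ x # v₍₀₎ r`, the product rule of `R` applied to `v₍₀₎ r`
yields the extra term `v₍₋₂₎ x ⊗ v₍₋₁₎ r ⊗ v₍₀₎`. By coassociativity this is `v₍₋₁₎ (x # r) ⊗ v₍₀₎`;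
the remaining terms form `v` times the derivative. -/
theorem derivR_mul_ι (hR : IsNicholsAlgebra (H := H) ιV 𝒱) (v : V) (y : Q ⊗[k] R) :
    derivR hR (mulL k H Q R (1 ⊗ₜ ιV v) y) =
      (mulL k H Q R (1 ⊗ₜ ιV v)).rTensor V (derivR hR y) +
        ((actH k H Q R).flip y).rTensor V (coact k H v) := by
  induction y using TensorProduct.induction_on with
  | zero => simp
  | add x y hx hy =>
    simp only [map_add, hx, hy, LinearMap.rTensor_add, LinearMap.add_apply]
    abel
  | tmul x r =>
    rw [rTensor_actH_coact, mulL_one_tmul_ι hR, map_add]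
    have h2 : derivR hR (x ⊗ₜ[k] r) = (TensorProduct.assoc k Q R V).symm (x ⊗ₜ hR.deriv r) := rfl
    have h3 : derivR hR (((Smash.inl (ιV v) : Smash k R H) • x) ⊗ₜ[k] r) =
      (TensorProduct.assoc k Q R V).symm
        (((Smash.inl (ιV v) : Smash k R H) • x) ⊗ₜ hR.deriv r) := rfl
    rw [h2, rTensor_mulL_ι hR, h3, add_assoc]
    congr 1
    rw [← map_add]
    generalize coact k H v = u
    induction u using TensorProduct.induction_on with
    | zero => simp
    | add x y hx hy =>
      simp only [map_add] at hx hy ⊢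
      rw [hx, hy]
      abel
    | tmul h w =>
      simp only [derivR, LinearMap.comp_apply, TensorProduct.map_tmul, LinearMap.lTensor_tmul,
        LinearMap.flip_apply, LinearMap.mul_apply', hR.deriv_ι_mul, TensorProduct.tmul_add, map_add]
      rfl

variable {M : Type*} [AddCommGroup M] [Module k M] [Module (Smash k R H) M]
  [IsScalarTower k (Smash k R H) M] [YetterDrinfeld k (Smash k R H) M]
  {ℳ : ℕ → Submodule k M} (hM : IsHighestWeight (H := H) 𝒱 ℳ)
  [Coalgebra k Q] [BraidedHopfAlgebra k (Smash k R H) Q]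
  {ιM : M →ₗ[k] Q} {𝒬 : ℕ → Submodule k Q} (hQ : IsNicholsAlgebra (H := Smash k R H) ιM 𝒬)

/-- The part of the skew derivation of `Q # R` with values in `(Q # R) ⊗ M_H`. -/
def derivL (hM : IsHighestWeight (H := H) 𝒱 ℳ) (hQ : IsNicholsAlgebra (H := Smash k R H) ιM 𝒬) :
    Q ⊗[k] R →ₗ[k] (Q ⊗[k] R) ⊗[k] highestWeight k H R M :=
  (TensorProduct.assoc k Q R (highestWeight k H R M)).symm.toLinearMap ∘ₗ
    TensorProduct.lift ((LinearMap.lTensorHom Q ∘ₗ hM.coactProj).flip ∘ₗ hQ.deriv)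

theorem derivL_tmul (x : Q) (r : R) : derivL hM hQ (x ⊗ₜ r) =
    (TensorProduct.assoc k Q R (highestWeight k H R M)).symm
      ((hM.coactProj r).lTensor Q (hQ.deriv x)) := rfl

/-- The correction term of `D_Q(p x)` is `p₍₋₁₎ x ⊗ p₍₀₎`. Because `p` is a highest weight vector,
this coaction lies in `H ⊗ M_H`, where `E_r` is simply `n ↦ n₍₋₁₎ r ⊗ n₍₀₎`. Coassociativity turns
the result into the diagonal action of `p₍₋₁₎` on `x # r`. -/
theorem derivL_mul_ι_coe (p : highestWeight k H R M) (y : Q ⊗[k] R) :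
    derivL hM hQ ((LinearMap.mulLeft k (ιM p)).rTensor R y) =
      ((LinearMap.mulLeft k (ιM p)).rTensor R).rTensor _ (derivL hM hQ y) +
        ((actH k H Q R).flip y).rTensor _ (coact k H p) := by
  induction y using TensorProduct.induction_on with
  | zero => simp
  | add x y hx hy =>
    simp only [map_add, hx, hy, LinearMap.rTensor_add, LinearMap.add_apply]
    abel
  | tmul x r =>
    rw [rTensor_actH_coact, LinearMap.rTensor_tmul, LinearMap.mulLeft_apply, derivL_tmul,
      derivL_tmul, hQ.deriv_ι_mul, map_add, map_add]
    congr 1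
    · generalize hQ.deriv x = d
      induction d using TensorProduct.induction_on with
      | zero => simp
      | add x y hx hy => simp only [map_add, hx, hy]
      | tmul z n =>
        simp only [LinearMap.rTensor_tmul, LinearMap.lTensor_tmul]
        generalize hM.coactProj r n = t
        induction t using TensorProduct.induction_on with
        | zero => simp
        | add x y hx hy => simp only [map_add, TensorProduct.tmul_add, hx, hy]
        | tmul a b => simp
    · congr 1
      rw [← highestWeight.incl_coactH]
      change _ = TensorProduct.map ((act k (Smash k R H) Q).flip x ∘ₗ Smash.inr.toLinearMap)
        (((act k H R).flip r).rTensor _ ∘ₗ coact k H) (highestWeight.coactH k H R M p)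
      generalize highestWeight.coactH k H R M p = t
      induction t using TensorProduct.induction_on with
      | zero => simp
      | add x y hx hy => simp only [map_add, hx, hy]
      | tmul h p => simp [highestWeight.incl, hM.coactProj_coe]

/-- Let `D_Q(x) = z ⊗ n`. The term `v x # r` of the product contributes `v z ⊗ E_r(n)` and `v₍₋₁₎ z
⊗ E_r(v₍₀₎ n)`. The term `v₍₋₁₎ x # v₍₀₎ r` contributes `v₍₋₂₎ z ⊗ E_{v₍₀₎ r}(v₍₋₁₎ n)`. By
`coactProj_inl_smul` the last two add up to `v₍₋₁₎ z ⊗ v₍₀₎ E_r(n)`, so nothing is left beyond `v`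
times the derivative. -/
theorem derivL_mul_ι (hR : IsNicholsAlgebra (H := H) ιV 𝒱) (v : V) (y : Q ⊗[k] R) :
    derivL hM hQ (mulL k H Q R (1 ⊗ₜ ιV v) y) =
      (mulL k H Q R (1 ⊗ₜ ιV v)).rTensor _ (derivL hM hQ y) := by
  induction y using TensorProduct.induction_on with
  | zero => simp
  | add x y hx hy => simp only [map_add, hx, hy]
  | tmul x r =>
    rw [derivL_tmul, mulL_one_tmul_ι hR, map_add, derivL_tmul]
    rw [hQ.deriv_smul, Smash.diagAct_apply, hR.comul_inl_ι]
    let B₁ : V →ₗ[k] (Q ⊗[k] M) →ₗ[k] Q ⊗[k] (R ⊗[k] highestWeight k H R M) :=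
      LinearMap.lTensorHom Q ∘ₗ hM.coactProj ∘ₗ (LinearMap.mul k R).flip r ∘ₗ ιV
    let B₂ : H →ₗ[k] (Q ⊗[k] M) →ₗ[k] (Q ⊗[k] M) :=
      TensorProduct.map₂ (act k (Smash k R H) Q ∘ₗ Smash.inr.toLinearMap)
        (act k (Smash k R H) M ∘ₗ Smash.inr.toLinearMap) ∘ₗ comul
    -- The map `T d` is the contribution of the second term of the product as a function of `d =
    -- D_Q(x)`. Since `D_Q` is linear over `A`, `x` enters only through `d`, which can then be
    -- replaced by an arbitrary tensor.
    let T : (Q ⊗[k] M) → H ⊗[k] V →ₗ[k] Q ⊗[k] (R ⊗[k] highestWeight k H R M) :=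
      fun d => TensorProduct.lift (B₁.flip ∘ₗ B₂.flip d)
    have hT : ∀ d h w, T d (h ⊗ₜ w) = B₁ w (B₂ h d) := fun d h w => rfl
    have hB₂ : ∀ h d, diagAct k (Smash k R H) Q M (Smash.inr h) d = B₂ h d := by
      intro h d
      have e : comul (R := k) (Smash.inr h : Smash k R H) = TensorProduct.map
        Smash.inr.toLinearMap Smash.inr.toLinearMap (comul h) := Smash.comulA_inr k H R h
      rw [Smash.diagAct_apply, e]
      simp only [B₂, LinearMap.comp_apply]
      generalize comul (R := k) h = t
      induction t using TensorProduct.induction_on with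
      | zero => simp
      | add x y hx hy => simp only [map_add, LinearMap.add_apply, hx, hy]
      | tmul a b => rfl
    have h1 : ∀ u : H ⊗[k] V, derivL hM hQ (TensorProduct.map
        ((act k (Smash k R H) Q).flip x ∘ₗ Smash.inr.toLinearMap)
        ((LinearMap.mul k R).flip r ∘ₗ ιV) u) =
        (TensorProduct.assoc k Q R _).symm (T (hQ.deriv x) u) := by
      intro u
      induction u using TensorProduct.induction_on with
      | zero => simp
      | add x y hx hy => simp only [map_add, hx, hy]
      | tmul h w =>
        rw [hT, ← hB₂, ← hQ.deriv_smul]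
        rfl
    rw [h1]
    generalize hQ.deriv x = d
    induction d using TensorProduct.induction_on with
    | zero =>
      have h2 : ∀ u, T 0 u = 0 := by
        intro u
        induction u using TensorProduct.induction_on with
        | zero => simp
        | add x y hx hy => simp only [map_add, hx, hy, add_zero]
        | tmul h w => rw [hT, map_zero, map_zero]
      simp [h2]
    | add d d' hd hd' =>
      have h2 : ∀ u, T (d + d') u = T d u + T d' u := by
        intro u
        induction u using TensorProduct.induction_on with
        | zero => simp
        | add x y hx hy => simp only [map_add, hx, hy]; abel
        | tmul h w => simp only [hT, map_add]
      simp only [map_add, h2, ← hd, ← hd', LinearMap.add_apply]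
      abel
    | tmul z n =>
      let G : H ⊗[k] R →ₗ[k] R ⊗[k] highestWeight k H R M :=
        TensorProduct.lift (((hM.coactProj ∘ₗ (LinearMap.mul k R).flip r).compl₂
          ((act k (Smash k R H) M).flip n ∘ₗ Smash.inr.toLinearMap)).flip)
      have hG : ∀ h s, G (h ⊗ₜ s) = hM.coactProj (s * r) ((Smash.inr h : Smash k R H) • n) :=
        fun h s => rfl
      let Θ : H ⊗[k] (H ⊗[k] V) →ₗ[k] Q ⊗[k] (R ⊗[k] highestWeight k H R M) :=
        TensorProduct.map ((act k (Smash k R H) Q).flip z ∘ₗ Smash.inr.toLinearMap)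
          (G ∘ₗ ιV.lTensor H)
      have h2 : ∀ u, T (z ⊗ₜ n) u = Θ (TensorProduct.assoc k H H V (comul.rTensor V u)) := by
        intro u
        induction u using TensorProduct.induction_on with
        | zero => simp
        | add x y hx hy => simp only [map_add, hx, hy]
        | tmul h w =>
          rw [hT, LinearMap.rTensor_tmul]
          simp only [B₂, LinearMap.comp_apply]
          generalize comul (R := k) h = t
          induction t using TensorProduct.induction_on with
          | zero => simp
          | add x y hx hy =>
            simp only [map_add, TensorProduct.add_tmul, LinearMap.add_apply, hx, hy]
          | tmul a b => rfl
      rw [h2, coact_coassoc, LinearMap.lTensor_tmul, rTensor_mulL_ι hR, map_add,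
        LinearMap.add_apply, map_add, map_add, add_assoc, ← map_add]
      congr 1
      · simp
      · congr 1
        generalize coact k H v = u
        induction u using TensorProduct.induction_on with
        | zero => simp
        | add x y hx hy =>
          simp only [map_add, LinearMap.add_apply] at hx hy ⊢
          rw [← hx, ← hy]
          abel
        | tmul h w =>
          -- Coassociativity has separated the factor acting on `z` from the coaction of `w`, so the
          -- identity applies to `w` in the factor `R ⊗ M_H`.
          have key := hM.coactProj_inl_smul hR w r n G hG
          rw [hR.coact_ι] at key
          have e1 : Θ ((coact k H).lTensor H (h ⊗ₜ w)) = ((Smash.inr h : Smash k R H) • z) ⊗ₜ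
            G (ιV.lTensor H (coact k H w)) := rfl
          have e2 : (hM.coactProj r).lTensor Q (TensorProduct.map₂ (act k (Smash k R H) Q)
              (act k (Smash k R H) M) (TensorProduct.map Smash.inr.toLinearMap
                (Smash.inl.toLinearMap ∘ₗ ιV) (h ⊗ₜ w)) (z ⊗ₜ n)) =
              ((Smash.inr h : Smash k R H) • z) ⊗ₜ
                hM.coactProj r ((Smash.inl (ιV w) : Smash k R H) • n) := rfl
          rw [e1, e2, ← TensorProduct.tmul_add, key]
          rfl

/-- The skew derivation `Q # R → (Q # R) ⊗ (M_H ⊕ V)`. -/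
def deriv (hR : IsNicholsAlgebra (H := H) ιV 𝒱) (hM : IsHighestWeight (H := H) 𝒱 ℳ)
    (hQ : IsNicholsAlgebra (H := Smash k R H) ιM 𝒬) :
    Q ⊗[k] R →ₗ[k] (Q ⊗[k] R) ⊗[k] (highestWeight k H R M × V) :=
  (LinearMap.inl k _ _).lTensor _ ∘ₗ derivL hM hQ + (LinearMap.inr k _ _).lTensor _ ∘ₗ derivR hR

/-- The four product rules for the two kinds of generators and the two components fit together:
`M_H` has its correction term only in the `M_H`-component and `V` only in the `V`-component, which
together are the coaction of the direct sum. -/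
theorem deriv_mul (hR : IsNicholsAlgebra (H := H) ιV 𝒱) (w : highestWeight k H R M × V)
    (y : Q ⊗[k] R) :
    deriv hR hM hQ (mulL k H Q R (ιM w.1 ⊗ₜ 1 + 1 ⊗ₜ ιV w.2) y) =
      (mulL k H Q R (ιM w.1 ⊗ₜ 1 + 1 ⊗ₜ ιV w.2)).rTensor _ (deriv hR hM hQ y) +
        ((actH k H Q R).flip y).rTensor _ (coact k H w) := by
  have e1 : mulL k H Q R (ιM w.1 ⊗ₜ 1) = (LinearMap.mulLeft k (ιM w.1)).rTensor R :=
    LinearMap.ext (mulL_tmul_one _)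
  have e2 : coact k H w = (LinearMap.inl k _ V).lTensor H (coact k H w.1) +
      (LinearMap.inr k (highestWeight k H R M) V).lTensor H (coact k H w.2) := by
    change prodCoact k H _ _ w = _
    simp [prodCoact]
  simp only [map_add, LinearMap.add_apply, LinearMap.rTensor_add, deriv, LinearMap.comp_apply, e1,
    e2, derivL_mul_ι_coe, derivL_mul_ι hM hQ hR, derivR_mulLeft, derivR_mul_ι hR,
    rTensor_lTensor_comm]
  abel

theorem deriv_one (hR : IsNicholsAlgebra (H := H) ιV 𝒱) :
    deriv hR hM hQ ((1 : Q) ⊗ₜ (1 : R)) = 0 := by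
  simp [deriv, derivL_tmul, derivR, hQ.deriv_one, hR.deriv_one]

variable (k H Q R) in
/-- The counit of `Q # R`. -/
def counitQR : Q ⊗[k] R →ₗ[k] k := LinearMap.mul' k k ∘ₗ TensorProduct.map counit counit

/-- The constants of the skew derivation of `Q # R` are the scalars. -/
theorem eq_zero_of_deriv_eq_zero (hR : IsNicholsAlgebra (H := H) ιV 𝒱) {y : Q ⊗[k] R}
    (hy : deriv hR hM hQ y = 0) (hε : counitQR k Q R y = 0) : y = 0 := by
  obtain ⟨hL, hV⟩ := eq_zero_of_lTensor_inl_add_inr hy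
  -- Constants of `D_R` are scalars, so the vanishing of the `V`-component means that `y = x ⊗ 1`
  -- for some `x`.
  have h1 : hR.deriv.lTensor Q y = 0 :=
    (TensorProduct.assoc k Q R V).symm.injective (hV.trans (map_zero _).symm)
  have h2 := lTensor_eq_zero ⊤ hR.deriv
    (LinearMap.id - LinearMap.toSpanSingleton k R 1 ∘ₗ counit)
    (fun x _ hx => by
      rw [LinearMap.sub_apply, LinearMap.id_apply, sub_eq_zero]
      simpa using hR.eq_of_deriv_eq_zero hx) (mem_range_lTensor_top y) h1
  rw [LinearMap.lTensor_sub, LinearMap.sub_apply, LinearMap.lTensor_id, LinearMap.id_apply,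
    sub_eq_zero] at h2
  obtain ⟨x, rfl⟩ : ∃ x : Q, y = x ⊗ₜ 1 := by
    refine ⟨TensorProduct.rid k Q (counit.lTensor Q y), h2.trans ?_⟩
    generalize y = t
    induction t using TensorProduct.induction_on with
    | zero => simp
    | add x y hx hy => simp only [map_add, TensorProduct.add_tmul, hx, hy]
    | tmul a b => simp [TensorProduct.smul_tmul]
  rw [derivL_tmul] at hL
  have h3 : (hM.coactProj 1).lTensor Q (hQ.deriv x) = 0 :=
    (TensorProduct.assoc k Q R _).symm.injective (hL.trans (map_zero _).symm)
  -- At `r = 1` the `M_H`-component is `(id ⊗ E_1) D_Q(x)`. As `E_1` is injective, `D_Q(x) = 0`, so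
  -- `x` is a scalar, and the counit shows that this scalar is zero.
  have h4 := lTensor_eq_zero ⊤ (hM.coactProj 1) LinearMap.id
    (fun m _ hm => hM.eq_zero_of_coactProj_one hR hm) (mem_range_lTensor_top _) h3
  rw [LinearMap.lTensor_id, LinearMap.id_apply] at h4
  have h5 : counit (R := k) x = 0 := by
    simpa [counitQR, BraidedHopfAlgebra.counit_one (k := k) (H := H)] using hε
  rw [hQ.eq_of_deriv_eq_zero h4, h5, zero_smul, TensorProduct.zero_tmul]

end BraidedBiproduct

/-! ### Adjoint actions -/

section Adjoint

variable {k H B : Type*} [Field k] [Ring H] [HopfAlgebra k H] [Ring B] [Algebra k B]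

/-- If `g(h) b = F(h₍₁₎) g(h₍₂₎)`, then `F(h) = g(h₍₁₎) b g(S(h₍₂₎))`. -/
theorem eq_adjoint_of_skew (g : H →ₐ[k] B) (b : B) (F : H →ₗ[k] B)
    (hF : ∀ h, g h * b = LinearMap.mul' k B (TensorProduct.map F g.toLinearMap (comul h))) (h : H) :
    F h = LinearMap.mul' k B (TensorProduct.map (LinearMap.mulRight k b ∘ₗ g.toLinearMap)
      (g.toLinearMap ∘ₗ HopfAlgebra.antipode k) (comul h)) := by
  -- The expression `F(h₍₁₎) g(h₍₂₎ S(h₍₃₎))` is read in two ways: by the antipode axiom it is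
  -- `F(h)`, and by the hypothesis it is `g(h₍₁₎) b g(S(h₍₂₎))`.
  let Φ : H ⊗[k] (H ⊗[k] H) →ₗ[k] B :=
    LinearMap.mul' k B ∘ₗ TensorProduct.map F (g.toLinearMap ∘ₗ LinearMap.mul' k H ∘ₗ
      (HopfAlgebra.antipode k).lTensor H)
  have h1 : ∀ t : H ⊗[k] H, LinearMap.mul' k B (TensorProduct.map
      (LinearMap.mulRight k b ∘ₗ g.toLinearMap) (g.toLinearMap ∘ₗ HopfAlgebra.antipode k) t) =
      Φ (TensorProduct.assoc k H H H (comul.rTensor H t)) := by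
    intro t
    induction t using TensorProduct.induction_on with
    | zero => simp
    | add x y hx hy => simp only [map_add, hx, hy]
    | tmul a c =>
      simp only [TensorProduct.map_tmul, LinearMap.comp_apply, LinearMap.mul'_apply,
        LinearMap.mulRight_apply, AlgHom.toLinearMap_apply, hF, LinearMap.rTensor_tmul]
      generalize comul (R := k) a = s
      induction s using TensorProduct.induction_on with
      | zero => simp
      | add x y hx hy => simp only [map_add, add_mul, TensorProduct.add_tmul, hx, hy]
      | tmul d e => simp [Φ, mul_assoc]
  have h2 : ∀ t : H ⊗[k] H, Φ (comul.lTensor H t) =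
      F (TensorProduct.rid k H (counit.lTensor H t)) := by
    intro t
    induction t using TensorProduct.induction_on with
    | zero => simp
    | add x y hx hy => simp only [map_add, hx, hy]
    | tmul a c =>
      simp [Φ, HopfAlgebra.mul_antipode_lTensor_comul_apply, Algebra.algebraMap_eq_smul_one]
  rw [h1, coassoc_apply, h2]
  simp

/-- The elements that skew commute with `H` form a subalgebra. -/
theorem skew_mul {T : Type*} [Ring T] [Algebra k T] [Module H T] [IsScalarTower k H T]
    [IsModuleAlgebra k H T] (g : H →ₐ[k] B) (P : T →ₐ[k] B) (a b : T)
    (ha : ∀ h, g h * P a = LinearMap.mul' k B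
      (TensorProduct.map (P.toLinearMap ∘ₗ (act k H T).flip a) g.toLinearMap (comul h)))
    (hb : ∀ h, g h * P b = LinearMap.mul' k B
      (TensorProduct.map (P.toLinearMap ∘ₗ (act k H T).flip b) g.toLinearMap (comul h))) (h : H) :
    g h * P (a * b) = LinearMap.mul' k B
      (TensorProduct.map (P.toLinearMap ∘ₗ (act k H T).flip (a * b)) g.toLinearMap (comul h)) := by
  let F : H ⊗[k] (H ⊗[k] H) →ₗ[k] B :=
    LinearMap.mul' k B ∘ₗ TensorProduct.map (P.toLinearMap ∘ₗ (act k H T).flip a)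
      (LinearMap.mul' k B ∘ₗ TensorProduct.map (P.toLinearMap ∘ₗ (act k H T).flip b) g.toLinearMap)
  have h1 : ∀ t : H ⊗[k] H, LinearMap.mul' k B
      (TensorProduct.map (P.toLinearMap ∘ₗ (act k H T).flip a) g.toLinearMap t) * P b =
      F (comul.lTensor H t) := by
    intro t
    induction t using TensorProduct.induction_on with
    | zero => simp
    | add x y hx hy => simp only [map_add, add_mul, hx, hy]
    | tmul c d =>
      simp only [F, TensorProduct.map_tmul, LinearMap.mul'_apply, LinearMap.comp_apply,
        LinearMap.lTensor_tmul, mul_assoc, AlgHom.toLinearMap_apply, hb]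
  have h2 : ∀ t : H ⊗[k] H, F (TensorProduct.assoc k H H H (comul.rTensor H t)) =
      LinearMap.mul' k B (TensorProduct.map
        (P.toLinearMap ∘ₗ (act k H T).flip (a * b)) g.toLinearMap t) := by
    intro t
    induction t using TensorProduct.induction_on with
    | zero => simp
    | add x y hx hy => simp only [map_add, hx, hy]
    | tmul c d =>
      simp only [TensorProduct.map_tmul, LinearMap.mul'_apply, LinearMap.comp_apply,
        LinearMap.rTensor_tmul, LinearMap.flip_apply, act_apply, IsModuleAlgebra.smul_mul (k := k),
        Smash.diagAct_apply]
      generalize comul (R := k) c = s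
      induction s using TensorProduct.induction_on with
      | zero => simp
      | add x y hx hy =>
        simp only [map_add, add_mul, LinearMap.add_apply, TensorProduct.add_tmul, hx, hy]
      | tmul e f => simp [F, mul_assoc]
  rw [map_mul, ← mul_assoc, ha, h1, ← coassoc_apply, h2]

end Adjoint

/-! ### The smash product Q # (R # H) and its action on Q -/

namespace BraidedBiproduct

section Smash

variable {k H Q R : Type*} [Field k] [Ring H] [HopfAlgebra k H]
  [Ring R] [Algebra k R] [Module H R] [IsScalarTower k H R] [Coalgebra k R]
  [BraidedHopfAlgebra k H R]
  [Ring Q] [Algebra k Q] [Module (Smash k R H) Q] [IsScalarTower k (Smash k R H) Q]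
  [IsModuleAlgebra k (Smash k R H) Q]

variable (k H Q R) in
/-- The inclusion of `H` in `Q # (R # H)`. -/
def inrH : H →ₐ[k] Smash k Q (Smash k R H) := Smash.inr.comp Smash.inr

variable (k H Q R) in
/-- The inclusion of `R` in `Q # (R # H)`. -/
def inrR : R →ₐ[k] Smash k Q (Smash k R H) := Smash.inr.comp Smash.inl

theorem inrH_mul_inl (h : H) (x : Q) : inrH k H Q R h * Smash.inl x =
    LinearMap.mul' k _ (TensorProduct.map
      (Smash.inl.toLinearMap ∘ₗ (act k (Smash k R H) Q).flip x ∘ₗ Smash.inr.toLinearMap)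
      (inrH k H Q R).toLinearMap (comul h)) := by
  have e : comul (R := k) (Smash.inr h : Smash k R H) = TensorProduct.map
    Smash.inr.toLinearMap Smash.inr.toLinearMap (comul h) := Smash.comulA_inr k H R h
  change Smash.inr (Smash.inr h) * Smash.inl x = _
  rw [Smash.inr_mul_inl, e]
  generalize comul (R := k) h = t
  induction t using TensorProduct.induction_on with
  | zero => simp
  | add x y hx hy => simp only [map_add, hx, hy]
  | tmul a b =>
    rw [TensorProduct.map_tmul, LinearMap.rTensor_tmul, Smash.ofTensor_tmul]
    rfl

theorem inrH_mul_inrR (h : H) (r : R) : inrH k H Q R h * inrR k H Q R r =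
    LinearMap.mul' k _ (TensorProduct.map
      ((inrR k H Q R).toLinearMap ∘ₗ (act k H R).flip r)
      (inrH k H Q R).toLinearMap (comul h)) := by
  change (Smash.inr (Smash.inr h) : Smash k Q (Smash k R H)) * Smash.inr (Smash.inl r) = _
  rw [← map_mul, Smash.inr_mul_inl]
  generalize comul (R := k) h = t
  induction t using TensorProduct.induction_on with
  | zero => simp
  | add x y hx hy => simp only [map_add, hx, hy]
  | tmul a b =>
    rw [TensorProduct.map_tmul, LinearMap.rTensor_tmul, Smash.ofTensor_tmul, map_mul]
    rfl

theorem toSmash_tmul (x : Q) (r : R) :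
    toSmash k H Q R (x ⊗ₜ r) = Smash.inl x * inrR k H Q R r :=
  Smash.ofTensor_tmul _ _

theorem inrH_mul_toSmash (h : H) (z : Q ⊗[k] R) : inrH k H Q R h * toSmash k H Q R z =
    LinearMap.mul' k _ (TensorProduct.map (toSmash k H Q R ∘ₗ (actH k H Q R).flip z)
      (inrH k H Q R).toLinearMap (comul h)) := by
  -- Restricting the action on `Q` along `H → R # H` makes `SkewComm.mul` applicable to the factors
  -- `Q` and `R` together.
  let inst : Module H Q := Module.compHom Q (Smash.inr : H →ₐ[k] Smash k R H).toRingHom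
  have hs : ∀ (h : H) (x : Q), h • x = (Smash.inr h : Smash k R H) • x := fun _ _ => rfl
  have : IsScalarTower k H Q := ⟨fun c h x => by rw [hs, hs, map_smul, smul_assoc]⟩
  have h1 : SkewComm (inrH k H Q R).toLinearMap
    (Smash.inl : Q →ₐ[k] Smash k Q (Smash k R H)).toLinearMap := fun h x => inrH_mul_inl h x
  have h2 : SkewComm (inrH k H Q R).toLinearMap (inrR k H Q R).toLinearMap :=
    fun h x => inrH_mul_inrR h x
  have h3 : LinearMap.mul' k _ ∘ₗ TensorProduct.map
      (Smash.inl : Q →ₐ[k] Smash k Q (Smash k R H)).toLinearMap (inrR k H Q R).toLinearMap =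
      toSmash k H Q R := by
    refine TensorProduct.ext' fun x r => ?_
    rw [toSmash_tmul]
    rfl
  have h4 := h1.mul h2 h z
  rw [← LinearMap.comp_assoc, h3, ← LinearMap.comp_apply (LinearMap.mul' k _), h3] at h4
  exact h4

variable (k H Q R) in
/-- The algebra inclusion `Q # R → Q # (R # H)`. -/
def toSmashHom : BraidedBiproduct k H Q R →ₐ[k] Smash k Q (Smash k R H) :=
  AlgHom.ofLinearMap (toSmash k H Q R ∘ₗ ofTensor.symm.toLinearMap) rfl
    (fun x y => toSmash_mulL x y)

variable (k H Q R) in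
/-- The action `(x # a) m = x (a m)` of `Q # (R # H)` on `Q`. -/
def repr : Smash k Q (Smash k R H) →ₐ[k] Module.End k Q :=
  Smash.lift (Algebra.lmul k Q) (Algebra.lsmul k k Q) (by
    intro a x
    refine LinearMap.ext fun m => ?_
    change a • (x * m) = _
    rw [IsModuleAlgebra.smul_mul (k := k), Smash.diagAct_apply]
    generalize comul (R := k) a = t
    induction t using TensorProduct.induction_on with
    | zero => simp
    | add x y hx hy => simp only [map_add, LinearMap.add_apply, hx, hy]
    | tmul a b => simp)

theorem repr_inl (x m : Q) : repr k H Q R (Smash.inl x) m = x * m := by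
  rw [repr, Smash.lift_inl]; rfl

theorem repr_inr (a : Smash k R H) (m : Q) : repr k H Q R (Smash.inr a) m = a • m := by
  rw [repr, Smash.lift_inr]; rfl

theorem repr_mem {J : TwoSidedIdeal Q} (hJ : ∀ (a : Smash k R H), ∀ y ∈ J, a • y ∈ J)
    (z : Smash k Q (Smash k R H)) {y : Q} (hy : y ∈ J) : repr k H Q R z y ∈ J := by
  induction z using Smash.induction_on with
  | zero => rw [map_zero]; exact J.zero_mem
  | add z z' hz hz' => rw [map_add]; exact J.add_mem hz hz'
  | mk x a =>
    rw [← Smash.inl_mul_inr, map_mul, Module.End.mul_apply, repr_inr, repr_inl]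
    exact J.mul_mem_left _ _ (hJ a y hy)

/-- The ideal of all elements of `Q # (R # H)` that map `Q` to the ideal `J` of `Q`. -/
def annihilatorMod {J : TwoSidedIdeal Q} (hJ : ∀ (a : Smash k R H), ∀ y ∈ J, a • y ∈ J) :
    TwoSidedIdeal (Smash k Q (Smash k R H)) :=
  TwoSidedIdeal.mk' {z | ∀ m, repr k H Q R z m ∈ J}
    (fun m => by rw [map_zero]; exact J.zero_mem)
    (fun hx hy m => by rw [map_add]; exact J.add_mem (hx m) (hy m))
    (fun hx m => by rw [map_neg]; exact J.neg_mem (hx m))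
    -- Absorption from the left uses that `J` is a left ideal stable under `R # H`. Absorption from
    -- the right uses that the condition is imposed for every `m` in `Q`, not only for `m = 1`.
    (fun {x y} hy m => by
      rw [map_mul, Module.End.mul_apply]
      exact repr_mem hJ x (hy m))
    (fun {x y} hx m => by
      rw [map_mul, Module.End.mul_apply]
      exact hx _)

theorem mem_annihilatorMod {J : TwoSidedIdeal Q}
    (hJ : ∀ (a : Smash k R H), ∀ y ∈ J, a • y ∈ J) (z : Smash k Q (Smash k R H)) :
    z ∈ annihilatorMod hJ ↔ ∀ m, repr k H Q R z m ∈ J :=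
  TwoSidedIdeal.mem_mk' ..

end Smash

/-! ### Naturality of the braided biproduct in Q -/

section Naturality

variable {k H Q Q' R : Type*} [Field k] [Ring H] [HopfAlgebra k H]
  [Ring R] [Algebra k R] [Module H R] [IsScalarTower k H R] [Coalgebra k R]
  [BraidedHopfAlgebra k H R]
  [Ring Q] [Algebra k Q] [Module (Smash k R H) Q] [IsScalarTower k (Smash k R H) Q]
  [Ring Q'] [Algebra k Q'] [Module (Smash k R H) Q'] [IsScalarTower k (Smash k R H) Q']

theorem rTensor_mulL (π : Q →ₐ[k] Q') (hπ : ∀ (a : Smash k R H) x, π (a • x) = a • π x)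
    (x y : Q ⊗[k] R) : π.toLinearMap.rTensor R (mulL k H Q R x y) =
      mulL k H Q' R (π.toLinearMap.rTensor R x) (π.toLinearMap.rTensor R y) := by
  induction x using TensorProduct.induction_on with
  | zero => simp
  | add x x' hx hx' => simp only [map_add, LinearMap.add_apply, hx, hx']
  | tmul q r =>
    induction y using TensorProduct.induction_on with
    | zero => simp
    | add x y hx hy => simp only [map_add, hx, hy]
    | tmul q' r' =>
      change π.toLinearMap.rTensor R ((LinearMap.mulLeft k q).rTensor R
        (TensorProduct.map₂ (act k (Smash k R H) Q) (LinearMap.mul k R)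
          (halfComul k H R r) (q' ⊗ₜ r'))) = (LinearMap.mulLeft k (π q)).rTensor R
        (TensorProduct.map₂ (act k (Smash k R H) Q') (LinearMap.mul k R)
          (halfComul k H R r) (π q' ⊗ₜ r'))
      generalize halfComul k H R r = t
      induction t using TensorProduct.induction_on with
      | zero => simp
      | add x y hx hy => simp only [map_add, LinearMap.add_apply, hx, hy]
      | tmul a b => simp [hπ]

theorem rTensor_actH (π : Q →ₐ[k] Q') (hπ : ∀ (a : Smash k R H) x, π (a • x) = a • π x)
    (h : H) (y : Q ⊗[k] R) : π.toLinearMap.rTensor R (actH k H Q R h y) =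
      actH k H Q' R h (π.toLinearMap.rTensor R y) := by
  simp only [actH, LinearMap.comp_apply]
  generalize comul (R := k) h = t
  induction t using TensorProduct.induction_on with
  | zero => simp
  | add x y hx hy => simp only [map_add, LinearMap.add_apply, hx, hy]
  | tmul a b =>
    induction y using TensorProduct.induction_on with
    | zero => simp
    | add x y hx hy => simp only [map_add, hx, hy]
    | tmul q r => simp [hπ]

end Naturality

end BraidedBiproduct

namespace IsNicholsAlgebra

/-- The projection of the tensor algebra to a Nichols algebra is a module map. -/
theorem lift_smul {k H W R : Type*} [Field k] [Ring H] [HopfAlgebra k H]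
    [AddCommGroup W] [Module k W] [Module H W] [IsScalarTower k H W] [YetterDrinfeld k H W]
    [Ring R] [Algebra k R] [Module H R] [IsScalarTower k H R] [Coalgebra k R]
    [BraidedHopfAlgebra k H R] {ι : W →ₗ[k] R} {𝒢 : ℕ → Submodule k R}
    (hR : IsNicholsAlgebra (H := H) ι 𝒢) (h : H) (x : Tc k H W) :
    Tc.lift ι (h • x) = h • (Tc.lift ι x : R) := by
  induction x using Tc.induction generalizing h with
  | algebraMap c =>
    rw [Tc.smul_algebraMap, AlgHom.commutes, AlgHom.commutes, Algebra.algebraMap_eq_smul_one,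
      Algebra.algebraMap_eq_smul_one, smul_algebra_smul_comm, IsModuleAlgebra.smul_one (k := k) h,
      Algebra.algebraMap_eq_smul_one, smul_smul]
  | ι w => rw [Tc.smul_ι, Tc.lift_ι, Tc.lift_ι, hR.ι_smul]
  | add a b ha hb => rw [smul_add, map_add, map_add, smul_add, ha, hb]
  | mul a b ha hb =>
    rw [IsModuleAlgebra.smul_mul (k := k), map_mul, IsModuleAlgebra.smul_mul (k := k),
      Smash.diagAct_apply, Smash.diagAct_apply]
    generalize comul (R := k) h = t
    induction t using TensorProduct.induction_on with
    | zero => simp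
    | add x y hx hy => simp only [map_add, LinearMap.add_apply, hx, hy]
    | tmul c d => simp [ha, hb]

end IsNicholsAlgebra

/-! ### The projection to the braided biproduct -/

section ProjBiproduct

set_option linter.unusedSectionVars false

open BraidedBiproduct

variable {k H V R M : Type*} [Field k] [Ring H] [HopfAlgebra k H]
  [AddCommGroup V] [Module k V] [Module H V] [IsScalarTower k H V] [YetterDrinfeld k H V]
  [Ring R] [Algebra k R] [Module H R] [IsScalarTower k H R] [Coalgebra k R]
  [BraidedHopfAlgebra k H R] {ιV : V →ₗ[k] R} {𝒱 : ℕ → Submodule k R}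
  [AddCommGroup M] [Module k M] [Module (Smash k R H) M] [IsScalarTower k (Smash k R H) M]
  [YetterDrinfeld k (Smash k R H) M] {ℳ : ℕ → Submodule k M}

variable (H M) in
/-- The composition `T_c(M_H ⊕ V) → T_c(M) # R → T_c(M) # (R # H)`. -/
def projSmash (ιV : V →ₗ[k] R) : Tc k H (highestWeight k H R M × V) →ₐ[k]
    Smash k (Tc k (Smash k R H) M) (Smash k R H) :=
  (toSmashHom k H (Tc k (Smash k R H) M) R).comp (projBiproduct ιV)

theorem projSmash_apply (x : Tc k H (highestWeight k H R M × V)) :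
    projSmash H M ιV x = toSmash k H (Tc k (Smash k R H) M) R
      (ofTensor.symm (projBiproduct ιV x)) := rfl

theorem projBiproduct_ι (w : highestWeight k H R M × V) :
    ofTensor.symm (projBiproduct ιV (Tc.ι k H _ w)) =
      Tc.ι k (Smash k R H) M w.1 ⊗ₜ 1 + 1 ⊗ₜ ιV w.2 := by
  rw [projBiproduct, Tc.lift_ι]
  rfl

theorem projSmash_ι (w : highestWeight k H R M × V) : projSmash H M ιV (Tc.ι k H _ w) =
    Smash.inl (Tc.ι k (Smash k R H) M w.1) + inrR k H _ R (ιV w.2) := by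
  rw [projSmash_apply, projBiproduct_ι, map_add, toSmash_tmul, toSmash_tmul, map_one, map_one,
    mul_one, one_mul]

/-- `h p(x) = p(h₍₁₎ x) h₍₂₎` in `T_c(M) # (R # H)`. -/
theorem inrH_mul_projSmash (hR : IsNicholsAlgebra (H := H) ιV 𝒱)
    (h : H) (x : Tc k H (highestWeight k H R M × V)) :
    inrH k H (Tc k (Smash k R H) M) R h * projSmash H M ιV x = LinearMap.mul' k (Smash k (Tc k (Smash k R H) M) (Smash k R H)) (TensorProduct.map
      ((projSmash H M ιV).toLinearMap ∘ₗ (act k H (Tc k H (highestWeight k H R M × V))).flip x) (inrH k H (Tc k (Smash k R H) M) R).toLinearMap (comul h)) := by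
  induction x using Tc.induction generalizing h with
  | algebraMap c =>
    rw [AlgHom.commutes]
    have : ∀ t : H ⊗[k] H, LinearMap.mul' k (Smash k (Tc k (Smash k R H) M) (Smash k R H)) (TensorProduct.map ((projSmash H M ιV).toLinearMap ∘ₗ
        (act k H (Tc k H (highestWeight k H R M × V))).flip (algebraMap k (Tc k H (highestWeight k H R M × V)) c))
        (inrH k H (Tc k (Smash k R H) M) R).toLinearMap t) =
        c • inrH k H (Tc k (Smash k R H) M) R (TensorProduct.lid k H (counit.rTensor H t)) := by
      intro t
      induction t using TensorProduct.induction_on with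
      | zero => simp
      | add x y hx hy => simp only [map_add, hx, hy, smul_add]
      | tmul a b =>
        simp only [TensorProduct.map_tmul, LinearMap.mul'_apply, LinearMap.comp_apply,
          LinearMap.flip_apply, act_apply, Tc.smul_algebraMap, AlgHom.toLinearMap_apply,
          AlgHom.commutes, LinearMap.rTensor_tmul, TensorProduct.lid_tmul, map_smul, smul_smul]
        rw [← Algebra.smul_def]
    rw [this, ← Algebra.commutes, ← Algebra.smul_def]
    simp
  | ι w =>
    rw [projSmash_ι, mul_add, inrH_mul_inl, inrH_mul_inrR]
    generalize comul (R := k) h = t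
    induction t using TensorProduct.induction_on with
    | zero => simp
    | add x y hx hy =>
      simp only [map_add] at hx hy ⊢
      rw [← hx, ← hy]
      abel
    | tmul a b =>
      simp only [TensorProduct.map_tmul, LinearMap.mul'_apply, LinearMap.comp_apply,
        LinearMap.flip_apply, act_apply, AlgHom.toLinearMap_apply, Tc.smul_ι, projSmash_ι,
        Prod.smul_fst, Prod.smul_snd, hR.ι_smul, highestWeight.coe_smul, add_mul]
  | add a b ha hb =>
    simp only [map_add, mul_add, ha, hb, LinearMap.comp_add, TensorProduct.map_add_left,
      LinearMap.add_apply]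
  | mul a b ha hb => exact skew_mul (inrH k H (Tc k (Smash k R H) M) R) (projSmash H M ιV) a b ha hb h

/-- `p(h x) = h₍₁₎ p(x) S(h₍₂₎)` in `T_c(M) # (R # H)`. -/
theorem projSmash_smul (hR : IsNicholsAlgebra (H := H) ιV 𝒱)
    (h : H) (x : Tc k H (highestWeight k H R M × V)) :
    projSmash H M ιV (h • x) = LinearMap.mul' k (Smash k (Tc k (Smash k R H) M) (Smash k R H)) (TensorProduct.map
      (LinearMap.mulRight k (projSmash H M ιV x) ∘ₗ (inrH k H (Tc k (Smash k R H) M) R).toLinearMap)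
      ((inrH k H (Tc k (Smash k R H) M) R).toLinearMap ∘ₗ HopfAlgebra.antipode k) (comul h)) :=
  eq_adjoint_of_skew (inrH k H (Tc k (Smash k R H) M) R) (projSmash H M ιV x)
    ((projSmash H M ιV).toLinearMap ∘ₗ (act k H (Tc k H (highestWeight k H R M × V))).flip x) (fun h => inrH_mul_projSmash hR h x) h

/-- Inside `T_c(M) # (R # H)`, into which `T_c(M) # R` embeds, both sides are equal to `h₍₁₎ p(x)
S(h₍₂₎)`. -/
theorem projBiproduct_smul (hR : IsNicholsAlgebra (H := H) ιV 𝒱)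
    (h : H) (x : Tc k H (highestWeight k H R M × V)) :
    ofTensor.symm (projBiproduct ιV (h • x)) =
      actH k H (Tc k (Smash k R H) M) R h (ofTensor.symm (projBiproduct ιV x)) := by
  refine toSmash_injective (k := k) (H := H) ?_
  rw [← projSmash_apply, projSmash_smul hR]
  exact (eq_adjoint_of_skew (inrH k H (Tc k (Smash k R H) M) R) (projSmash H M ιV x)
    (toSmash k H _ R ∘ₗ (actH k H _ R).flip (ofTensor.symm (projBiproduct ιV x)))
    (fun h => inrH_mul_toSmash h _) h).symm

theorem projBiproduct_mul (x y : Tc k H (highestWeight k H R M × V)) :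
    ofTensor.symm (projBiproduct ιV (x * y)) = mulL k H (Tc k (Smash k R H) M) R
      (ofTensor.symm (projBiproduct ιV x)) (ofTensor.symm (projBiproduct ιV y)) := by
  rw [map_mul]; rfl

/-- This identifies the elements of `hatSet` as the values of the operators `p(x)` on `T_c(M)`,
which allows the ideal `annihilatorMod` to detect them. -/
theorem repr_projSmash (x : Tc k H (highestWeight k H R M × V)) (m : Tc k (Smash k R H) M) :
    repr k H _ R (projSmash H M ιV x) m = applyTo m (projBiproduct ιV x) := by
  rw [projSmash_apply]
  change _ = LinearMap.mul' k (Tc k (Smash k R H) M)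
    (((act k (Smash k R H) (Tc k (Smash k R H) M)).flip m ∘ₗ
      (Smash.inl : R →ₐ[k] Smash k R H).toLinearMap).lTensor (Tc k (Smash k R H) M)
        (ofTensor.symm (projBiproduct ιV x)))
  generalize (ofTensor (k := k) (H := H)).symm (projBiproduct ιV x) = z
  induction z using TensorProduct.induction_on with
  | zero => simp
  | add x y hx hy => simp only [map_add, LinearMap.add_apply, hx, hy]
  | tmul a r =>
    rw [toSmash_tmul, map_mul, Module.End.mul_apply, repr_inl]
    change a * repr k H _ R (Smash.inr (Smash.inl r)) m = _
    rw [repr_inr]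
    rfl

theorem inrR_mem_range (hR : IsNicholsAlgebra (H := H) ιV 𝒱) (r : R) :
    inrR k H (Tc k (Smash k R H) M) R r ∈ (projSmash H M ιV).range := by
  have h1 : (⊤ : Subalgebra k R) ≤
      ((projSmash H M ιV).range).comap (inrR k H (Tc k (Smash k R H) M) R) := by
    rw [← hR.adjoin_range]
    refine Algebra.adjoin_le ?_
    rintro _ ⟨v, rfl⟩
    refine ⟨Tc.ι k H _ (0, v), ?_⟩
    change projSmash H M ιV (Tc.ι k H _ (0, v)) = _
    rw [projSmash_ι]
    simp
  exact h1 (Algebra.mem_top (x := r))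

/-- In the smash product, `h m` is the adjoint expression `h₍₁₎ m S(h₍₂₎)`. If `m = p(x)`, this
expression is `p(h x)`. -/
theorem inl_ι_inr_smul_mem_range (hR : IsNicholsAlgebra (H := H) ιV 𝒱) {m : M}
    (hm : Smash.inl (Tc.ι k (Smash k R H) M m) ∈ (projSmash H M ιV).range) (h : H) :
    Smash.inl (Tc.ι k (Smash k R H) M ((Smash.inr h : Smash k R H) • m)) ∈
      (projSmash H M ιV).range := by
  obtain ⟨x, hx⟩ := hm
  change projSmash H M ιV x = _ at hx
  refine ⟨h • x, ?_⟩
  change projSmash H M ιV (h • x) = _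
  rw [projSmash_smul hR, hx]
  refine (eq_adjoint_of_skew (inrH k H (Tc k (Smash k R H) M) R) (Smash.inl (Tc.ι k (Smash k R H) M m))
    (Smash.inl.toLinearMap ∘ₗ (act k (Smash k R H) _).flip (Tc.ι k (Smash k R H) M m) ∘ₗ
      Smash.inr.toLinearMap) (fun h => inrH_mul_inl h _) h).symm.trans ?_
  simp [Tc.smul_ι]

/-- The action of `v` is a braided commutator: `v m # 1 = (1 # v)(m # 1) - (v₍₋₁₎ m # 1)(1 # v₍₀₎)`.
All factors on the right are in the range, the element `v₍₋₁₎ m` by `inl_ι_inr_smul_mem_range`. -/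
theorem inl_ι_inl_smul_mem_range (hR : IsNicholsAlgebra (H := H) ιV 𝒱) {m : M}
    (hm : Smash.inl (Tc.ι k (Smash k R H) M m) ∈ (projSmash H M ιV).range) (v : V) :
    Smash.inl (Tc.ι k (Smash k R H) M ((Smash.inl (ιV v) : Smash k R H) • m)) ∈
      (projSmash H M ιV).range := by
  let P := (projSmash H M ιV).range
  have h1 : inrR k H (Tc k (Smash k R H) M) R (ιV v) *
      Smash.inl (Tc.ι k (Smash k R H) M m) =
      Smash.inl (Tc.ι k (Smash k R H) M ((Smash.inl (ιV v) : Smash k R H) • m)) +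
      Smash.ofTensor (((act k (Smash k R H) _).flip (Tc.ι k (Smash k R H) M m)).rTensor _
        (TensorProduct.map (Smash.inr : H →ₐ[k] Smash k R H).toLinearMap
          ((Smash.inl : R →ₐ[k] Smash k R H).toLinearMap ∘ₗ ιV) (coact k H v))) := by
    change Smash.inr (Smash.inl (ιV v)) * _ = _
    rw [Smash.inr_mul_inl, hR.comul_inl_ι, map_add, map_add, LinearMap.rTensor_tmul,
      Smash.ofTensor_tmul, map_one, mul_one, LinearMap.flip_apply, act_apply, Tc.smul_ι]
  have h2 : ∀ u : H ⊗[k] V,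
      Smash.ofTensor (((act k (Smash k R H) _).flip (Tc.ι k (Smash k R H) M m)).rTensor _
        (TensorProduct.map (Smash.inr : H →ₐ[k] Smash k R H).toLinearMap
          ((Smash.inl : R →ₐ[k] Smash k R H).toLinearMap ∘ₗ ιV) u)) ∈ P := by
    intro u
    induction u using TensorProduct.induction_on with
    | zero => simp only [map_zero]; exact zero_mem _
    | add x y hx hy => simp only [map_add]; exact add_mem hx hy
    | tmul h w =>
      rw [TensorProduct.map_tmul, LinearMap.rTensor_tmul, Smash.ofTensor_tmul,
        LinearMap.flip_apply, act_apply, Tc.smul_ι]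
      exact mul_mem (inl_ι_inr_smul_mem_range hR hm h) (inrR_mem_range hR (ιV w))
  rw [eq_sub_of_add_eq h1.symm]
  exact sub_mem (mul_mem (inrR_mem_range hR _) hm) (h2 _)

/-- The vectors of `M` that lie in the range form a subspace stable under `H` and, as `V` generates
`R`, under `R`. This subspace contains `M_H`, which generates `M` over `R # H`. -/
theorem inl_mem_range (hR : IsNicholsAlgebra (H := H) ιV 𝒱)
    (hM : IsHighestWeight (H := H) 𝒱 ℳ) (y : Tc k (Smash k R H) M) :
    Smash.inl y ∈ (projSmash H M ιV).range := by
  let P := (projSmash H M ιV).range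
  let S₀ : Submodule k M :=
    (Subalgebra.toSubmodule P).comap (Smash.inl.toLinearMap ∘ₗ Tc.ι k (Smash k R H) M)
  have hS₀ : ∀ m, m ∈ S₀ ↔ Smash.inl (Tc.ι k (Smash k R H) M m) ∈ P := fun m => Iff.rfl
  have hinl : ∀ (r : R), ∀ m ∈ S₀, (Smash.inl r : Smash k R H) • m ∈ S₀ := by
    intro r
    have hr : r ∈ Algebra.adjoin k (Set.range ιV) := by rw [hR.adjoin_range]; trivial
    induction hr using Algebra.adjoin_induction with
    | mem x hx => obtain ⟨v, rfl⟩ := hx; exact fun m hm => inl_ι_inl_smul_mem_range hR hm v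
    | algebraMap c =>
      intro m hm
      rw [AlgHom.commutes, algebraMap_smul]
      exact S₀.smul_mem c hm
    | add a b _ _ ha hb =>
      intro m hm
      rw [map_add, add_smul]
      exact add_mem (ha m hm) (hb m hm)
    | mul a b _ _ ha hb =>
      intro m hm
      rw [map_mul, mul_smul]
      exact ha _ (hb m hm)
  let S : Submodule (Smash k R H) M :=
    { S₀ with
      smul_mem' := by
        intro a m hm
        change a • m ∈ S₀
        induction a using Smash.induction_on with
        | zero => rw [zero_smul]; exact zero_mem _
        | add a b ha hb => rw [add_smul]; exact add_mem ha hb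
        | mk r h =>
          rw [← Smash.inl_mul_inr, mul_smul]
          exact hinl r _ (inl_ι_inr_smul_mem_range hR hm h) }
  have hS : S = ⊤ := by
    rw [eq_top_iff, ← hM.span_eq_top, Submodule.span_le]
    intro m hm
    refine ⟨Tc.ι k H _ (⟨m, hm⟩, 0), ?_⟩
    change projSmash H M ιV (Tc.ι k H _ (⟨m, hm⟩, 0)) = _
    rw [projSmash_ι]
    simp
  induction y using Tc.induction with
  | algebraMap c => rw [AlgHom.commutes]; exact P.algebraMap_mem c
  | ι m =>
    have hm : m ∈ S := by rw [hS]; trivial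
    exact hm
  | add a b ha hb => rw [map_add]; exact add_mem ha hb
  | mul a b ha hb => rw [map_mul]; exact mul_mem ha hb

theorem exists_projBiproduct_eq (hR : IsNicholsAlgebra (H := H) ιV 𝒱)
    (hM : IsHighestWeight (H := H) 𝒱 ℳ) (y : Tc k (Smash k R H) M) :
    ∃ x : Tc k H (highestWeight k H R M × V), projSmash H M ιV x = Smash.inl y ∧
      ofTensor.symm (projBiproduct ιV x) = y ⊗ₜ 1 := by
  obtain ⟨x, hx⟩ := inl_mem_range hR hM y
  refine ⟨x, hx, toSmash_injective (k := k) (H := H) ?_⟩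
  rw [← projSmash_apply, toSmash_tmul, map_one, mul_one]
  exact hx

/-! ### The kernels of the projections -/

variable {Q N : Type*} [Ring Q] [Algebra k Q] [Module (Smash k R H) Q]
  [IsScalarTower k (Smash k R H) Q] [Coalgebra k Q] [BraidedHopfAlgebra k (Smash k R H) Q]
  {ιM : M →ₗ[k] Q} {𝒬 : ℕ → Submodule k Q}
  [Ring N] [Algebra k N] [Module H N] [IsScalarTower k H N] [Coalgebra k N]
  [BraidedHopfAlgebra k H N]
  {ιN : (highestWeight k H R M × V) →ₗ[k] N} {𝒩 : ℕ → Submodule k N}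

/-- The composition `T_c(M_H ⊕ V) → T_c(M) # R → Q # R`. -/
def projQ (ιV : V →ₗ[k] R) (ιM : M →ₗ[k] Q) :
    Tc k H (highestWeight k H R M × V) →ₗ[k] Q ⊗[k] R :=
  (Tc.lift ιM : Tc k (Smash k R H) M →ₐ[k] Q).toLinearMap.rTensor R ∘ₗ
    ofTensor.symm.toLinearMap ∘ₗ (projBiproduct ιV).toLinearMap

theorem projQ_apply (x : Tc k H (highestWeight k H R M × V)) : projQ ιV ιM x =
    (Tc.lift ιM : Tc k (Smash k R H) M →ₐ[k] Q).toLinearMap.rTensor R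
      (ofTensor.symm (projBiproduct ιV x)) := rfl

theorem projQ_one : projQ ιV ιM (1 : Tc k H (highestWeight k H R M × V)) = 1 ⊗ₜ 1 := by
  have h1 : ofTensor.symm (projBiproduct ιV (1 : Tc k H (highestWeight k H R M × V))) =
    (1 : Tc k (Smash k R H) M) ⊗ₜ[k] (1 : R) := by rw [map_one]; rfl
  rw [projQ_apply, h1, LinearMap.rTensor_tmul, AlgHom.toLinearMap_apply, map_one]

theorem projQ_ι_mul (hQ : IsNicholsAlgebra (H := Smash k R H) ιM 𝒬)
    (w : highestWeight k H R M × V) (x : Tc k H (highestWeight k H R M × V)) :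
    projQ ιV ιM (Tc.ι k H _ w * x) =
      mulL k H Q R (ιM w.1 ⊗ₜ 1 + 1 ⊗ₜ ιV w.2) (projQ ιV ιM x) := by
  rw [projQ_apply, projBiproduct_mul, rTensor_mulL _ hQ.lift_smul, projBiproduct_ι, map_add,
    LinearMap.rTensor_tmul, LinearMap.rTensor_tmul, AlgHom.toLinearMap_apply,
    AlgHom.toLinearMap_apply, map_one, Tc.lift_ι]
  rfl

theorem projQ_smul (hR : IsNicholsAlgebra (H := H) ιV 𝒱)
    (hQ : IsNicholsAlgebra (H := Smash k R H) ιM 𝒬) (h : H)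
    (x : Tc k H (highestWeight k H R M × V)) :
    projQ ιV ιM (h • x) = actH k H Q R h (projQ ιV ιM x) := by
  rw [projQ_apply, projBiproduct_smul hR, rTensor_actH _ hQ.lift_smul]
  rfl

/-- The counits vanish on `M`, on `V` and on `v # 1`. Since they are multiplicative and compatible
with the actions, left multiplication by a generator gives counit zero. -/
theorem counitQR_mulL (hR : IsNicholsAlgebra (H := H) ιV 𝒱)
    (hQ : IsNicholsAlgebra (H := Smash k R H) ιM 𝒬) (m : M) (v : V) (y : Q ⊗[k] R) :
    counitQR k Q R (mulL k H Q R (ιM m ⊗ₜ 1 + 1 ⊗ₜ ιV v) y) = 0 := by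
  induction y using TensorProduct.induction_on with
  | zero => simp
  | add x y hx hy => rw [map_add, map_add, hx, hy, add_zero]
  | tmul x r =>
    have e1 : counit (R := k) (Smash.inl (ιV v) : Smash k R H) = 0 :=
      (Smash.counitA_inl k H R (ιV v)).trans (hR.counit_ι v)
    have e2 : ∀ u : H ⊗[k] V, counitQR k Q R (TensorProduct.map
        ((act k (Smash k R H) Q).flip x ∘ₗ Smash.inr.toLinearMap)
        ((LinearMap.mul k R).flip r ∘ₗ ιV) u) = 0 := by
      intro u
      induction u using TensorProduct.induction_on with
      | zero => simp
      | add x y hx hy => rw [map_add, map_add, hx, hy, add_zero]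
      | tmul h w =>
        simp [counitQR, BraidedHopfAlgebra.counit_mul (k := k) (H := H), hR.counit_ι]
    rw [map_add, LinearMap.add_apply, map_add, mulL_tmul_one, mulL_one_tmul_ι hR, map_add, e2]
    simp [counitQR, BraidedHopfAlgebra.counit_mul (k := k) (H := Smash k R H), hQ.counit_ι,
      BraidedHopfAlgebra.counit_smul (k := k) (H := Smash k R H), e1]

/-- Both sides are the augmentation of the tensor algebra: they take the value `1` at `1` and vanish
on every product that starts with a generator. -/
theorem counit_lift_eq (hR : IsNicholsAlgebra (H := H) ιV 𝒱)
    (hQ : IsNicholsAlgebra (H := Smash k R H) ιM 𝒬) (hN : IsNicholsAlgebra (H := H) ιN 𝒩)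
    (x : Tc k H (highestWeight k H R M × V)) :
    counit (R := k) (Tc.lift ιN x : N) = counitQR k Q R (projQ ιV ιM x) := by
  suffices h : x ∈ LinearMap.ker (counit ∘ₗ (Tc.lift ιN).toLinearMap -
      counitQR k Q R ∘ₗ projQ ιV ιM) by
    simpa [sub_eq_zero] using h
  refine Tc.mul_induction _ ?_ (fun w y _ => ?_) x
  · simp [projQ_one, counitQR, BraidedHopfAlgebra.counit_one (k := k) (H := H),
      BraidedHopfAlgebra.counit_one (k := k) (H := Smash k R H)]
  · simp only [LinearMap.mem_ker, LinearMap.sub_apply, LinearMap.comp_apply,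
      AlgHom.toLinearMap_apply, map_mul, Tc.lift_ι]
    rw [projQ_ι_mul hQ, counitQR_mulL hR hQ,
      BraidedHopfAlgebra.counit_mul (k := k) (H := H), hN.counit_ι, zero_mul, sub_zero]

/-- The kernels of `T_c(M_H ⊕ V) → N` and of `T_c(M_H ⊕ V) → Q # R` agree. -/
theorem lift_eq_zero_iff (hR : IsNicholsAlgebra (H := H) ιV 𝒱)
    (hM : IsHighestWeight (H := H) 𝒱 ℳ) (hQ : IsNicholsAlgebra (H := Smash k R H) ιM 𝒬)
    (hN : IsNicholsAlgebra (H := H) ιN 𝒩) (x : Tc k H (highestWeight k H R M × V)) :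
    (Tc.lift ιN x : N) = 0 ↔ projQ ιV ιM x = 0 := by
  have hf : ∀ x, (Tc.lift ιN : Tc k H (highestWeight k H R M × V) →ₐ[k] N).toLinearMap.rTensor _
      (Tc.deriv x) = hN.deriv (Tc.lift ιN x) :=
    Tc.rTensor_deriv_eq _ hN.deriv (fun w => LinearMap.mulLeft k (ιN w)) (act k H N)
      (fun w y => by simp [Tc.lift_ι]) (fun h y => hN.lift_smul h y)
      (by simp [hN.deriv_one]) hN.deriv_ι_mul
  have hg : ∀ x, (projQ ιV ιM).rTensor _ (Tc.deriv x) =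
      BraidedBiproduct.deriv hR hM hQ (projQ ιV ιM x) :=
    Tc.rTensor_deriv_eq _ (BraidedBiproduct.deriv hR hM hQ)
      (fun w => mulL k H Q R (ιM w.1 ⊗ₜ 1 + 1 ⊗ₜ ιV w.2)) (actH k H Q R)
      (projQ_ι_mul hQ) (projQ_smul hR hQ)
      (by rw [projQ_one, BraidedBiproduct.deriv_one]) (BraidedBiproduct.deriv_mul hM hQ hR)
  -- Both `N` and `Q # R` have a skew derivation whose constants are the scalars, so the comparison
  -- of kernels can be used in either direction.
  constructor
  · exact Tc.ker_le_of_deriv (Tc.lift ιN).toLinearMap (projQ ιV ιM) hN.deriv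
      (BraidedBiproduct.deriv hR hM hQ) counit (counitQR k Q R) hf hg
      (counit_lift_eq hR hQ hN) (fun y => eq_zero_of_deriv_eq_zero hM hQ hR)
  · refine Tc.ker_le_of_deriv (projQ ιV ιM) (Tc.lift ιN).toLinearMap
      (BraidedBiproduct.deriv hR hM hQ) hN.deriv (counitQR k Q R) counit hg hf
      (fun x => (counit_lift_eq hR hQ hN x).symm) (fun y hy hy0 => ?_)
    rw [hN.eq_of_deriv_eq_zero hy, hy0, zero_smul]

/-- As `π` is an algebra map that is linear over `R # H`, it sends `∑ m_i (v_i m)` to `∑ π(m_i) (v_i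
π(m))`. This depends on `p(x)` only through `∑ π(m_i) ⊗ v_i`, which is `projQ x`. -/
theorem lift_applyTo_eq_zero (hQ : IsNicholsAlgebra (H := Smash k R H) ιM 𝒬)
    {x : Tc k H (highestWeight k H R M × V)} (hx : projQ ιV ιM x = 0)
    (m : Tc k (Smash k R H) M) :
    (Tc.lift ιM (applyTo m (projBiproduct ιV x)) : Q) = 0 := by
  have h1 : ∀ z : Tc k (Smash k R H) M ⊗[k] R,
      (Tc.lift ιM (applyTo m (ofTensor (H := H) z)) : Q) =
      LinearMap.mul' k Q (((act k (Smash k R H) Q).flip (Tc.lift ιM m) ∘ₗ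
        (Smash.inl : R →ₐ[k] Smash k R H).toLinearMap).lTensor Q
        ((Tc.lift ιM : Tc k (Smash k R H) M →ₐ[k] Q).toLinearMap.rTensor R z)) := by
    intro z
    induction z using TensorProduct.induction_on with
    | zero => simp
    | add x y hx hy => simp only [map_add, hx, hy]
    | tmul a r =>
      have h2 := applyTo_sum (H := H) {()} m (fun _ => a) (fun _ => r)
      simp only [Finset.sum_singleton] at h2
      rw [h2, map_mul, hQ.lift_smul]
      simp
  have h3 := h1 (ofTensor.symm (projBiproduct ιV x))
  rw [LinearEquiv.apply_symm_apply, ← projQ_apply, hx, map_zero, map_zero] at h3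
  exact h3

end ProjBiproduct

/-! ### Ideals stable under Hopf algebra actions -/

theorem smul_mem_span_smul {k A T : Type*} [Field k] [Ring A] [Bialgebra k A] [Ring T]
    [Algebra k T] [Module A T] [IsScalarTower k A T] [IsModuleAlgebra k A T] (Z : Set T)
    (a : A) {y : T} (hy : y ∈ TwoSidedIdeal.span {y | ∃ a : A, ∃ z ∈ Z, y = a • z}) :
    a • y ∈ TwoSidedIdeal.span {y | ∃ a : A, ∃ z ∈ Z, y = a • z} := by
  let J := TwoSidedIdeal.span {y | ∃ a : A, ∃ z ∈ Z, y = a • z}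
  -- Acting on a product distributes `Δ(a)` over the factors, so one factor must have its whole
  -- orbit in `J`, not just its image under `a`. For this reason the induction runs with `a`
  -- arbitrary.
  have key : ∀ (a : A) (x y : T), ((∀ b : A, b • x ∈ J) ∨ ∀ b : A, b • y ∈ J) → a • (x * y) ∈ J := by
    intro a x y h
    rw [IsModuleAlgebra.smul_mul (k := k), Smash.diagAct_apply]
    generalize comul (R := k) a = t
    induction t using TensorProduct.induction_on with
    | zero => simp only [map_zero, LinearMap.zero_apply]; exact J.zero_mem
    | add x y hx hy => simp only [map_add, LinearMap.add_apply]; exact J.add_mem hx hy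
    | tmul b c =>
      change (b • x) * (c • y) ∈ J
      rcases h with h | h
      · exact J.mul_mem_right _ _ (h b)
      · exact J.mul_mem_left _ _ (h c)
  induction hy using TwoSidedIdeal.span_induction generalizing a with
  | mem x hx =>
    obtain ⟨b, z, hz, rfl⟩ := hx
    exact TwoSidedIdeal.subset_span ⟨a * b, z, hz, (mul_smul a b z).symm⟩
  | zero => rw [smul_zero]; exact J.zero_mem
  | add x y _ _ hx hy => rw [smul_add]; exact J.add_mem (hx a) (hy a)
  | neg x _ hx => rw [smul_neg]; exact J.neg_mem (hx a)
  | left_absorb b x _ hx => exact key a b x (Or.inr hx)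
  | right_absorb b x _ hx => exact key a x b (Or.inl hx)

/-- Each summand `g(a) b g(S(c))` lies in the ideal, so a two-sided ideal is stable under the
adjoint action. With it the ideal generated by `H X` can be controlled through the elements of `X`
alone. -/
theorem adjoint_mem {k H B : Type*} [Field k] [Ring H] [HopfAlgebra k H] [Ring B] [Algebra k B]
    {g : H →ₐ[k] B} {I : TwoSidedIdeal B} {b : B} (hb : b ∈ I) (t : H ⊗[k] H) :
    LinearMap.mul' k B (TensorProduct.map (LinearMap.mulRight k b ∘ₗ g.toLinearMap)
      (g.toLinearMap ∘ₗ HopfAlgebra.antipode k) t) ∈ I := by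
  induction t using TensorProduct.induction_on with
  | zero => simp only [map_zero]; exact I.zero_mem
  | add x y hx hy => simp only [map_add]; exact I.add_mem hx hy
  | tmul a c => exact I.mul_mem_right _ _ (I.mul_mem_left _ _ hb)

end YDNichols

end

open scoped TensorProduct
open YDNichols

theorem mainTheorem5
    {k H V R M Q N : Type*} [Field k]
    -- `H` is a Hopf algebra with bijective antipode and `V` a Yetter-Drinfel'd module over `H`
    [Ring H] [HopfAlgebra k H]
    (hS : Function.Bijective (HopfAlgebra.antipode k (A := H)))
    [AddCommGroup V] [Module k V] [Module H V] [IsScalarTower k H V] [YetterDrinfeld k H V]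
    -- `R` is the Nichols algebra of `V`, so that `A` is `Smash k R H`
    [Ring R] [Algebra k R] [Module H R] [IsScalarTower k H R] [Coalgebra k R]
    [BraidedHopfAlgebra k H R]
    (ιV : V →ₗ[k] R) (𝒱 : ℕ → Submodule k R) (hR : IsNicholsAlgebra (H := H) ιV 𝒱)
    -- `M` is a graded Yetter-Drinfel'd module over `A` of highest weight
    [AddCommGroup M] [Module k M] [Module (Smash k R H) M] [IsScalarTower k (Smash k R H) M]
    [YetterDrinfeld k (Smash k R H) M]
    (ℳ : ℕ → Submodule k M) (hM : IsHighestWeight (H := H) 𝒱 ℳ)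
    -- `Q` is the Nichols algebra of `M`
    [Ring Q] [Algebra k Q] [Module (Smash k R H) Q] [IsScalarTower k (Smash k R H) Q]
    [Coalgebra k Q] [BraidedHopfAlgebra k (Smash k R H) Q]
    (ιM : M →ₗ[k] Q) (𝒬 : ℕ → Submodule k Q)
    (hQ : IsNicholsAlgebra (H := Smash k R H) ιM 𝒬)
    -- `N` is the Nichols algebra of `M_H ⊕ V`
    [Ring N] [Algebra k N] [Module H N] [IsScalarTower k H N] [Coalgebra k N]
    [BraidedHopfAlgebra k H N]
    (ιN : (highestWeight k H R M × V) →ₗ[k] N) (𝒩 : ℕ → Submodule k N)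
    (hN : IsNicholsAlgebra (H := H) ιN 𝒩)
    (X : Set (Tc k H (highestWeight k H R M × V)))
    (hX : TwoSidedIdeal.span {y | ∃ h : H, ∃ x ∈ X, y = h • x} =
      TwoSidedIdeal.ker (Tc.lift ιN : Tc k H (highestWeight k H R M × V) →ₐ[k] N)) :
    TwoSidedIdeal.span {y | ∃ a : Smash k R H, ∃ z ∈ hatSet ιV X, y = a • z} =
      TwoSidedIdeal.ker (Tc.lift ιM : Tc k (Smash k R H) M →ₐ[k] Q) := by
  have hJ : ∀ (a : Smash k R H),
      ∀ y ∈ TwoSidedIdeal.span {y | ∃ a : Smash k R H, ∃ z ∈ hatSet ιV X, y = a • z},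
      a • y ∈ TwoSidedIdeal.span {y | ∃ a : Smash k R H, ∃ z ∈ hatSet ιV X, y = a • z} :=
    fun a y hy => smul_mem_span_smul (k := k) _ a hy
  refine le_antisymm (TwoSidedIdeal.span_le.2 ?_) fun y hy => ?_
  · rintro _ ⟨a, _, ⟨x, hx, m, rfl⟩, rfl⟩
    have hxq : x ∈ TwoSidedIdeal.ker
        (Tc.lift ιN : Tc k H (highestWeight k H R M × V) →ₐ[k] N) := by
      rw [← hX]
      exact TwoSidedIdeal.subset_span ⟨1, x, hx, (one_smul H x).symm⟩
    have hx0 := (lift_eq_zero_iff hR hM hQ hN x).1 ((TwoSidedIdeal.mem_ker _).1 hxq)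
    refine (TwoSidedIdeal.mem_ker _).2 ?_
    rw [hQ.lift_smul, lift_applyTo_eq_zero hQ hx0, smul_zero]
  -- Lifting `y # 1` through `p` transports the question to the tensor algebra of `M_H ⊕ V`, where
  -- generators of the kernel are known.
  · obtain ⟨t, ht, ht'⟩ := exists_projBiproduct_eq hR hM y
    have ht0 : projQ ιV ιM t = 0 := by
      rw [projQ_apply, ht', LinearMap.rTensor_tmul, AlgHom.toLinearMap_apply,
        (TwoSidedIdeal.mem_ker _).1 hy, TensorProduct.zero_tmul]
    have htX : t ∈ TwoSidedIdeal.span {y | ∃ h : H, ∃ x ∈ X, y = h • x} := by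
      rw [hX]
      exact (TwoSidedIdeal.mem_ker _).2 ((lift_eq_zero_iff hR hM hQ hN t).2 ht0)
    -- The ideal of operators that map `T_c(M)` into the target ideal contains `p(x)` for `x ∈ X` by
    -- the definition of `hatSet`, and it contains `p(h x)` because that is adjoint to `p(x)`. Hence
    -- its preimage under `p` contains the whole kernel of `q`.
    have hle : TwoSidedIdeal.span {y | ∃ h : H, ∃ x ∈ X, y = h • x} ≤
        (BraidedBiproduct.annihilatorMod hJ).comap (projSmash H M ιV) := by
      refine TwoSidedIdeal.span_le.2 ?_
      rintro _ ⟨h, x, hx, rfl⟩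
      have hPx : projSmash H M ιV x ∈ BraidedBiproduct.annihilatorMod hJ := by
        refine (BraidedBiproduct.mem_annihilatorMod hJ _).2 fun m => ?_
        rw [repr_projSmash]
        exact TwoSidedIdeal.subset_span ⟨1, _, ⟨x, hx, m, rfl⟩, (one_smul _ _).symm⟩
      refine (TwoSidedIdeal.mem_comap _).2 ?_
      rw [projSmash_smul hR]
      exact adjoint_mem hPx _
    have hy' := (TwoSidedIdeal.mem_comap _).1 (hle htX)
    rw [ht] at hy'
    -- The operator `y # 1` sends `1` to `y`.
    have h1 := (BraidedBiproduct.mem_annihilatorMod hJ _).1 hy' 1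
    rwa [BraidedBiproduct.repr_inl, mul_one] at h1
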